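/- Let $G=(V,E^+\cup E^-,w)$ be a finite directed graph with real edge weights $w$, whose edges are partitioned into a set $E^+$ of *nonnegative* edges and a set $E^-$ of *negative* edges, such that $w(e)\ge 0$ for all $e\in E^+$ (edges of $E^-$ may have any weight). Let $n=|V|\ge 1$, $m=|E^+\cup E^-|$, $k=|E^-|$, and assume, as is done throughout, that $m\ge 2n$ and that the tail of every edge of $E^-$ has no other outgoing edge; the tails of edges of $E^-$ are called *negative vertices*. For $u,v\in V$ let $\mathrm{dist}^1(u,v)$ be the minimum weight of a (not necessarily simple) path from $u$ to $v$ that contains at most one occurrence of an edge of $E^-$ ($\infty$ if there is none). A *negative sandwich* is a triple $(x,U,y)$ with $x,y\in V$ and $U$ a set of negative vertices such that $\mathrm{dist}^1(x,u)<0$ and $\mathrm{dist}^1(u,y)<0$ for all $u\in U$. A *1-hop independent set* is a set $I$ of negative vertices such that $\mathrm{dist}^1(u,v)\ge 0$ for all $u,v\in I$. **Corollary.** There exist a randomized (Las Vegas) real-RAM algorithm and an absolute constant $\delta>0$ such that, on every such input $G$, whenever the algorithm halts it does one of the following: 1. it correctly reports that $G$ contains a negative-weight cycle, 2. it returns a negative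 sandwich $(x,U,y)$ with $|U|\ge \delta k^{1/3}$, or 3. it returns a 1-hop independent set $I$ with $|I|\ge\delta k^{1/3}$; and its running time is $O(m\log^2 n)$ with high probability: for every $a\in\mathbb{N}$ there is a constant $C$ such that on every such input it halts within $Cm\log^2 n$ steps with probability at least $1-n^{-a}$. Here the real RAM has unit-cost copying, addition, subtraction, negation and comparison of real numbers, unit-cost elementary integer operations, array access and branching, and unit-cost uniform random integers from $\{0,\dots,r\}$ for a stored integer $r$. The input is given as the numbers $n,m$ and the list of the edges, in arbitrary order, with their endpoints, classification and weights. -/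

import Mathlib

namespace FindSandwich

/-! ### Graphs, hop-limited distances, negative sandwiches, independent sets -/

/-- A finite directed graph with vertex set `Fin n`, real edge weights, and edge set `E⁺ ∪ E⁻`
listed, in an arbitrary order, as `Fin m`.  There are no parallel edges (an edge is determined by
its ordered pair of endpoints).  The classification of the edges into negative ones (`Eneg`) and
nonnegative ones (all others) is part of the data: an edge of `Eneg` may have any real weight. -/
structure WDigraph (n m : ℕ) where
  tail : Fin m → Fin n
  head : Fin m → Fin n
  Eneg : Finset (Fin m)
  w : Fin m → ℝ
  simple : Function.Injective fun e => (tail e, head e)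

namespace WDigraph

variable {n m : ℕ} (G : WDigraph n m)

/-- Paths of `G` (not necessarily simple). -/
inductive Walk : Fin n → Fin n → Type
  | nil (u : Fin n) : Walk u u
  | cons {u v : Fin n} (e : Fin m) (hu : G.tail e = u) (p : Walk (G.head e) v) : Walk u v

variable {G}

/-- The number of occurrences of negative edges (hops) on a path. -/
def Walk.hops : {u v : Fin n} → G.Walk u v → ℕ
  | _, _, .nil _ => 0
  | _, _, .cons e _ p => (if e ∈ G.Eneg then 1 else 0) + p.hops

/-- The total weight of a path. -/
noncomputable def Walk.weight : {u v : Fin n} → G.Walk u v → ℝ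
  | _, _, .nil _ => 0
  | _, _, .cons e _ p => G.w e + p.weight

variable (G)

/-- The `h`-hop distance from `u` to `v`; it is `⊤` if there is no `h`-hop path. -/
noncomputable def hopDist (h : ℕ) (u v : Fin n) : EReal :=
  ⨅ p : {p : G.Walk u v // p.hops ≤ h}, (p.1.weight : EReal)

/-- A path of negative weight that starts and ends at the same vertex. -/
def HasNegativeCycle : Prop := ∃ (v : Fin n) (p : G.Walk v v), p.weight < 0

/-- A negative vertex: the tail of an edge of `E⁻`. -/
def IsNegativeVertex (u : Fin n) : Prop := ∃ e ∈ G.Eneg, G.tail e = u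

def HopRelated (h : ℕ) (u v : Fin n) : Prop := G.hopDist h u v < 0 ∨ G.hopDist h v u < 0

structure IsNegativeSandwich (x : Fin n) (U : Finset (Fin n)) (y : Fin n) : Prop where
  negative : ∀ u ∈ U, G.IsNegativeVertex u
  left : ∀ u ∈ U, G.hopDist 1 x u < 0
  right : ∀ u ∈ U, G.hopDist 1 u y < 0

structure IsOneHopIndependent (I : Finset (Fin n)) : Prop where
  negative : ∀ u ∈ I, G.IsNegativeVertex u
  independent : ∀ x ∈ I, ∀ y ∈ I, ¬ G.HopRelated 1 x y

end WDigraph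

/-! ### A randomized real RAM

The memory consists of integer registers, real registers, integer arrays and real arrays.  A program
names registers and arrays by constants; arrays are indexed by the contents of integer registers.
The integer operations are copying, successor, truncated subtraction and halving, so that no integer
in memory ever exceeds the largest integer initially present or named in the program plus the number
of steps.  The operations on real numbers are copying, addition, subtraction, negation and
comparison.  Every instruction and every evaluation of a test takes one step. -/

structure State where
  reg : ℕ → ℕ
  arr : ℕ → ℕ → ℕ
  rreg : ℕ → ℝ
  rarr : ℕ → ℕ → ℝ

namespace State

def setReg (s : State) (x v : ℕ) : State := { s with reg := Function.update s.reg x v }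

def setArr (s : State) (a i v : ℕ) : State :=
  { s with arr := Function.update s.arr a (Function.update (s.arr a) i v) }

def setRReg (s : State) (x : ℕ) (v : ℝ) : State := { s with rreg := Function.update s.rreg x v }

def setRArr (s : State) (a i : ℕ) (v : ℝ) : State :=
  { s with rarr := Function.update s.rarr a (Function.update (s.rarr a) i v) }

end State

inductive Instr
  | const (x c : ℕ)
  | copy (x y : ℕ)
  | succ (x y : ℕ)
  | sub (x y z : ℕ)
  | half (x y : ℕ)
  | load (x a i : ℕ)
  | store (a i y : ℕ)
  | rcopy (x y : ℕ)
  | radd (x y z : ℕ)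
  | rsub (x y z : ℕ)
  | rneg (x y : ℕ)
  | rload (x a i : ℕ)
  | rstore (a i y : ℕ)
  | rand (x y : ℕ)

/-- The effect of an instruction.  `rand x y` puts into register `x` a fresh uniformly random
element of `{0, …, r}`, where `r` is the content of register `y`. -/
noncomputable def Instr.exec (s : State) : Instr → PMF State
  | const x c => PMF.pure (s.setReg x c)
  | copy x y => PMF.pure (s.setReg x (s.reg y))
  | succ x y => PMF.pure (s.setReg x (s.reg y + 1))
  | sub x y z => PMF.pure (s.setReg x (s.reg y - s.reg z))
  | half x y => PMF.pure (s.setReg x (s.reg y / 2))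
  | load x a i => PMF.pure (s.setReg x (s.arr a (s.reg i)))
  | store a i y => PMF.pure (s.setArr a (s.reg i) (s.reg y))
  | rcopy x y => PMF.pure (s.setRReg x (s.rreg y))
  | radd x y z => PMF.pure (s.setRReg x (s.rreg y + s.rreg z))
  | rsub x y z => PMF.pure (s.setRReg x (s.rreg y - s.rreg z))
  | rneg x y => PMF.pure (s.setRReg x (-s.rreg y))
  | rload x a i => PMF.pure (s.setRReg x (s.rarr a (s.reg i)))
  | rstore a i y => PMF.pure (s.setRArr a (s.reg i) (s.rreg y))
  | rand x y =>
      (PMF.uniformOfFintype (Fin (s.reg y + 1))).map fun r => s.setReg x (r : ℕ)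

inductive Test
  | lt (x y : ℕ)
  | eq (x y : ℕ)
  | rlt (x y : ℕ)

def Test.Holds (s : State) : Test → Prop
  | lt x y => s.reg x < s.reg y
  | eq x y => s.reg x = s.reg y
  | rlt x y => s.rreg x < s.rreg y

/-- Programs. -/
inductive Prog
  | skip
  | instr (i : Instr)
  | seq (p q : Prog)
  | ite (b : Test) (p q : Prog)
  | while (b : Test) (p : Prog)

/-- A configuration: the stack of program parts still to be executed, and the memory.  The machine
has halted when the stack is empty. -/
abbrev Config := List Prog × State

open Classical in
/-- One step of the machine. -/
noncomputable def step : Config → PMF Config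
  | ([], s) => PMF.pure ([], s)
  | (.skip :: K, s) => PMF.pure (K, s)
  | (.instr i :: K, s) => (i.exec s).map fun s' => (K, s')
  | (.seq p q :: K, s) => PMF.pure (p :: q :: K, s)
  | (.ite b p q :: K, s) => PMF.pure ((if b.Holds s then p else q) :: K, s)
  | (.while b p :: K, s) => PMF.pure (if b.Holds s then p :: .while b p :: K else K, s)

/-- The distribution of the configuration after `t` steps. -/
noncomputable def run (c : Config) : ℕ → PMF Config
  | 0 => PMF.pure c
  | t + 1 => (run c t).bind step

def Halted (c : Config) : Prop := c.1 = []

/-! ### Input and output conventions -/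

/-- The initial memory for input `G`: register `0` holds `n`, register `1` holds `m`, and for every
edge `e < m` cell `e` of the integer arrays `0`, `1`, `2` and of the real array `0` holds the tail of
`e`, the head of `e`, a bit telling whether `e ∈ E⁻`, and the weight of `e`.  Everything else
is `0`. -/
noncomputable def inputState {n m : ℕ} (G : WDigraph n m) : State where
  reg x := if x = 0 then n else if x = 1 then m else 0
  arr a i :=
    if h : i < m then
      if a = 0 then G.tail ⟨i, h⟩
      else if a = 1 then G.head ⟨i, h⟩
      else if a = 2 then (if (⟨i, h⟩ : Fin m) ∈ G.Eneg then 1 else 0)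
      else 0
    else 0
  rreg _ := 0
  rarr a i := if h : i < m then (if a = 0 then G.w ⟨i, h⟩ else 0) else 0

/-- The three kinds of answers. -/
inductive Answer (n : ℕ)
  | cycle
  | sandwich (x : Fin n) (U : Finset (Fin n)) (y : Fin n)
  | independent (I : Finset (Fin n))

/-- Register `1` holds the cardinality `c` of `S`, and the first `c` cells of the integer
array `0` list the elements of `S`. -/
def ListsSet {n : ℕ} (s : State) (S : Finset (Fin n)) : Prop :=
  s.reg 1 = S.card ∧ ∀ v : Fin n, v ∈ S ↔ ∃ i < s.reg 1, s.arr 0 i = v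

/-- The memory `s` presents the given answer; register `0` holds the kind of the answer, and
registers `2` and `3` hold the vertices `x` and `y` of a sandwich. -/
def Presents {n : ℕ} (s : State) : Answer n → Prop
  | .cycle => s.reg 0 = 0
  | .sandwich x U y => s.reg 0 = 1 ∧ ListsSet s U ∧ s.reg 2 = x ∧ s.reg 3 = y
  | .independent I => s.reg 0 = 2 ∧ ListsSet s I

/-- The answer is correct for `G`, where the returned set has size at least `δ * k ^ (1/3)`. -/
def Answer.Correct {n m : ℕ} (G : WDigraph n m) (δ : ℝ) : Answer n → Prop
  | .cycle => G.HasNegativeCycle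
  | .sandwich x U y =>
      G.IsNegativeSandwich x U y ∧ δ * (G.Eneg.card : ℝ) ^ ((1 : ℝ) / 3) ≤ (U.card : ℝ)
  | .independent I =>
      G.IsOneHopIndependent I ∧ δ * (G.Eneg.card : ℝ) ^ ((1 : ℝ) / 3) ≤ (I.card : ℝ)

end FindSandwich

/-!
# Finding a negative sandwich or a 1-hop independent set

The tail of an edge of `E⁻` has no other outgoing edge, so a negative vertex is represented by its
edge `e ∈ E⁻`.  Write `e → f` if `dist¹ < 0` from the tail of `e` to the tail of `f`.  Let `k` be
the number of edges of `E⁻`.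

**One search decides many relations.**  A one-hop path of negative weight from the tail of `e` must
begin with `e` and then use nonnegative edges only (`hopDist_one_lt_zero_iff`).  Hence one run of
Dijkstra's algorithm over `E⁺` from the heads of a set `S ⊆ E⁻`, with initial labels `w e`, tells
for every `f` whether some `e ∈ S` has `e → f`, and one run against the edges tells whether
`f → e` for some `e ∈ S` (`search_spec`).  Only the sign of a distance matters, so labels are capped
at `0`.  The priority queue is a tournament tree on all vertices, and a search takes time
`O(m log n)` (`dijkstra_spec`).

**A stage.**  Let `U` be a set of `N` negative edges and let `r`, `τ` satisfy `4 (r - 1) τ ≤ N`.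
A stage draws `r` elements of `U` with replacement and takes the first one as a probe `v`.  If
`v → v`, there is a negative cycle.  If at least `τ` elements of `U` are related to `v`, the stage
returns these elements.  Otherwise it deletes from the sample repetitions and the elements related
to a sampled one, which takes one search in the opposite direction; what is left is independent.
Call `b` *bad* if it is related to itself
or to at least `τ` elements.  If half of `U` is bad, then so is the probe with probability at least
`1 / 2`.  If not, then a sampled element that is not bad is deleted with probability at most
`(r - 1) τ / N ≤ 1 / 4`, so that a quarter of the sample survives in expectation.  In both cases the
stage succeeds with probability at least `1 / 8` (`card_pow_le_card_filter`, `stage_spec`), where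
an independent set counts as success if it has `r / 8` elements.

**A trial.**  With `r` and `regSmall` of the order `k ^ (1/3)` and `regBig` of the order
`k ^ (2/3)`, a first stage on all of `E⁻`, against the edges, yields a negative cycle, a large
independent set, or a `y` together with at least `regBig` edges `e → y`.  In the last case a second
stage on these edges, along the edges, yields a negative cycle, a large independent set, or an `x`
with `x → e` for at least `regSmall` of them, which is a sandwich (`trial_spec`).  A trial succeeds
with probability at least `1 / 64`, and it takes time `O(m log n)`; repeating it until it succeeds
takes `O(log n)` trials with high probability (`haltProb_while_ge`, `pow_trials_le`), and no wrong
answer is ever given (`algorithm_sound`).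

**Reasoning about programs.**  Deterministic program parts are treated with a big-step semantics
(`BigStep`), with Hoare triples that bound the time (`Tri`) and with a frame rule (`Frame`): a
location that no instruction of a program writes to keeps its contents.  Randomness enters only by
drawing the samples (`Spread`); `PTri` is the resulting triple with a success probability.
-/

namespace FindSandwich

/-! ### Deterministic execution -/

/-- Whether an instruction draws a random number. -/
def Instr.isRand : Instr → Bool
  | .rand _ _ => true
  | _ => false

/-- The effect of a deterministic instruction; `rand` is given a dummy effect. -/
noncomputable def Instr.eff (s : State) : Instr → State
  | .const x c => s.setReg x c
  | .copy x y => s.setReg x (s.reg y)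
  | .succ x y => s.setReg x (s.reg y + 1)
  | .sub x y z => s.setReg x (s.reg y - s.reg z)
  | .half x y => s.setReg x (s.reg y / 2)
  | .load x a i => s.setReg x (s.arr a (s.reg i))
  | .store a i y => s.setArr a (s.reg i) (s.reg y)
  | .rcopy x y => s.setRReg x (s.rreg y)
  | .radd x y z => s.setRReg x (s.rreg y + s.rreg z)
  | .rsub x y z => s.setRReg x (s.rreg y - s.rreg z)
  | .rneg x y => s.setRReg x (-s.rreg y)
  | .rload x a i => s.setRReg x (s.rarr a (s.reg i))
  | .rstore a i y => s.setRArr a (s.reg i) (s.rreg y)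
  | .rand _ _ => s

theorem Instr.exec_eq_pure {i : Instr} (h : i.isRand = false) (s : State) :
    i.exec s = PMF.pure (i.eff s) := by
  cases i <;> first | rfl | simp [Instr.isRand] at h

/-- `BigStep p s t s'`: started in memory `s`, the program `p` terminates without drawing a random
number after exactly `t` steps, with memory `s'`. -/
inductive BigStep : Prog → State → ℕ → State → Prop
  | skip (s : State) : BigStep .skip s 1 s
  | instr (s : State) {i : Instr} (h : i.isRand = false) : BigStep (.instr i) s 1 (i.eff s)
  | seq {p q : Prog} {s s' s'' : State} {t t' : ℕ} (h : BigStep p s t s')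
      (h' : BigStep q s' t' s'') : BigStep (.seq p q) s (t + t' + 1) s''
  | ite_true {b : Test} {p q : Prog} {s s' : State} {t : ℕ} (hb : b.Holds s)
      (h : BigStep p s t s') : BigStep (.ite b p q) s (t + 1) s'
  | ite_false {b : Test} {p q : Prog} {s s' : State} {t : ℕ} (hb : ¬ b.Holds s)
      (h : BigStep q s t s') : BigStep (.ite b p q) s (t + 1) s'
  | while_true {b : Test} {p : Prog} {s s' s'' : State} {t t' : ℕ} (hb : b.Holds s)
      (h : BigStep p s t s') (h' : BigStep (.while b p) s' t' s'') :
      BigStep (.while b p) s (t + t' + 1) s''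
  | while_false {b : Test} {p : Prog} {s : State} (hb : ¬ b.Holds s) :
      BigStep (.while b p) s 1 s

theorem run_add (c : Config) (a b : ℕ) :
    run c (a + b) = (run c a).bind fun c' => run c' b := by
  induction b with
  | zero => simp [run]
  | succ b ih => rw [← add_assoc, run, ih, PMF.bind_bind]; rfl

theorem run_one (c : Config) : run c 1 = step c := by simp [run]

theorem run_of_step {c c' : Config} (h : step c = PMF.pure c') (t : ℕ) :
    run c (t + 1) = run c' t := by
  rw [add_comm, run_add, run_one, h, PMF.pure_bind]

/-- The big-step semantics agrees with the machine, whatever remains on the stack. -/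
theorem BigStep.run_eq {p : Prog} {s s' : State} {t : ℕ} (h : BigStep p s t s') (K : List Prog) :
    run (p :: K, s) t = PMF.pure (K, s') := by
  induction h generalizing K with
  | skip s => simp [run, step]
  | instr s h => simp [run, step, Instr.exec_eq_pure h, PMF.pure_map]
  | @seq p q s s' s'' t t' _ _ ih ih' =>
    rw [run_of_step (c' := (p :: q :: K, s)) (by simp [step]), run_add, ih, PMF.pure_bind, ih']
  | @ite_true b p q s s' t hb _ ih =>
    rw [run_of_step (c' := (p :: K, s)) (by simp [step, hb]), ih]
  | @ite_false b p q s s' t hb _ ih =>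
    rw [run_of_step (c' := (q :: K, s)) (by simp [step, hb]), ih]
  | @while_true b p s s' s'' t t' hb _ _ ih ih' =>
    rw [run_of_step (c' := (p :: .while b p :: K, s)) (by simp [step, hb]), run_add, ih,
      PMF.pure_bind, ih']
  | while_false hb => simp [run, step, hb]

/-! ### Locations and frames -/

/-- The named parts of the memory. -/
inductive Loc
  | reg (x : ℕ)
  | arr (a : ℕ)
  | rreg (x : ℕ)
  | rarr (a : ℕ)
  deriving DecidableEq

/-- The location an instruction writes to. -/
def Instr.target : Instr → Loc
  | .const x _ | .copy x _ | .succ x _ | .sub x _ _ | .half x _ | .load x _ _ | .rand x _ => .reg x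
  | .store a _ _ => .arr a
  | .rcopy x _ | .radd x _ _ | .rsub x _ _ | .rneg x _ | .rload x _ _ => .rreg x
  | .rstore a _ _ => .rarr a

/-- Whether some instruction of a program writes to a given location. -/
def Prog.writes : Prog → Loc → Bool
  | .skip, _ => false
  | .instr i, l => decide (i.target = l)
  | .seq p q, l => p.writes l || q.writes l
  | .ite _ p q, l => p.writes l || q.writes l
  | .while _ p, l => p.writes l

/-- Two memories have the same contents at a location. -/
def Same (s s' : State) : Loc → Prop
  | .reg x => s'.reg x = s.reg x
  | .arr a => s'.arr a = s.arr a
  | .rreg x => s'.rreg x = s.rreg x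
  | .rarr a => s'.rarr a = s.rarr a

theorem Same.refl (s : State) (l : Loc) : Same s s l := by cases l <;> rfl

theorem Same.trans {s s' s'' : State} {l : Loc} (h : Same s s' l) (h' : Same s' s'' l) :
    Same s s'' l := by
  cases l <;> exact Eq.trans h' h

section simps
variable (s : State) (x y v a b i : ℕ) (r : ℝ)
@[simp] theorem State.setReg_reg : (s.setReg x v).reg y = if y = x then v else s.reg y := by
  simp [State.setReg, Function.update_apply]
@[simp] theorem State.setReg_arr : (s.setReg x v).arr = s.arr := rfl
@[simp] theorem State.setReg_rreg : (s.setReg x v).rreg = s.rreg := rfl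
@[simp] theorem State.setReg_rarr : (s.setReg x v).rarr = s.rarr := rfl
@[simp] theorem State.setArr_reg : (s.setArr a i v).reg = s.reg := rfl
@[simp] theorem State.setArr_arr : (s.setArr a i v).arr b =
    if b = a then Function.update (s.arr a) i v else s.arr b := by
  simp [State.setArr, Function.update_apply]
@[simp] theorem State.setArr_rreg : (s.setArr a i v).rreg = s.rreg := rfl
@[simp] theorem State.setArr_rarr : (s.setArr a i v).rarr = s.rarr := rfl
@[simp] theorem State.setRReg_reg : (s.setRReg x r).reg = s.reg := rfl
@[simp] theorem State.setRReg_arr : (s.setRReg x r).arr = s.arr := rfl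
@[simp] theorem State.setRReg_rreg : (s.setRReg x r).rreg y = if y = x then r else s.rreg y := by
  simp [State.setRReg, Function.update_apply]
@[simp] theorem State.setRReg_rarr : (s.setRReg x r).rarr = s.rarr := rfl
@[simp] theorem State.setRArr_reg : (s.setRArr a i r).reg = s.reg := rfl
@[simp] theorem State.setRArr_arr : (s.setRArr a i r).arr = s.arr := rfl
@[simp] theorem State.setRArr_rreg : (s.setRArr a i r).rreg = s.rreg := rfl
@[simp] theorem State.setRArr_rarr : (s.setRArr a i r).rarr b =
    if b = a then Function.update (s.rarr a) i r else s.rarr b := by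
  simp [State.setRArr, Function.update_apply]
end simps

theorem Instr.same_eff {i : Instr} {l : Loc} (h : i.target ≠ l) (s : State) :
    Same s (i.eff s) l := by
  cases i <;> cases l <;> simp_all [Instr.target, Same, Instr.eff, eq_comm]

/-- The memory `s'` differs from `s` at most in the locations that `p` writes to. -/
def Frame (p : Prog) (s s' : State) : Prop := ∀ l, p.writes l = false → Same s s' l

/-- The frame rule: a program changes only the locations it writes to. -/
theorem BigStep.frame {p : Prog} {s s' : State} {t : ℕ} (h : BigStep p s t s') : Frame p s s' := by
  intro l hl
  induction h with
  | skip s => exact Same.refl _ _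
  | instr s h => exact Instr.same_eff (by simpa [Prog.writes] using hl) s
  | seq _ _ ih ih' =>
    simp only [Prog.writes, Bool.or_eq_false_iff] at hl
    exact (ih hl.1).trans (ih' hl.2)
  | ite_true hb _ ih =>
    simp only [Prog.writes, Bool.or_eq_false_iff] at hl
    exact ih hl.1
  | ite_false hb _ ih =>
    simp only [Prog.writes, Bool.or_eq_false_iff] at hl
    exact ih hl.2
  | while_true hb _ _ ih ih' => exact (ih hl).trans (ih' hl)
  | while_false hb => exact Same.refl _ _

namespace Frame
variable {p : Prog} {s s' : State} (h : Frame p s s')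
include h
theorem reg (x : ℕ) (hx : p.writes (.reg x) = false := by rfl) : s'.reg x = s.reg x := h (.reg x) hx
theorem arr (x : ℕ) (hx : p.writes (.arr x) = false := by rfl) : s'.arr x = s.arr x := h (.arr x) hx
theorem rreg (x : ℕ) (hx : p.writes (.rreg x) = false := by rfl) : s'.rreg x = s.rreg x :=
  h (.rreg x) hx
theorem rarr (x : ℕ) (hx : p.writes (.rarr x) = false := by rfl) : s'.rarr x = s.rarr x :=
  h (.rarr x) hx
end Frame

/-! ### Triples with time bounds -/

/-- Started in `s`, the program `p` terminates without drawing random numbers, within `B` steps,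
in a memory satisfying `Q`. -/
def Tri (p : Prog) (s : State) (B : ℕ) (Q : State → Prop) : Prop :=
  ∃ t s', BigStep p s t s' ∧ t ≤ B ∧ Q s'

namespace Tri
variable {p q : Prog} {s : State} {B B₁ B₂ : ℕ} {Q Q₁ Q₂ : State → Prop} {b : Test}

/-- Weakening; the new postcondition may use that the program changes only what it writes to. -/
theorem mono (h : Tri p s B₁ Q₁) (hB : B₁ ≤ B) (hQ : ∀ s', Q₁ s' → Frame p s s' → Q s') :
    Tri p s B Q := by
  obtain ⟨t, s', h, ht, hs⟩ := h
  exact ⟨t, s', h, ht.trans hB, hQ _ hs h.frame⟩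

theorem mono_time (h : Tri p s B₁ Q) (hB : B₁ ≤ B) : Tri p s B Q := h.mono hB fun _ h _ => h

theorem skip (h : Q s) : Tri .skip s 1 Q := ⟨1, s, .skip s, le_rfl, h⟩

theorem instr {i : Instr} (hi : i.isRand = false) (h : Q (i.eff s)) : Tri (.instr i) s 1 Q :=
  ⟨1, _, .instr s hi, le_rfl, h⟩

theorem seq (h₁ : Tri p s B₁ Q₁) (h₂ : ∀ s', Q₁ s' → Frame p s s' → Tri q s' B₂ Q) :
    Tri (.seq p q) s (B₁ + B₂ + 1) Q := by
  obtain ⟨t, s', h, ht, hs⟩ := h₁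
  obtain ⟨t', s'', h', ht', hs'⟩ := h₂ s' hs h.frame
  exact ⟨_, s'', .seq h h', by omega, hs'⟩

theorem ite (h₁ : b.Holds s → Tri p s B Q) (h₂ : ¬ b.Holds s → Tri q s B Q) :
    Tri (.ite b p q) s (B + 1) Q := by
  by_cases hb : b.Holds s
  · obtain ⟨t, s', h, ht, hs⟩ := h₁ hb
    exact ⟨_, s', .ite_true hb h, by omega, hs⟩
  · obtain ⟨t, s', h, ht, hs⟩ := h₂ hb
    exact ⟨_, s', .ite_false hb h, by omega, hs⟩

/-- The rule for loops.  The ghost value `g` records the progress, and `Φ g` bounds the time still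
needed. -/
theorem while_inv {γ : Type*} (Inv : γ → State → Prop) (Φ : γ → ℕ)
    (hstep : ∀ g s, Inv g s → b.Holds s →
      ∃ B, Tri p s B fun s' => ∃ g', Inv g' s' ∧ B + 1 + Φ g' ≤ Φ g)
    {g : γ} (h0 : Inv g s) :
    Tri (.while b p) s (Φ g + 1) fun s' => (∃ g', Inv g' s') ∧ ¬ b.Holds s' := by
  induction hn : Φ g using Nat.strong_induction_on generalizing g s with
  | _ n ih =>
    by_cases hb : b.Holds s
    · obtain ⟨B, t, s', h, ht, g', hg', hΦ⟩ := hstep g s h0 hb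
      obtain ⟨t', s'', h', ht', hs⟩ := ih (Φ g') (by omega) hg' rfl
      exact ⟨_, s'', .while_true hb h h', by omega, hs⟩
    · exact ⟨1, s, .while_false hb, by omega, ⟨g, h0⟩, hb⟩

end Tri

/-- Straight-line programs. -/
def block : List Instr → Prog
  | [] => .skip
  | i :: l => .seq (.instr i) (block l)

/-- The postcondition of a straight-line program is checked by executing it symbolically. -/
theorem Tri.block {l : List Instr} {s : State} {Q : State → Prop}
    (hl : ∀ i ∈ l, i.isRand = false) (h : Q (l.foldl (fun s i => i.eff s) s)) :
    Tri (block l) s (2 * l.length + 1) Q := by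
  induction l generalizing s with
  | nil => exact Tri.skip h
  | cons i l ih =>
    refine (Tri.seq (Q₁ := fun s' => s' = i.eff s) (Tri.instr (hl i (by simp)) rfl)
      fun s' hs' _ => ih (fun j hj => hl j (by simp [hj])) ?_).mono_time ?_
    · simpa [hs'] using h
    · simp; omega

/-- The loop in which register `i` runs through the numbers below the content of register `b`. -/
def forN (i b : ℕ) (body : Prog) : Prog :=
  .seq (.instr (.const i 0)) (.while (.lt i b) (.seq body (.instr (.succ i i))))

/-- The rule for counting loops, with an invariant `Inv j` that holds before the pass with counter
`j`. The postcondition of the body refers to the memory in which the counter has been advanced. -/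
theorem Tri.forN {i b : ℕ} {body : Prog} {s : State} {B N : ℕ} (Inv : ℕ → State → Prop)
    (hN : s.reg b = N) (hib : b ≠ i) (hwi : body.writes (.reg i) = false)
    (hwb : body.writes (.reg b) = false) (h0 : Inv 0 (s.setReg i 0))
    (hstep : ∀ j s, j < N → s.reg i = j → s.reg b = N → Inv j s →
      Tri body s B fun s' => Inv (j + 1) (s'.setReg i (j + 1))) :
    Tri (forN i b body) s (N * (B + 3) + 3) (Inv N) := by
  refine (Tri.seq (Q₁ := fun s' => s' = s.setReg i 0) (Tri.instr rfl rfl) fun s' hs' _ =>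
    (Tri.while_inv (fun j s' => Inv j s' ∧ s'.reg i = j ∧ s'.reg b = N ∧ j ≤ N)
    (fun j => (N - j) * (B + 3)) ?_ (g := 0) ?_).mono le_rfl ?_).mono_time ?_
  · rintro j s ⟨hI, hj, hb, -⟩ hlt
    replace hlt : j < N := by simpa [Test.Holds, hj, hb] using hlt
    refine ⟨B + 1 + 1, (hstep j s hlt hj hb hI).seq fun s' hs' hf => Tri.instr rfl ?_⟩
    have hi : s'.reg i = j := (hf.reg i hwi).trans hj
    have hb' : s'.reg b = N := (hf.reg b hwb).trans hb
    refine ⟨j + 1, ⟨by simpa [Instr.eff, hi] using hs', by simp [Instr.eff, hi],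
      by simp [Instr.eff, hib, hb'], hlt⟩, ?_⟩
    obtain ⟨d, rfl⟩ : ∃ d, N = j + 1 + d := ⟨_, (Nat.add_sub_cancel' hlt).symm⟩
    rw [show j + 1 + d - j = d + 1 by omega, show j + 1 + d - (j + 1) = d by omega]
    ring_nf; omega
  · subst hs'
    exact ⟨h0, by simp, by simp [hib, hN], Nat.zero_le _⟩
  · rintro s' ⟨⟨j, hI, hj, hb, hjN⟩, hnb⟩ _
    have : ¬ j < N := by simpa [Test.Holds, hj, hb] using hnb
    obtain rfl : j = N := by omega
    exact hI
  · simp; omega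

/-! ### Halting probabilities -/

/-- The probability of having halted after `t` steps. -/
noncomputable def haltProb (c : Config) (t : ℕ) : ℝ :=
  ((run c t).toOuterMeasure {c | Halted c}).toReal

/-- Within `t` steps, a run from `c` may halt in the configuration `d`. -/
def MayHalt (c d : Config) (t : ℕ) : Prop := d ∈ (run c t).support ∧ Halted d

theorem toOuterMeasure_le_one {α : Type*} (μ : PMF α) (S : Set α) : μ.toOuterMeasure S ≤ 1 := by
  rw [PMF.toOuterMeasure_apply]
  calc _ ≤ ∑' x, μ x := ENNReal.tsum_le_tsum fun x => Set.indicator_le_self _ _ _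
    _ = 1 := μ.tsum_coe

theorem haltProb_le_one (c : Config) (t : ℕ) : haltProb c t ≤ 1 :=
  ENNReal.toReal_le_of_le_ofReal zero_le_one (by simpa using toOuterMeasure_le_one _ _)

theorem haltProb_nonneg (c : Config) (t : ℕ) : 0 ≤ haltProb c t := ENNReal.toReal_nonneg

theorem step_of_halted {c : Config} (h : Halted c) : step c = PMF.pure c := by
  obtain ⟨K, s⟩ := c
  obtain rfl : K = [] := h
  rfl

theorem haltProb_mono (c : Config) {t t' : ℕ} (h : t ≤ t') : haltProb c t ≤ haltProb c t' := by
  induction t', h using Nat.le_induction with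
  | base => exact le_rfl
  | succ t' _ ih =>
    refine ih.trans (ENNReal.toReal_mono
      (ne_top_of_le_ne_top ENNReal.one_ne_top (toOuterMeasure_le_one _ _)) ?_)
    rw [run, PMF.toOuterMeasure_bind_apply, PMF.toOuterMeasure_apply]
    refine ENNReal.tsum_le_tsum fun d => ?_
    by_cases hd : Halted d
    · simp [Set.indicator, hd, step_of_halted hd]
    · simp [Set.indicator, hd]

theorem run_of_halted {c : Config} (h : Halted c) (t : ℕ) : run c t = PMF.pure c := by
  induction t with
  | zero => rfl
  | succ t ih => rw [run, ih, PMF.pure_bind, step_of_halted h]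

theorem haltProb_of_halted (s : State) (t : ℕ) : haltProb ([], s) t = 1 := by
  rw [haltProb, run_of_halted (show Halted ([], s) from rfl)]
  simp [PMF.toOuterMeasure_pure_apply, Halted]

theorem MayHalt.add {c d : Config} {t : ℕ} (h : MayHalt c d t) (u : ℕ) : MayHalt c d (t + u) := by
  refine ⟨?_, h.2⟩
  rw [run_add, PMF.mem_support_bind_iff]
  exact ⟨d, h.1, by simp [run_of_halted h.2]⟩

theorem BigStep.haltProb_eq {p : Prog} {s s' : State} {t : ℕ} (h : BigStep p s t s')
    (K : List Prog) (u : ℕ) : haltProb (p :: K, s) (u + t) = haltProb (K, s') u := by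
  rw [haltProb, add_comm, run_add, h.run_eq, PMF.pure_bind, haltProb]

theorem BigStep.mayHalt {p : Prog} {s s' : State} {t : ℕ} (h : BigStep p s t s')
    {K : List Prog} {u : ℕ} {d : Config} (hd : MayHalt (p :: K, s) d u) :
    ∃ u' ≤ u, MayHalt (K, s') d u' := by
  rcases le_total t u with htu | htu
  · obtain ⟨v, rfl⟩ := Nat.exists_eq_add_of_le htu
    refine ⟨v, by omega, ?_, hd.2⟩
    have := hd.1
    rwa [run_add, h.run_eq, PMF.pure_bind] at this
  · obtain ⟨v, rfl⟩ := Nat.exists_eq_add_of_le htu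
    have := (hd.add v).1
    rw [h.run_eq] at this
    exact ⟨0, by omega, this, hd.2⟩

theorem run_rand (x y : ℕ) (K : List Prog) (s : State) (u : ℕ) :
    run (.instr (.rand x y) :: K, s) (u + 1) =
      (PMF.uniformOfFintype (Fin (s.reg y + 1))).bind fun v => run (K, s.setReg x v) u := by
  rw [add_comm, run_add, run_one]
  simp only [step, Instr.exec, PMF.map_comp, PMF.bind_map]
  change (PMF.bind _ fun a => PMF.pure _).bind _ = _
  simp only [PMF.bind_bind, PMF.pure_bind]
  rfl

theorem haltProb_rand (x y : ℕ) (K : List Prog) (s : State) (u : ℕ) :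
    haltProb (.instr (.rand x y) :: K, s) (u + 1) =
      (∑ v : Fin (s.reg y + 1), haltProb (K, s.setReg x v) u) / (s.reg y + 1 : ℕ) := by
  rw [haltProb, run_rand, PMF.toOuterMeasure_bind_apply, tsum_fintype, ENNReal.toReal_sum,
    Finset.sum_div]
  · refine Finset.sum_congr rfl fun v _ => ?_
    rw [ENNReal.toReal_mul, PMF.uniformOfFintype_apply, Fintype.card_fin, ENNReal.toReal_inv,
      ENNReal.toReal_natCast, haltProb, div_eq_inv_mul]
  · intro v _
    refine ENNReal.mul_ne_top (PMF.apply_ne_top _ _)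
      (ne_top_of_le_ne_top ENNReal.one_ne_top (toOuterMeasure_le_one _ _))

theorem mayHalt_rand {x y : ℕ} {K : List Prog} {s : State} {u : ℕ} {d : Config}
    (h : MayHalt (.instr (.rand x y) :: K, s) d u) :
    ∃ v : Fin (s.reg y + 1), ∃ u' ≤ u, MayHalt (K, s.setReg x v) d u' := by
  cases u with
  | zero =>
    have h1 := h.1
    simp only [run, PMF.mem_support_pure_iff] at h1
    have := h.2
    simp [h1, Halted] at this
  | succ u =>
    have h1 := h.1
    rw [run_rand, PMF.mem_support_bind_iff] at h1
    obtain ⟨v, -, hv⟩ := h1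
    exact ⟨v, u, by omega, hv, h.2⟩

/-! ### Memory layout

The integer registers `regN` and `regM` and the first three integer arrays and the first real array
are given by the input.  Edges of `E⁻` are stored as their numbers.

* Constants: `regZero`, `regOne`, `rregZero`; `rregMax` is the maximum of `0` and the numbers `-w e`
  for `e ∈ E⁻`.
* Parameters: `regK` is the number of edges of `E⁻`, `regR` the size of a sample, `regS` the size of
  a sufficiently large independent set, and `regBig` and `regSmall` are the numbers of related
  vertices that make the first and the second stage successful.
* State of the computation: `regDone` is `1` if a result has been found, `regKind` is its kind, and
  `regFlag` is `1` if a stage has found many vertices related to its probe; `regSelf` tells whether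
  the probe is related to itself.
* Results: `regX` and `regY` are the ends of a sandwich, `arrOut` lists `regCnt` edges; `arrMid`
  lists the `regMid` edges found by the first stage.
* Graph: `arrTail'` is a copy of `arrTail`, which is overwritten by the answer; `arrNegList` lists
  `E⁻`; arrays `4` to `7` hold adjacency lists of `E⁺`.
* Searches: `rarrD` holds distance labels, `rarrK` the keys of the vertices in the tournament tree
  `arrTree`, and `arrLeaf` the numbers of their leaves.
* Samples: `arrSample` holds the sample, and `arrMark` an index of each sampled edge.

The other registers are temporary. -/

notation "regN" => (0 : ℕ)
notation "regM" => (1 : ℕ)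
notation "regZero" => (4 : ℕ)
notation "regOne" => (5 : ℕ)
notation "regK" => (6 : ℕ)
notation "regBig" => (7 : ℕ)
notation "regSmall" => (8 : ℕ)
notation "regR" => (9 : ℕ)
notation "regS" => (10 : ℕ)
notation "regDone" => (11 : ℕ)
notation "regKind" => (12 : ℕ)
notation "regX" => (13 : ℕ)
notation "regY" => (14 : ℕ)
notation "regCnt" => (15 : ℕ)
notation "regMid" => (16 : ℕ)
notation "regFlag" => (17 : ℕ)
notation "regSelf" => (18 : ℕ)
notation "regI" => (20 : ℕ)
notation "regF" => (21 : ℕ)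
notation "regV" => (22 : ℕ)
notation "regP" => (23 : ℕ)
notation "regSib" => (24 : ℕ)
notation "regHalf" => (25 : ℕ)
notation "regA" => (26 : ℕ)
notation "regB" => (27 : ℕ)
notation "regT" => (28 : ℕ)
notation "regU" => (29 : ℕ)
notation "regE" => (30 : ℕ)

notation "arrTail" => (0 : ℕ)
notation "arrHead" => (1 : ℕ)
notation "arrNeg" => (2 : ℕ)
notation "arrTail'" => (3 : ℕ)
notation "arrLeaf" => (8 : ℕ)
notation "arrNegList" => (9 : ℕ)
notation "arrTree" => (10 : ℕ)
notation "arrMid" => (12 : ℕ)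
notation "arrOut" => (13 : ℕ)
notation "arrSample" => (14 : ℕ)
notation "arrMark" => (15 : ℕ)

notation "rregZero" => (0 : ℕ)
notation "rregMax" => (1 : ℕ)
notation "rregVal" => (2 : ℕ)
notation "rregX" => (3 : ℕ)
notation "rregA" => (4 : ℕ)
notation "rregB" => (5 : ℕ)
notation "rregU" => (6 : ℕ)

notation "rarrW" => (0 : ℕ)
notation "rarrD" => (1 : ℕ)
notation "rarrK" => (2 : ℕ)

/-! ### A tournament tree -/

/-- `T` is a binary tree in heap order, whose nodes are `1, …, 2 * n - 1` and whose leaf `n + v`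
holds `v`; every node holds the number of one of the leaves below it. -/
structure TreeShape (n : ℕ) (T : ℕ → ℕ) : Prop where
  lt : ∀ p, 1 ≤ p → p < 2 * n → T p < n
  below : ∀ p, 1 ≤ p → p < 2 * n → ∃ t, (n + T p) / 2 ^ t = p
  leaf : ∀ v < n, T (n + v) = v

/-- A tournament tree: every node holds an element of least key among the leaves below it. -/
structure Tree (n : ℕ) (T : ℕ → ℕ) (K : ℕ → ℝ) : Prop extends TreeShape n T where
  le : ∀ p, 2 ≤ p → p < 2 * n → K (T (p / 2)) ≤ K (T p)

/-- The root of a tournament tree holds an element of least key. -/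
theorem Tree.root_le {n : ℕ} {T : ℕ → ℕ} {K : ℕ → ℝ} (h : Tree n T K) {v : ℕ} (hv : v < n) :
    K (T 1) ≤ K v := by
  have key : ∀ p, 1 ≤ p → p < 2 * n → K (T 1) ≤ K (T p) := by
    intro p
    induction p using Nat.strong_induction_on with
    | _ p ih =>
      intro h1 h2
      rcases Nat.lt_or_ge p 2 with hp | hp
      · obtain rfl : p = 1 := by omega
        exact le_rfl
      · exact (ih (p / 2) (by omega) (by omega) (by omega)).trans (h.le p hp h2)
  simpa [h.leaf v hv] using key (n + v) (by omega) (by omega)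

/-- The shape is preserved if an inner node takes over the element of one of its children. -/
theorem TreeShape.update {n : ℕ} {T : ℕ → ℕ} (h : TreeShape n T) {i j z : ℕ} (hi : 2 ≤ i)
    (hin : i < 2 * n) (hij : j / 2 = i / 2) (hjn : j < 2 * n) (hz : z = T i ∨ z = T j) :
    TreeShape n (Function.update T (i / 2) z) := by
  refine ⟨fun p h1 h2 => ?_, fun p h1 h2 => ?_, fun v hv => ?_⟩
  · rw [Function.update_apply]
    split_ifs
    · rcases hz with rfl | rfl
      · exact h.lt _ (by omega) hin
      · exact h.lt _ (by omega) hjn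
    · exact h.lt _ h1 h2
  · rw [Function.update_apply]
    split_ifs with hp
    · subst hp
      rcases hz with rfl | rfl
      · obtain ⟨t, ht⟩ := h.below i (by omega) hin
        exact ⟨t + 1, by rw [pow_succ, ← Nat.div_div_eq_div_mul, ht]⟩
      · obtain ⟨t, ht⟩ := h.below j (by omega) hjn
        exact ⟨t + 1, by rw [pow_succ, ← Nat.div_div_eq_div_mul, ht, hij]⟩
    · exact h.below _ h1 h2
  · rw [Function.update_apply, if_neg (by omega), h.leaf v hv]

/-- Let the parent of node `regP` hold the winner among the elements of that node and its
sibling. -/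
def combine : Prog :=
  .seq (block [.half regHalf regP, .succ regSib regP, .half regT regSib]) <|
  .seq (.ite (.eq regT regHalf) .skip (.instr (.sub regSib regP regOne))) <|
  .seq (block [.load regA arrTree regP, .load regB arrTree regSib,
    .rload rregA rarrK regA, .rload rregB rarrK regB]) <|
  .ite (.rlt rregB rregA) (.instr (.store arrTree regHalf regB))
    (.instr (.store arrTree regHalf regA))

/-- Here `j` is the sibling of `i`, and `z` is the winner. -/
theorem combine_spec {s : State} {i : ℕ} (h1 : s.reg regOne = 1) (hP : s.reg regP = i)
    (hi : 2 ≤ i) :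
    Tri combine s 30 fun s' => s'.reg regP = i ∧ s'.reg regHalf = i / 2 ∧
      ∃ j z, j / 2 = i / 2 ∧ (∀ p, p / 2 = i / 2 → p = i ∨ p = j) ∧
        s'.arr arrTree = Function.update (s.arr arrTree) (i / 2) z ∧
        (z = s.arr arrTree i ∨ z = s.arr arrTree j) ∧
        s.rarr rarrK z ≤ s.rarr rarrK (s.arr arrTree i) ∧
        s.rarr rarrK z ≤ s.rarr rarrK (s.arr arrTree j) := by
  unfold combine
  refine Tri.mono_time ((Tri.block (by simp [Instr.isRand])
    (Q := fun s' => s'.reg regHalf = i / 2 ∧ s'.reg regSib = i + 1 ∧ s'.reg regT = (i + 1) / 2)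
    (by simp [Instr.eff, hP])).seq fun s1 ⟨hH1, hS1, hT1⟩ f1 => ?_) (B₁ := 7 + 22 + 1)
      (by norm_num)
  have hP1 := (f1.reg regP).trans hP
  have hO1 := (f1.reg regOne).trans h1
  refine Tri.mono_time ((Tri.ite (Q := fun s' => ∃ j, s'.reg regSib = j ∧ j / 2 = i / 2 ∧
      (∀ p, p / 2 = i / 2 → p = i ∨ p = j)) (B := 1) (fun hb => Tri.skip ?_)
      (fun hb => Tri.instr rfl ?_)).seq fun s2 ⟨j, hS2, hji, hj⟩ f2 => ?_) (B₁ := 2 + 19 + 1)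
      (by norm_num)
  · simp only [Test.Holds, hH1, hT1] at hb
    exact ⟨i + 1, hS1, hb, by omega⟩
  · simp only [Test.Holds, hH1, hT1] at hb
    exact ⟨i - 1, by simp [Instr.eff, hP1, hO1], by omega, by omega⟩
  have hP2 := (f2.reg regP).trans hP1
  have hH2 := (f2.reg regHalf).trans hH1
  have hT2 := (f2.arr arrTree).trans (f1.arr arrTree)
  have hK2 := (f2.rarr rarrK).trans (f1.rarr rarrK)
  refine Tri.mono_time ((Tri.block (by simp [Instr.isRand])
    (Q := fun s' => s'.reg regA = s.arr arrTree i ∧ s'.reg regB = s.arr arrTree j ∧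
      s'.rreg rregA = s.rarr rarrK (s.arr arrTree i) ∧
      s'.rreg rregB = s.rarr rarrK (s.arr arrTree j))
    (by simp [Instr.eff, hP2, hS2, hT2, hK2])).seq fun s3 ⟨hA, hB, hrA, hrB⟩ f3 => ?_)
      (B₁ := 9 + 2 + 1) (by norm_num)
  have hP3 := (f3.reg regP).trans hP2
  have hH3 := (f3.reg regHalf).trans hH2
  have hT3 := (f3.arr arrTree).trans hT2
  refine Tri.ite (fun hb => Tri.instr rfl ?_) (fun hb => Tri.instr rfl ?_) <;>
    simp only [Test.Holds, hrA, hrB, not_lt] at hb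
  · refine ⟨by simp [Instr.eff, hP3], by simp [Instr.eff, hH3], j, s.arr arrTree j, hji, hj, ?_,
      .inr rfl, hb.le, le_rfl⟩
    simp [Instr.eff, hH3, hT3, hB]
  · refine ⟨by simp [Instr.eff, hP3], by simp [Instr.eff, hH3], j, s.arr arrTree i, hji, hj, ?_,
      .inl rfl, le_rfl, hb⟩
    simp [Instr.eff, hH3, hT3, hA]

/-- Recompute the nodes on the path from node `regP` to the root. -/
def walk : Prog := .while (.lt regOne regP) (.seq combine (.instr (.copy regP regHalf)))

/-- The bound for the time of one operation on the tournament tree. -/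
def treeTime (n : ℕ) : ℕ := 33 * Nat.log 2 (2 * n) + 1

/-- After the key of `v` has changed, recomputing the nodes above the leaf of `v` repairs the
tournament tree. The order can be violated only between a node above that leaf and its children;
when node `i` is about to be processed, only between a proper ancestor of `i` and its children. -/
theorem walk_spec {s : State} {n v : ℕ} {K : ℕ → ℝ} {x : ℝ} (h1 : s.reg regOne = 1)
    (hv : v < n) (hP : s.reg regP = n + v) (hT : Tree n (s.arr arrTree) K)
    (hK : s.rarr rarrK = Function.update K v x) :
    Tri walk s (treeTime n) fun s' => Tree n (s'.arr arrTree) (s.rarr rarrK) := by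
  set K' := s.rarr rarrK with hK'
  refine (Tri.while_inv (g := n + v) (fun i s' => s'.reg regOne = 1 ∧ s'.reg regP = i ∧ 1 ≤ i ∧
    i < 2 * n ∧ s'.rarr rarrK = K' ∧ TreeShape n (s'.arr arrTree) ∧ ∀ p, 2 ≤ p → p < 2 * n →
      K' (s'.arr arrTree (p / 2)) ≤ K' (s'.arr arrTree p) ∨ ∃ t, p / 2 = i / 2 ^ (t + 1))
    (fun i => 33 * Nat.log 2 i) ?_ ?_).mono ?_ ?_
  · rintro i s ⟨h1, hP, hi1, hin, hK, hS, hle⟩ hb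
    replace hb : 2 ≤ i := Nat.succ_le_of_lt (by simpa [Test.Holds, hP, h1] using hb)
    refine ⟨30 + 1 + 1, (combine_spec h1 hP hb).seq fun s' ⟨hP', hH', j, z, hji, hj, hT', hz, hzi,
      hzj⟩ f => Tri.instr rfl ⟨i / 2, ⟨?_, ?_, by omega, by omega, ?_, ?_, fun p hp hpn => ?_⟩, ?_⟩⟩
    · simp [Instr.eff, f.reg regOne, h1]
    · simp [Instr.eff, hH']
    · simp [Instr.eff, f.rarr rarrK, hK]
    · simp only [Instr.eff, State.setReg_arr, hT']
      exact hS.update hb hin hji (by omega) hz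
    · simp only [Instr.eff, State.setReg_arr, hT', Function.update_apply]
      rw [hK] at hzi hzj
      by_cases h1 : p / 2 = i / 2
      · left
        rw [if_pos h1, if_neg (by omega)]
        rcases hj p h1 with rfl | rfl
        · exact hzi
        · exact hzj
      · rw [if_neg h1]
        by_cases h2 : p = i / 2
        · right
          exact ⟨0, by rw [h2]; simp⟩
        · rw [if_neg h2]
          refine (hle p hp hpn).imp_right ?_
          rintro ⟨t, ht⟩
          cases t with
          | zero => exact absurd (by simpa using ht) h1
          | succ t => exact ⟨t, by rw [ht, Nat.div_div_eq_div_mul, ← pow_succ']⟩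
    · have : Nat.log 2 (i / 2) + 1 = Nat.log 2 i := by
        rw [Nat.log_div_base]
        have := Nat.log_pos (b := 2) (by norm_num) hb
        omega
      omega
  · refine ⟨h1, hP, by omega, by omega, rfl, hT.toTreeShape, fun p hp hpn => ?_⟩
    rw [hK]
    -- A node that holds `v` is on the path from the leaf of `v` to the root; elsewhere the order is
    -- intact.
    by_cases h2 : s.arr arrTree (p / 2) = v
    · right
      obtain ⟨t, ht⟩ := hT.below (p / 2) (by omega) (by omega)
      rw [h2] at ht
      cases t with
      | zero => simp at ht; omega
      | succ t => exact ⟨t, ht.symm⟩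
    by_cases h3 : s.arr arrTree p = v
    · right
      obtain ⟨t, ht⟩ := hT.below p (by omega) (by omega)
      rw [h3] at ht
      exact ⟨t, by rw [pow_succ, ← Nat.div_div_eq_div_mul, ht]⟩
    · left
      simpa [h2, h3] using hT.le p hp hpn
  · simp only [treeTime]
    have : Nat.log 2 (n + v) ≤ Nat.log 2 (2 * n) := Nat.log_mono_right (by omega)
    omega
  · rintro s' ⟨⟨i, h1, hP, hi1, hin, hK, hS, hle⟩, hb⟩ _
    replace hb : i = 1 := by
      simp [Test.Holds, hP, h1] at hb
      omega
    refine ⟨hS, fun p hp hpn => ?_⟩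
    refine (hle p hp hpn).resolve_right ?_
    rintro ⟨t, ht⟩
    rw [hb, Nat.div_eq_of_lt (Nat.one_lt_two_pow (by omega))] at ht
    omega

/-- Decrease the distance label of vertex `regV` to `rregX`, if it is larger. -/
def relax : Prog :=
  .seq (.instr (.rload rregA rarrD regV)) <|
  .ite (.rlt rregX rregA)
    (.seq (block [.rstore rarrD regV rregX, .rstore rarrK regV rregX, .load regP arrLeaf regV])
      walk)
    .skip

/-- The tournament tree is valid for the current keys, and the constants it needs are in place. -/
structure Queue (n : ℕ) (s : State) : Prop where
  one : s.reg regOne = 1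
  leaf : ∀ v < n, s.arr arrLeaf v = n + v
  tree : Tree n (s.arr arrTree) (s.rarr rarrK)

/-- A relaxation changes the label and the key together, and keeps the queue valid. -/
theorem relax_spec {s : State} {n v : ℕ} {x : ℝ} (hQ : Queue n s) (hV : s.reg regV = v)
    (hv : v < n) (hX : s.rreg rregX = x) :
    Tri relax s (treeTime n + 11) fun s' => Queue n s' ∧
      if x < s.rarr rarrD v then s'.rarr rarrD = Function.update (s.rarr rarrD) v x ∧
        s'.rarr rarrK = Function.update (s.rarr rarrK) v x
      else s'.rarr rarrD = s.rarr rarrD ∧ s'.rarr rarrK = s.rarr rarrK := by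
  refine ((Tri.instr (i := .rload rregA rarrD regV) rfl (Q := fun s' =>
    s' = s.setRReg rregA (s.rarr rarrD v)) (by simp [Instr.eff, hV])).seq
    (B₂ := treeTime n + 9) fun s1 h1 _ => ?_).mono_time (by omega)
  refine Tri.ite (B := treeTime n + 8) (fun hb => ?_) fun hb => ?_
  · replace hb : x < s.rarr rarrD v := by simpa [Test.Holds, h1, hX] using hb
    refine Tri.mono_time ((Tri.block (by simp [Instr.isRand])
      (Q := fun s' => s'.rarr rarrD = Function.update (s.rarr rarrD) v x ∧
        s'.rarr rarrK = Function.update (s.rarr rarrK) v x ∧ s'.reg regP = n + v ∧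
        s'.arr = s.arr ∧ s'.reg regOne = 1)
      (by simp [Instr.eff, hX, hV, h1, hQ.leaf v hv, hQ.one])).seq
      fun s2 ⟨hD2, hK2, hP2, hA2, hO2⟩ f2 =>
      (walk_spec hO2 hv hP2 (by rw [hA2]; exact hQ.tree) hK2).mono le_rfl fun s3 hT3 f3 => ?_)
      (B₁ := 7 + treeTime n + 1) (by omega)
    rw [if_pos hb]
    exact ⟨⟨(f3.reg regOne).trans hO2, by rw [f3.arr arrLeaf, hA2]; exact hQ.leaf,
      by rw [f3.rarr rarrK]; exact hT3⟩,
      (f3.rarr rarrD).trans hD2, (f3.rarr rarrK).trans hK2⟩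
  · replace hb : ¬ x < s.rarr rarrD v := by simpa [Test.Holds, h1, hX] using hb
    refine (Tri.skip ?_).mono_time (by omega)
    rw [if_neg hb, h1]
    exact ⟨⟨by simp [hQ.one], by simpa using hQ.leaf, by simpa using hQ.tree⟩, rfl, rfl⟩

/-! ### Shortest paths over nonnegative edges -/

/-- The array holding the end of an edge at which a search in direction `d` arrives; `true` stands
for searches along the edges, `false` for searches against them. -/
def arrDst : Bool → ℕ
  | true => arrHead
  | false => arrTail

/-- The array holding the first element of the list of the edges that leave a vertex in
direction `d`. -/
def arrFst : Bool → ℕ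
  | true => 4
  | false => 6

/-- The array holding the links of the lists of the edges that leave a vertex in direction `d`. -/
def arrNxt : Bool → ℕ
  | true => 5
  | false => 7

/-- Starting from `x`, the links `nxt` run through the list `l`.  Edge `e` is encoded as `e + 1`,
and `0` is the end of the list. -/
def IsChain (nxt : ℕ → ℕ) : ℕ → List ℕ → Prop
  | x, [] => x = 0
  | x, e :: l => x = e + 1 ∧ IsChain nxt (nxt e) l

/-- In direction `d`, the memory holds adjacency lists `adj` of nonnegative edges, with end points
`dst` and weights `w`. -/
structure HasAdj (d : Bool) (n : ℕ) (adj : ℕ → List ℕ) (dst : ℕ → ℕ) (w : ℕ → ℝ) (s : State) :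
    Prop where
  dst_eq : s.arr (arrDst d) = dst
  w_eq : s.rarr rarrW = w
  chain : ∀ u < n, IsChain (s.arr (arrNxt d)) (s.arr (arrFst d) u) (adj u)
  dst_lt : ∀ u < n, ∀ e ∈ adj u, dst e < n
  nonneg : ∀ u < n, ∀ e ∈ adj u, 0 ≤ w e
  zero : s.reg regZero = 0
  rzero : s.rreg rregZero = 0

theorem HasAdj.of_frame {d : Bool} {n : ℕ} {adj : ℕ → List ℕ} {dst : ℕ → ℕ} {w : ℕ → ℝ}
    {s s' : State} {p : Prog} (h : HasAdj d n adj dst w s) (f : Frame p s s')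
    (hp : [Loc.arr (arrDst d), .arr (arrFst d), .arr (arrNxt d), .rarr rarrW, .reg regZero,
      .rreg rregZero].all (fun l => !p.writes l) = true) : HasAdj d n adj dst w s' := by
  simp only [List.all_cons, List.all_nil, Bool.and_true, Bool.and_eq_true,
    Bool.not_eq_true'] at hp
  obtain ⟨h1, h2, h3, h4, h5, h6⟩ := hp
  exact ⟨(f.arr _ h1).trans h.dst_eq, (f.rarr _ h4).trans h.w_eq,
    by rw [f.arr _ h2, f.arr _ h3]; exact h.chain, h.dst_lt, h.nonneg, (f.reg _ h5).trans h.zero,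
    (f.rreg _ h6).trans h.rzero⟩

/-- The state of a search that has processed the vertices of `F`: the labels `D` are at most the
initial labels `D₀`, they satisfy `R`, and those of processed vertices are at most those of the
others; processed vertices have key `0`, the others have their label as key. -/
structure Settled (n : ℕ) (D₀ : ℕ → ℝ) (R : ℕ → ℝ → Prop) (F : Finset ℕ) (D K : ℕ → ℝ) :
    Prop where
  nonpos : ∀ v < n, D v ≤ 0
  le_init : ∀ v < n, D v ≤ D₀ v
  reach : ∀ v < n, R v (D v)
  key_mem : ∀ v ∈ F, K v = 0
  key_not : ∀ v < n, v ∉ F → K v = D v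
  le : ∀ u ∈ F, ∀ v < n, v ∉ F → D u ≤ D v

/-- A label can be decreased without violating the invariant if the new value is not below the
labels of the processed vertices; the vertex is then not a processed one. -/
theorem Settled.relax {n : ℕ} {D₀ : ℕ → ℝ} {R : ℕ → ℝ → Prop} {F : Finset ℕ} {D K : ℕ → ℝ}
    (h : Settled n D₀ R F D K) {v : ℕ} {y : ℝ} (hv : v < n) (hR : R v y) (hy : y < D v)
    (hF : ∀ u ∈ F, D u ≤ y) :
    v ∉ F ∧ Settled n D₀ R F (Function.update D v y) (Function.update K v y) := by
  have hvF : v ∉ F := fun hvF => (hF v hvF).not_gt hy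
  have hne : ∀ u ∈ F, u ≠ v := fun u hu huv => hvF (huv ▸ hu)
  refine ⟨hvF, fun u hu => ?_, fun u hu => ?_, fun u hu => ?_, fun u hu => ?_, fun u hu huF => ?_,
    fun u hu x hx hxF => ?_⟩
  · rcases eq_or_ne u v with rfl | huv
    · simpa using hy.le.trans (h.nonpos u hu)
    · simpa [huv] using h.nonpos u hu
  · rcases eq_or_ne u v with rfl | huv
    · simpa using hy.le.trans (h.le_init u hu)
    · simpa [huv] using h.le_init u hu
  · rcases eq_or_ne u v with rfl | huv
    · simpa using hR
    · simpa [huv] using h.reach u hu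
  · simpa [hne u hu] using h.key_mem u hu
  · rcases eq_or_ne u v with rfl | huv
    · simp
    · simpa [huv] using h.key_not u hu huF
  · rw [Function.update_of_ne (hne u hu)]
    rcases eq_or_ne x v with rfl | hxv
    · simpa using hF u hu
    · simpa [hxv] using h.le u hu x hx hxF

/-- Relax the edges of a list, which leave a vertex with label `rregU`. -/
def scan (d : Bool) : Prog :=
  .while (.lt regZero regE) <|
  .seq (block [.sub regE regE regOne, .load regV (arrDst d) regE, .rload rregX rarrW regE,
    .radd rregX rregU rregX]) <|
  .seq relax (.instr (.load regE (arrNxt d) regE))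

/-- Relaxing all edges that leave `u`, the processed vertex with the largest label. The labels of
processed vertices do not change, because all weights are nonnegative. -/
theorem scan_spec {d : Bool} {n : ℕ} {adj : ℕ → List ℕ} {dst : ℕ → ℕ} {w : ℕ → ℝ} {s : State}
    {D₀ : ℕ → ℝ} {R : ℕ → ℝ → Prop} {F : Finset ℕ} {u : ℕ}
    (hR : ∀ u < n, ∀ e ∈ adj u, ∀ x, R u x → R (dst e) (x + w e))
    (hA : HasAdj d n adj dst w s) (hQ : Queue n s)
    (hS : Settled n D₀ R F (s.rarr rarrD) (s.rarr rarrK)) (hu : u < n) (huF : u ∈ F)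
    (hmax : ∀ v ∈ F, s.rarr rarrD v ≤ s.rarr rarrD u) (hE : s.reg regE = s.arr (arrFst d) u)
    (hU : s.rreg rregU = s.rarr rarrD u) :
    Tri (scan d) s ((adj u).length * (treeTime n + 24) + 1) fun s' => Queue n s' ∧
      Settled n D₀ R F (s'.rarr rarrD) (s'.rarr rarrK) ∧
      (∀ v ∈ F, s'.rarr rarrD v = s.rarr rarrD v) ∧
      (∀ v < n, s'.rarr rarrD v ≤ s.rarr rarrD v) ∧
      ∀ e ∈ adj u, s'.rarr rarrD (dst e) ≤ s'.rarr rarrD u + w e := by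
  have hRu := hS.reach u hu
  set D := s.rarr rarrD with hD
  refine (Tri.while_inv (g := adj u) (fun l s' => HasAdj d n adj dst w s' ∧ Queue n s' ∧
    Settled n D₀ R F (s'.rarr rarrD) (s'.rarr rarrK) ∧
    (∀ v ∈ F, s'.rarr rarrD v = D v) ∧ (∀ v < n, s'.rarr rarrD v ≤ D v) ∧
    s'.rreg rregU = D u ∧ IsChain (s'.arr (arrNxt d)) (s'.reg regE) l ∧
    (∀ e ∈ l, e ∈ adj u) ∧
    ∀ e ∈ adj u, e ∈ l ∨ s'.rarr rarrD (dst e) ≤ D u + w e)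
    (fun l => l.length * (treeTime n + 24)) ?_ ?_).mono le_rfl ?_
  · rintro l s ⟨hA, hQ, hS, hDF, hDle, hU, hl, hlu, hedge⟩ hb
    cases l with
    | nil =>
      have hl : s.reg regE = 0 := hl
      simp [Test.Holds, hl, hA.zero] at hb
    | cons e l =>
      obtain ⟨hE, hl⟩ := hl
      have he : e ∈ adj u := hlu e (by simp)
      refine ⟨9 + (treeTime n + 11 + 1 + 1) + 1, (Tri.block (by simp [Instr.isRand])
        (Q := fun s' => s'.reg regE = e ∧ s'.reg regV = dst e ∧ s'.rreg rregX = D u + w e)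
        (by simp [Instr.eff, hE, hQ.one, hA.dst_eq, hA.w_eq, hU])).seq
          fun s1 ⟨hE1, hV1, hX1⟩ f1 => ?_⟩
      have hQ1 : Queue n s1 := ⟨(f1.reg regOne).trans hQ.one,
        by rw [f1.arr arrLeaf]; exact hQ.leaf,
        by rw [f1.arr arrTree, f1.rarr rarrK]; exact hQ.tree⟩
      refine (relax_spec hQ1 hV1 (hA.dst_lt u hu e he) hX1).seq fun s2 ⟨hQ2, hD2⟩ f2 =>
        Tri.instr rfl ⟨l, ⟨?_, ?_, ?_⟩, ?_⟩
      · have h1 : HasAdj d n adj dst w s2 :=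
          (hA.of_frame f1 (by cases d <;> rfl)).of_frame f2 (by cases d <;> rfl)
        exact ⟨h1.dst_eq, h1.w_eq, h1.chain, h1.dst_lt, h1.nonneg, by simp [Instr.eff, h1.zero],
          h1.rzero⟩
      · exact ⟨by simp [Instr.eff, hQ2.one], hQ2.leaf, hQ2.tree⟩
      · have hDF1 : ∀ v ∈ F, s1.rarr rarrD v ≤ D u + w e := fun v hv => by
          rw [f1.rarr rarrD, hDF v hv]
          linarith [hmax v hv, hA.nonneg u hu e he]
        have hR1 : R (dst e) (D u + w e) := hR u hu e he _ hRu
        have hU2 : s2.rreg rregU = D u := (f2.rreg rregU).trans ((f1.rreg rregU).trans hU)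
        have hl2 : IsChain (s2.arr (arrNxt d)) (s2.arr (arrNxt d) e) l := by
          rw [f2.arr (arrNxt d) (by cases d <;> rfl), f1.arr (arrNxt d) (by cases d <;> rfl)]
          exact hl
        have hE2 : s2.reg regE = e := (f2.reg regE).trans hE1
        simp only [Instr.eff, State.setReg_rarr, State.setReg_rreg, State.setReg_arr,
          State.setReg_reg, if_true, hE2]
        rw [f1.rarr rarrD, f1.rarr rarrK] at hD2
        rw [f1.rarr rarrD] at hDF1
        split_ifs at hD2 with hlt
        · obtain ⟨hnF, hS'⟩ := hS.relax (hA.dst_lt u hu e he) hR1 hlt hDF1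
          rw [hD2.1, hD2.2]
          refine ⟨hS', fun v hv => ?_, fun v hv => ?_, hU2, hl2,
            fun e' he' => hlu e' (by simp [he']), fun e' he' => ?_⟩
          · rw [Function.update_of_ne (fun h : v = dst e => hnF (h ▸ hv)), hDF v hv]
          · rw [Function.update_apply]
            split_ifs with h
            · subst h
              exact hlt.le.trans (hDle _ hv)
            · exact hDle v hv
          · rcases hedge e' he' with h | h
            · rcases List.mem_cons.1 h with rfl | h
              · right; simp
              · exact .inl h
            · right
              rw [Function.update_apply]
              split_ifs with h'
              · rw [h'] at h; exact hlt.le.trans h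
              · exact h
        · rw [hD2.1, hD2.2]
          refine ⟨hS, hDF, hDle, hU2, hl2, fun e' he' => hlu e' (by simp [he']), fun e' he' => ?_⟩
          rcases hedge e' he' with h | h
          · rcases List.mem_cons.1 h with rfl | h
            · exact .inr (not_lt.1 hlt)
            · exact .inl h
          · exact .inr h
      · simp only [List.length_cons]
        ring_nf
        omega
  · exact ⟨hA, hQ, hS, fun _ _ => rfl, fun _ _ => le_rfl, hU, by rw [hE]; exact hA.chain u hu,
      fun _ h => h, fun _ h => .inl h⟩
  · rintro s' ⟨⟨l, hA, hQ, hS, hDF, hDle, hU, hl, hlu, hedge⟩, hb⟩ _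
    refine ⟨hQ, hS, hDF, hDle, fun e he => ?_⟩
    rw [hDF u huF]
    refine (hedge e he).resolve_left fun hel => ?_
    cases l with
    | nil => simp at hel
    | cons e l =>
      have hE : s'.reg regE = e + 1 := hl.1
      simp [Test.Holds, hE, hA.zero] at hb

/-- Load the winner of the tournament and its key. -/
def peek : Prog := block [.load regU arrTree regOne, .rload rregU rarrK regU]

/-- Dijkstra's algorithm in direction `d`, for labels that are at most `0` initially.  Vertices with
label `0` need not be processed. -/
def dijkstra (d : Bool) : Prog :=
  .seq peek <|
  .while (.rlt rregU rregZero) <|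
  .seq (block [.rstore rarrK regU rregZero, .load regP arrLeaf regU]) <|
  .seq walk <|
  .seq (.instr (.load regE (arrFst d) regU)) <|
  .seq (scan d) peek

theorem peek_spec {n : ℕ} {s : State} (hQ : Queue n s) :
    Tri peek s 5 fun s' => s'.reg regU = s.arr arrTree 1 ∧
      s'.rreg rregU = s.rarr rarrK (s.arr arrTree 1) :=
  Tri.block (by simp [Instr.isRand]) (by simp [Instr.eff, hQ.one])

/-- A bound for the running time of `dijkstra`, if the adjacency lists have total length `m`. -/
def dijkstraTime (n m : ℕ) : ℕ := m * (treeTime n + 24) + n * (treeTime n + 20) + 7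

/-- The final labels are below the initial ones, satisfy every property `R` that is preserved along
edges, and cannot be decreased by any edge. The keys are `0` again, so that the tournament tree is
ready for the next search. The potential `Φ F` is the time for processing the vertices outside
`F`. -/
theorem dijkstra_spec {d : Bool} {n : ℕ} {adj : ℕ → List ℕ} {dst : ℕ → ℕ} {w : ℕ → ℝ} {s : State}
    {R : ℕ → ℝ → Prop} {m : ℕ} (hn : 0 < n)
    (hm : ∑ u ∈ Finset.range n, (adj u).length ≤ m)
    (hR : ∀ u < n, ∀ e ∈ adj u, ∀ x, R u x → R (dst e) (x + w e))
    (hA : HasAdj d n adj dst w s) (hQ : Queue n s)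
    (hD0 : ∀ v < n, s.rarr rarrD v ≤ 0) (hDR : ∀ v < n, R v (s.rarr rarrD v))
    (hK : ∀ v < n, s.rarr rarrK v = s.rarr rarrD v) :
    Tri (dijkstra d) s (dijkstraTime n m) fun s' => Queue n s' ∧
      (∀ v < n, s'.rarr rarrK v = 0) ∧ (∀ v < n, s'.rarr rarrD v ≤ 0) ∧
      (∀ v < n, s'.rarr rarrD v ≤ s.rarr rarrD v) ∧ (∀ v < n, R v (s'.rarr rarrD v)) ∧
      ∀ u < n, ∀ e ∈ adj u, s'.rarr rarrD (dst e) ≤ s'.rarr rarrD u + w e := by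
  set D₀ := s.rarr rarrD with hD₀
  set Φ : Finset ℕ → ℕ := fun F =>
    ∑ u ∈ Finset.range n \ F, ((adj u).length * (treeTime n + 24) + (treeTime n + 20)) with hΦ
  have hΦ0 : Φ ∅ + 7 ≤ dijkstraTime n m := by
    simp only [hΦ, Finset.sdiff_empty, Finset.sum_add_distrib, ← Finset.sum_mul, dijkstraTime,
      Finset.sum_const, Finset.card_range, smul_eq_mul]
    have := Nat.mul_le_mul_right (treeTime n + 24) hm
    have := Nat.mul_add n (treeTime n) 20
    omega
  refine ((peek_spec hQ).seq (B₂ := Φ ∅ + 1) fun s1 ⟨hU1, hrU1⟩ f1 =>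
    (Tri.while_inv (g := ∅) (fun F s' => HasAdj d n adj dst w s' ∧ Queue n s' ∧
      F ⊆ Finset.range n ∧ Settled n D₀ R F (s'.rarr rarrD) (s'.rarr rarrK) ∧
      (∀ v ∈ F, ∀ e ∈ adj v, s'.rarr rarrD (dst e) ≤ s'.rarr rarrD v + w e) ∧
      s'.reg regU = s'.arr arrTree 1 ∧ s'.rreg rregU = s'.rarr rarrK (s'.arr arrTree 1))
    Φ ?_ ?_).mono le_rfl ?_).mono_time (by omega)
  · rintro F s ⟨hA, hQ, hFn, hS, hF, hU, hrU⟩ hb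
    set u := s.arr arrTree 1 with hu
    have hun : u < n := hQ.tree.lt 1 le_rfl (by omega)
    have hKu : s.rarr rarrK u < 0 := by simpa [Test.Holds, hrU, hA.rzero] using hb
    have huF : u ∉ F := fun h => by simp [hS.key_mem u h] at hKu
    have hKD : s.rarr rarrK u = s.rarr rarrD u := hS.key_not u hun huF
    refine ⟨5 + (treeTime n + (1 + ((adj u).length * (treeTime n + 24) + 1 + 5 + 1) + 1) + 1) + 1,
      (Tri.block (by simp [Instr.isRand]) (Q := fun s' => s'.reg regP = n + u ∧
      s'.rarr rarrK = Function.update (s.rarr rarrK) u 0)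
      (by simp [Instr.eff, hU, hQ.leaf u hun, hA.rzero])).seq fun s1 ⟨hP1, hK1⟩ f1 => ?_⟩
    refine (walk_spec ((f1.reg regOne).trans hQ.one) hun hP1
      (by rw [f1.arr arrTree]; exact hQ.tree) hK1).seq fun s2 hT2 f2 => ?_
    refine (Tri.instr rfl (Q := fun s' => s' = s2.setReg regE (s2.arr (arrFst d) u))
      (by simp [Instr.eff, f2.reg regU, f1.reg regU, hU])).seq fun s3 hs3 f3 => ?_
    have hA3 : HasAdj d n adj dst w s3 := ((hA.of_frame f1 (by cases d <;> rfl)).of_frame f2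
      (by cases d <;> rfl)).of_frame f3 (by cases d <;> rfl)
    have hQ3 : Queue n s3 := by
      refine ⟨(f3.reg regOne).trans ((f2.reg regOne).trans ((f1.reg regOne).trans hQ.one)), ?_, ?_⟩
      · rw [f3.arr arrLeaf, f2.arr arrLeaf, f1.arr arrLeaf]
        exact hQ.leaf
      · rw [f3.arr arrTree, f3.rarr rarrK, f2.rarr rarrK]
        exact hT2
    have hD3 : s3.rarr rarrD = s.rarr rarrD :=
      (f3.rarr rarrD).trans ((f2.rarr rarrD).trans (f1.rarr rarrD))
    have hK3 : s3.rarr rarrK = Function.update (s.rarr rarrK) u 0 :=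
      (f3.rarr rarrK).trans ((f2.rarr rarrK).trans hK1)
    -- The vertex at the root of the tree has the least label among those not processed.
    have hmin : ∀ v < n, v ∉ F → s.rarr rarrD u ≤ s.rarr rarrD v := fun v hv hvF => by
      rw [← hKD, ← hS.key_not v hv hvF]
      exact hQ.tree.root_le hv
    have hmax : ∀ v ∈ insert u F, s3.rarr rarrD v ≤ s3.rarr rarrD u := fun v hv => by
      rw [hD3]
      rcases Finset.mem_insert.1 hv with rfl | hv
      · exact le_rfl
      · exact hS.le v hv u hun huF
    have hS3 : Settled n D₀ R (insert u F) (s3.rarr rarrD) (s3.rarr rarrK) := by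
      rw [hK3]
      refine ⟨hD3 ▸ hS.nonpos, hD3 ▸ hS.le_init, hD3 ▸ hS.reach, fun v hv => ?_, fun v hv hvF => ?_,
        fun v hv x hx hxF => ?_⟩
      · rw [Function.update_apply]
        split_ifs with h
        · rfl
        · exact hS.key_mem v ((Finset.mem_insert.1 hv).resolve_left h)
      · simp only [Finset.mem_insert, not_or] at hvF
        rw [Function.update_of_ne hvF.1, hD3]
        exact hS.key_not v hv hvF.2
      · refine (hmax v hv).trans ?_
        rw [hD3]
        exact hmin x hx fun h => hxF (Finset.mem_insert_of_mem h)
    refine (scan_spec hR hA3 hQ3 hS3 hun (Finset.mem_insert_self _ _) hmax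
      (by rw [hs3]; cases d <;> rfl) ?_).seq (B₂ := 5)
      fun s4 ⟨hQ4, hS4, hDF4, hDle4, hedge4⟩ f4 => ?_
    · rw [hD3, f3.rreg rregU, f2.rreg rregU, f1.rreg rregU, hrU, hKD]
    refine (peek_spec hQ4).mono le_rfl fun s5 ⟨hU5, hrU5⟩ f5 => ?_
    refine ⟨insert u F, ⟨(hA3.of_frame f4 (by cases d <;> rfl)).of_frame f5 (by cases d <;> rfl),
      ⟨(f5.reg regOne).trans hQ4.one, by rw [f5.arr arrLeaf]; exact hQ4.leaf,
        by rw [f5.arr arrTree, f5.rarr rarrK]; exact hQ4.tree⟩,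
      Finset.insert_subset (Finset.mem_range.2 hun) hFn,
      by rw [f5.rarr rarrD, f5.rarr rarrK]; exact hS4, fun v hv e he => ?_,
      by rw [f5.arr arrTree]; exact hU5, by rw [f5.arr arrTree, f5.rarr rarrK]; exact hrU5⟩, ?_⟩
    · rw [f5.rarr rarrD]
      rcases Finset.mem_insert.1 hv with rfl | hvF
      · exact hedge4 e he
      · have hvn : v < n := Finset.mem_range.1 (hFn hvF)
        rw [hDF4 v hv, hD3]
        refine (hDle4 _ (hA.dst_lt v hvn e he)).trans ?_
        rw [hD3]
        exact hF v hvF e he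
    · have : Φ F = ((adj u).length * (treeTime n + 24) + (treeTime n + 20)) + Φ (insert u F) := by
        simp only [hΦ]
        rw [Finset.sdiff_insert]
        exact (Finset.add_sum_erase _
          (fun u => (adj u).length * (treeTime n + 24) + (treeTime n + 20))
          (Finset.mem_sdiff.2 ⟨Finset.mem_range.2 hun, huF⟩)).symm
      omega
  · refine ⟨hA.of_frame f1 (by cases d <;> rfl), ⟨(f1.reg regOne).trans hQ.one,
      by rw [f1.arr arrLeaf]; exact hQ.leaf,
      by rw [f1.arr arrTree, f1.rarr rarrK]; exact hQ.tree⟩, Finset.empty_subset _,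
      ?_, by simp, by rw [f1.arr arrTree]; exact hU1,
      by rw [f1.arr arrTree, f1.rarr rarrK]; exact hrU1⟩
    rw [f1.rarr rarrD, f1.rarr rarrK]
    exact ⟨hD0, fun _ _ => le_rfl, hDR, by simp, fun v hv _ => hK v hv, by simp⟩
  · rintro s' ⟨⟨F, hA, hQ, hFn, hS, hF, hU, hrU⟩, hb⟩ _
    replace hb : 0 ≤ s'.rarr rarrK (s'.arr arrTree 1) := by
      simpa [Test.Holds, hrU, hA.rzero] using hb
    -- No key is negative, so the labels of all unprocessed vertices are `0`; relaxing the edges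
    -- leaving these vertices would have no effect, as labels are at most `0` and weights are
    -- nonnegative.
    have hzero : ∀ v < n, v ∉ F → s'.rarr rarrD v = 0 := fun v hv hvF =>
      le_antisymm (hS.nonpos v hv)
        (hb.trans ((hQ.tree.root_le hv).trans_eq (hS.key_not v hv hvF)))
    refine ⟨hQ, fun v hv => ?_, hS.nonpos, hS.le_init, hS.reach, fun u hu e he => ?_⟩
    · by_cases hvF : v ∈ F
      · exact hS.key_mem v hvF
      · rw [hS.key_not v hv hvF, hzero v hv hvF]
    · by_cases huF : u ∈ F
      · exact hF u huF e he
      · rw [hzero u hu huF, zero_add]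
        exact (hS.nonpos _ (hA.dst_lt u hu e he)).trans (hA.nonneg u hu e he)

/-! ### One-hop relations between negative vertices -/

section graph
variable {n m : ℕ} (G : WDigraph n m)

/-- The end of edge `e` at which a search in direction `d` arrives. -/
noncomputable def endAt (d : Bool) (e : ℕ) : ℕ := (inputState G).arr (arrDst d) e

/-- The weight of edge `e`. -/
noncomputable def weightOf (e : ℕ) : ℝ := (inputState G).rarr rarrW e

/-- `e` is the number of an edge of `E⁻`. -/
def IsNeg (e : ℕ) : Prop := ∃ h : e < m, (⟨e, h⟩ : Fin m) ∈ G.Eneg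

/-- There is a path of weight `x` from `u` to `v` that uses edges of `E⁺` only. -/
def PosPath (u v : ℕ) (x : ℝ) : Prop :=
  ∃ (hu : u < n) (hv : v < n) (p : G.Walk ⟨u, hu⟩ ⟨v, hv⟩), p.hops = 0 ∧ p.weight = x

/-- `PosPath` along a direction. -/
def DirPath (d : Bool) (u v : ℕ) (x : ℝ) : Prop := if d then PosPath G u v x else PosPath G v u x

/-- The one-hop relation between the negative vertices that are the tails of the edges `e`
and `f`. -/
def Rel (d : Bool) (e f : ℕ) : Prop :=
  ∃ (he : e < m) (hf : f < m), if d then G.hopDist 1 (G.tail ⟨e, he⟩) (G.tail ⟨f, hf⟩) < 0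
    else G.hopDist 1 (G.tail ⟨f, hf⟩) (G.tail ⟨e, he⟩) < 0

variable {G}

theorem rel_not {d : Bool} {e f : ℕ} : Rel G (!d) e f ↔ Rel G d f e := by
  cases d <;> exact ⟨fun ⟨h1, h2, h⟩ => ⟨h2, h1, h⟩, fun ⟨h1, h2, h⟩ => ⟨h2, h1, h⟩⟩

theorem endAt_true {e : ℕ} (h : e < m) : endAt G true e = G.head ⟨e, h⟩ := by
  simp [endAt, inputState, arrDst, h]

theorem endAt_false {e : ℕ} (h : e < m) : endAt G false e = G.tail ⟨e, h⟩ := by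
  simp [endAt, inputState, arrDst, h]

theorem weightOf_eq {e : ℕ} (h : e < m) : weightOf G e = G.w ⟨e, h⟩ := by
  simp [weightOf, inputState, h]

theorem endAt_lt (d : Bool) {e : ℕ} (h : e < m) : endAt G d e < n := by
  cases d
  · simp [endAt_false h]
  · simp [endAt_true h]

theorem PosPath.nil {u : ℕ} (hu : u < n) : PosPath G u u 0 := ⟨hu, hu, .nil _, rfl, rfl⟩

theorem PosPath.cons {e v : ℕ} {x : ℝ} (he : e < m) (hne : ¬ IsNeg G e)
    (h : PosPath G (endAt G true e) v x) : PosPath G (endAt G false e) v (weightOf G e + x) := by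
  obtain ⟨hu, hv, p, hp, rfl⟩ := h
  have : (⟨endAt G true e, hu⟩ : Fin n) = G.head ⟨e, he⟩ := Fin.ext (endAt_true he)
  revert p
  rw [this]
  intro p hp
  refine ⟨endAt_lt _ he, hv, .cons ⟨e, he⟩ (Fin.ext (endAt_false he).symm) p, ?_, ?_⟩
  · have : (⟨e, he⟩ : Fin m) ∉ G.Eneg := fun h => hne ⟨he, h⟩
    simp [WDigraph.Walk.hops, this, hp]
  · simp [WDigraph.Walk.weight, weightOf_eq he]

theorem exists_walk_snoc {u v : Fin n} (p : G.Walk u v) (hp : p.hops = 0) {e : Fin m}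
    (hv : G.tail e = v) (he : e ∉ G.Eneg) :
    ∃ q : G.Walk u (G.head e), q.hops = 0 ∧ q.weight = p.weight + G.w e := by
  induction p with
  | nil u => exact ⟨.cons e hv (.nil _), by simp [WDigraph.Walk.hops, he], by
      simp [WDigraph.Walk.weight]⟩
  | cons e' hu p ih =>
    simp only [WDigraph.Walk.hops, Nat.add_eq_zero_iff] at hp
    obtain ⟨q, hq, hw⟩ := ih hp.2 hv
    exact ⟨.cons e' hu q, by simp [WDigraph.Walk.hops, hq, hp.1],
      by simp [WDigraph.Walk.weight, hw, add_assoc]⟩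

theorem PosPath.snoc {e u : ℕ} {x : ℝ} (he : e < m) (hne : ¬ IsNeg G e)
    (h : PosPath G u (endAt G false e) x) : PosPath G u (endAt G true e) (x + weightOf G e) := by
  obtain ⟨hu, hv, p, hp, rfl⟩ := h
  obtain ⟨q, hq, hw⟩ := exists_walk_snoc p hp (e := ⟨e, he⟩) (Fin.ext (endAt_false he).symm)
    fun h => hne ⟨he, h⟩
  have : (⟨endAt G true e, endAt_lt _ he⟩ : Fin n) = G.head ⟨e, he⟩ := Fin.ext (endAt_true he)
  refine ⟨hu, endAt_lt _ he, this ▸ q, ?_, ?_⟩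
  · rw [← hq]; congr! 1; simp
  · rw [weightOf_eq he, ← hw]; congr! 1; simp

theorem DirPath.extend {d : Bool} {e a : ℕ} {x : ℝ} (he : e < m) (hne : ¬ IsNeg G e)
    (h : DirPath G d a (endAt G (!d) e) x) : DirPath G d a (endAt G d e) (x + weightOf G e) := by
  cases d
  · rw [add_comm]
    exact PosPath.cons he hne h
  · exact PosPath.snoc he hne h

/-- Labels that no edge of `E⁺` can decrease satisfy the triangle inequality along paths in
`E⁺`. -/
theorem le_add_weight {D : ℕ → ℝ} (hD : ∀ e < m, ¬ IsNeg G e →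
      D (endAt G true e) ≤ D (endAt G false e) + weightOf G e)
    {u v : Fin n} (p : G.Walk u v) (hp : p.hops = 0) : D v ≤ D u + p.weight := by
  induction p with
  | nil u => simp [WDigraph.Walk.weight]
  | cons e hu p ih =>
    simp only [WDigraph.Walk.hops, Nat.add_eq_zero_iff] at hp
    have he : ¬ IsNeg G e := fun ⟨_, h⟩ => by simp [h] at hp
    have := hD e e.2 he
    rw [endAt_true e.2, endAt_false e.2, weightOf_eq e.2] at this
    simp only [WDigraph.Walk.weight, ← hu]
    have := ih hp.2
    simp at *
    linarith

theorem le_add_weight' {D : ℕ → ℝ} (hD : ∀ e < m, ¬ IsNeg G e →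
      D (endAt G false e) ≤ D (endAt G true e) + weightOf G e)
    {u v : Fin n} (p : G.Walk u v) (hp : p.hops = 0) : D u ≤ D v + p.weight := by
  have := le_add_weight (D := fun v => -D v) (fun e he hne => by linarith [hD e he hne]) p hp
  linarith

theorem DirPath.le_add {d : Bool} {D : ℕ → ℝ} (hD : ∀ e < m, ¬ IsNeg G e →
      D (endAt G d e) ≤ D (endAt G (!d) e) + weightOf G e) {a b : ℕ} {x : ℝ}
    (h : DirPath G d a b x) : D b ≤ D a + x := by
  cases d
  · obtain ⟨hu, hv, p, hp, rfl⟩ := h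
    exact le_add_weight' hD p hp
  · obtain ⟨hu, hv, p, hp, rfl⟩ := h
    exact le_add_weight hD p hp

/-- A one-hop path of negative weight from the tail of `e ∈ E⁻` starts with `e` and continues with
edges of `E⁺`, because `e` is the only edge leaving its tail. -/
theorem hopDist_one_lt_zero_iff
    (hun : ∀ e ∈ G.Eneg, ∀ e', G.tail e' = G.tail e → e' = e) {e : ℕ} (he : IsNeg G e)
    {v : Fin n} : G.hopDist 1 (G.tail ⟨e, he.1⟩) v < 0 ↔
      ∃ x, PosPath G (endAt G true e) v x ∧ weightOf G e + x < 0 := by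
  obtain ⟨he, hneg⟩ := he
  rw [WDigraph.hopDist, iInf_lt_iff, weightOf_eq he, endAt_true he]
  constructor
  · rintro ⟨⟨p, hp⟩, hw⟩
    replace hw : p.weight < 0 := by exact_mod_cast hw
    cases p with
    | nil => simp [WDigraph.Walk.weight] at hw
    | cons e' hu p =>
      obtain rfl := hun _ hneg e' hu
      simp only [WDigraph.Walk.hops, hneg, if_true] at hp
      exact ⟨p.weight, ⟨(G.head _).2, v.2, p, by omega, rfl⟩, hw⟩
  · rintro ⟨x, ⟨_, _, p, hp, rfl⟩, hw⟩
    refine ⟨⟨.cons ⟨e, he⟩ rfl p, ?_⟩, ?_⟩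
    · simp [WDigraph.Walk.hops, hneg, hp]
    · change ((G.w ⟨e, he⟩ + p.weight : ℝ) : EReal) < 0
      exact_mod_cast hw

/-- The relation in terms of a path in `E⁺` from the end of `e` to that of `f`. In direction `true`
the path runs from the head of `e` to the tail of `f`; in direction `false` it runs from the head
of `f` to the tail of `e`. -/
theorem rel_iff (hun : ∀ e ∈ G.Eneg, ∀ e', G.tail e' = G.tail e → e' = e) {d : Bool} {e f : ℕ}
    (he : IsNeg G e) (hf : IsNeg G f) : Rel G d e f ↔
      ∃ x, DirPath G d (endAt G d e) (endAt G (!d) f) x ∧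
        (if d then weightOf G e else weightOf G f) + x < 0 := by
  cases d
  · have : Rel G false e f ↔ G.hopDist 1 (G.tail ⟨f, hf.1⟩) (G.tail ⟨e, he.1⟩) < 0 :=
      ⟨fun ⟨_, _, h⟩ => h, fun h => ⟨he.1, hf.1, h⟩⟩
    rw [this, hopDist_one_lt_zero_iff hun hf, ← endAt_false he.1]
    rfl
  · have : Rel G true e f ↔ G.hopDist 1 (G.tail ⟨e, he.1⟩) (G.tail ⟨f, hf.1⟩) < 0 :=
      ⟨fun ⟨_, _, h⟩ => h, fun h => ⟨he.1, hf.1, h⟩⟩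
    rw [this, hopDist_one_lt_zero_iff hun he, ← endAt_false hf.1]
    rfl

/-- A negative vertex related to itself lies on a closed path of negative weight. -/
theorem hasNegativeCycle_of_rel {d : Bool} {e : ℕ} (h : Rel G d e e) : G.HasNegativeCycle := by
  obtain ⟨he, _, h⟩ := h
  replace h : G.hopDist 1 (G.tail ⟨e, he⟩) (G.tail ⟨e, he⟩) < 0 := by cases d <;> exact h
  rw [WDigraph.hopDist, iInf_lt_iff] at h
  obtain ⟨p, hp⟩ := h
  exact ⟨_, p.1, by exact_mod_cast hp⟩

end graph

/-! ### Searching from a set of negative vertices -/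

/-- The first `c` cells of an array. -/
def cells (f : ℕ → ℕ) (c : ℕ) : List ℕ := (List.range c).map f

theorem cells_succ (f : ℕ → ℕ) (c : ℕ) : cells f (c + 1) = cells f c ++ [f c] := by
  simp [cells, List.range_succ]

theorem cells_congr {f g : ℕ → ℕ} {c : ℕ} (h : ∀ i < c, f i = g i) : cells f c = cells g c :=
  List.map_congr_left fun i hi => h i (List.mem_range.1 hi)

theorem cells_update (f : ℕ → ℕ) (c x : ℕ) :
    cells (Function.update f c x) (c + 1) = cells f c ++ [x] := by
  rw [cells_succ, Function.update_self,
    cells_congr fun i hi => Function.update_of_ne (Nat.ne_of_lt hi) x f]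

theorem mem_cells {f : ℕ → ℕ} {c x : ℕ} : x ∈ cells f c ↔ ∃ i < c, f i = x := by
  simp [cells]

@[simp] theorem length_cells (f : ℕ → ℕ) (c : ℕ) : (cells f c).length = c := by simp [cells]

section
variable {n m : ℕ} (G : WDigraph n m)

open Classical in
/-- The list of the numbers of the edges of `E⁺` that leave `u` in direction `d`. -/
noncomputable def adjList (d : Bool) (u : ℕ) : List ℕ :=
  ((List.range m).filter fun e => endAt G (!d) e = u ∧ ¬ IsNeg G e).reverse

open Classical in
/-- The list of the numbers of the edges of `E⁻`. -/
noncomputable def negEdges : List ℕ := (List.range m).filter fun e => IsNeg G e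

variable {G}

theorem mem_adjList {d : Bool} {u e : ℕ} :
    e ∈ adjList G d u ↔ e < m ∧ endAt G (!d) e = u ∧ ¬ IsNeg G e := by
  simp [adjList]

theorem mem_negEdges {e : ℕ} : e ∈ negEdges G ↔ IsNeg G e := by
  simp only [negEdges, List.mem_filter, List.mem_range, decide_eq_true_eq, and_iff_right_iff_imp]
  exact fun h => h.1

theorem nodup_negEdges : (negEdges G).Nodup := List.nodup_range.filter _

theorem length_negEdges : (negEdges G).length = G.Eneg.card := by
  classical
  rw [← List.toFinset_card_of_nodup nodup_negEdges, ← Finset.card_map Fin.valEmbedding]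
  congr 1
  ext e
  simp only [List.mem_toFinset, mem_negEdges, Finset.mem_map, Fin.valEmbedding_apply]
  exact ⟨fun ⟨h, he⟩ => ⟨_, he, rfl⟩, fun ⟨a, ha, hae⟩ => ⟨hae ▸ a.2, by subst hae; exact ha⟩⟩

/-- Every edge is in at most one adjacency list. -/
theorem sum_length_adjList_le (d : Bool) (N : ℕ) :
    ∑ u ∈ Finset.range N, (adjList G d u).length ≤ m := by
  classical
  have key : ∀ l : List ℕ, ∑ u ∈ Finset.range N,
      (l.filter fun e => endAt G (!d) e = u ∧ ¬ IsNeg G e).length ≤ l.length := by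
    intro l
    induction l with
    | nil => simp
    | cons a l ih =>
      have : ∀ u, ((a :: l).filter fun e => endAt G (!d) e = u ∧ ¬ IsNeg G e).length ≤
          (l.filter fun e => endAt G (!d) e = u ∧ ¬ IsNeg G e).length +
            if endAt G (!d) a = u then 1 else 0 := by
        intro u
        rw [List.filter_cons]
        split_ifs <;> simp_all
      refine (Finset.sum_le_sum fun u _ => this u).trans ?_
      rw [Finset.sum_add_distrib, List.length_cons]
      refine Nat.add_le_add ih ?_
      rw [Finset.sum_ite_eq]
      split_ifs <;> simp
  simpa [adjList] using key (List.range m)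

variable (G)

/-- The parts of the memory that are prepared once and for all, with the edges given by `G`. -/
structure Static (s : State) : Prop where
  n_eq : s.reg regN = n
  m_eq : s.reg regM = m
  one : s.reg regOne = 1
  zero : s.reg regZero = 0
  rzero : s.rreg rregZero = 0
  dst : ∀ d, s.arr (arrDst d) = endAt G d
  tail' : ∀ e < m, s.arr arrTail' e = endAt G false e
  weight : s.rarr rarrW = weightOf G
  chain : ∀ d, ∀ u < n, IsChain (s.arr (arrNxt d)) (s.arr (arrFst d) u) (adjList G d u)
  leaf : ∀ v < n, s.arr arrLeaf v = n + v
  neg : cells (s.arr arrNegList) (s.reg regK) = negEdges G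
  max_nonneg : 0 ≤ s.rreg rregMax
  max_le : ∀ e, IsNeg G e → -weightOf G e ≤ s.rreg rregMax

/-- The locations that `Static` speaks about. -/
def staticLocs : List Loc :=
  [.reg regN, .reg regM, .reg regOne, .reg regZero, .rreg rregZero, .arr 0, .arr 1, .arr 3,
    .rarr rarrW, .arr 4, .arr 5, .arr 6, .arr 7, .arr arrLeaf, .arr arrNegList, .reg regK,
    .rreg rregMax]

variable {G}

theorem Static.congr {s s' : State} (h : Static G s) (hs : ∀ l ∈ staticLocs, Same s s' l) :
    Static G s' := by
  simp only [staticLocs, List.forall_mem_cons, Same] at hs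
  obtain ⟨h1, h2, h3, h4, h5, h6, h7, h8, h9, h10, h11, h12, h13, h14, h15, h16, h17, -⟩ := hs
  refine ⟨h1.trans h.n_eq, h2.trans h.m_eq, h3.trans h.one, h4.trans h.zero, h5.trans h.rzero,
    fun d => ?_, by rw [h8]; exact h.tail', h9.trans h.weight, fun d => ?_,
    by rw [h14]; exact h.leaf, by rw [h15, h16]; exact h.neg, by rw [h17]; exact h.max_nonneg,
    by rw [h17]; exact h.max_le⟩
  · rw [← h.dst d]
    cases d <;> assumption
  · have := h.chain d
    cases d
    · simp only [arrNxt, arrFst] at this ⊢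
      rwa [h12, h13]
    · simp only [arrNxt, arrFst] at this ⊢
      rwa [h10, h11]

theorem Static.of_frame {s s' : State} {p : Prog} (h : Static G s) (f : Frame p s s')
    (hp : staticLocs.all (fun l => !p.writes l) = true := by rfl) : Static G s' :=
  h.congr fun l hl => f l (by simpa using List.all_eq_true.1 hp l hl)

theorem Static.hasAdj {s : State} (h : Static G s)
    (hpos : ∀ e, e ∉ G.Eneg → 0 ≤ G.w e) (d : Bool) :
    HasAdj d n (adjList G d) (endAt G d) (weightOf G) s where
  dst_eq := h.dst d
  w_eq := h.weight
  chain := h.chain d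
  dst_lt u hu e he := endAt_lt d (mem_adjList.1 he).1
  nonneg u hu e he := by
    obtain ⟨h1, -, h2⟩ := mem_adjList.1 he
    rw [weightOf_eq h1]
    exact hpos _ fun h => h2 ⟨h1, h⟩
  zero := h.zero
  rzero := h.rzero

/-- Reset all distance labels to `0`. -/
def clear : Prog := forN regI regN (.instr (.rstore rarrD regI rregZero))

/-- Give labels to the vertices from which a search in direction `d` starts, for the sample whose
size is in register `c`.  In a search against the edges the labels are shifted by the maximum
`rregMax`, so that distances too large to matter become `0`. -/
def seed (d : Bool) (c : ℕ) : Prog := forN regI c <|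
  .seq (block [.load regF arrSample regI, .load regV (arrDst d) regF]) <|
  .seq (.instr (if d then .rload rregX rarrW regF else .rneg rregX rregMax)) relax

/-- Search in direction `d` from the sample whose size is in register `c`. -/
def search (d : Bool) (c : ℕ) : Prog := .seq clear (.seq (seed d c) (dijkstra d))

/-- The value that tells whether edge `f` is related to the sample. -/
noncomputable def relVal (G : WDigraph n m) (d : Bool) (s : State) (f : ℕ) : ℝ :=
  (if d then 0 else weightOf G f + s.rreg rregMax) + s.rarr rarrD (endAt G (!d) f)

/-- Compute `relVal` for the edge in register `regF`. -/
def evalRel (d : Bool) : Prog :=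
  .seq (block [.load regV (arrDst (!d)) regF, .rload rregVal rarrD regV]) <|
  if d then .skip else
    block [.rload rregX rarrW regF, .radd rregX rregX rregMax, .radd rregVal rregX rregVal]

theorem evalRel_spec {d : Bool} {s : State} {f : ℕ} (hS : Static G s) (hf : s.reg regF = f) :
    Tri (evalRel d) s 13 fun s' => s'.rreg rregVal = relVal G d s f := by
  have h1 := hS.dst
  cases d
  · exact (Tri.block (by simp [Instr.isRand]) (Q := fun s' => s' = (s.setReg regV
      (endAt G true f)).setRReg rregVal (s.rarr rarrD (endAt G true f)))
      (by simp [Instr.eff, h1, hf])).seq fun s' hs' _ => Tri.block (by simp [Instr.isRand])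
      (by simp [Instr.eff, hs', hf, hS.weight, relVal])
  · refine Tri.mono_time ((Tri.block (by simp [Instr.isRand]) (Q := fun s' => s' = (s.setReg regV
      (endAt G false f)).setRReg rregVal (s.rarr rarrD (endAt G false f)))
      (by simp [Instr.eff, h1, hf])).seq fun s' hs' _ => Tri.skip
      (by simp [hs', relVal])) (B₁ := 5 + 1 + 1) (by norm_num)

/-- The memory between two searches. -/
structure Ready (G : WDigraph n m) (s : State) : Prop extends Static G s where
  queue : Queue n s
  key : ∀ v < n, s.rarr rarrK v = 0

/-- The locations that `Ready` speaks about. -/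
def readyLocs : List Loc := .arr arrTree :: .rarr rarrK :: staticLocs

theorem Ready.congr {s s' : State} (h : Ready G s) (hs : ∀ l ∈ readyLocs, Same s s' l) :
    Ready G s' := by
  have hS := h.toStatic.congr fun l hl => hs l (List.mem_cons_of_mem _ (List.mem_cons_of_mem _ hl))
  have h1 : s'.arr arrTree = s.arr arrTree := hs _ List.mem_cons_self
  have h2 : s'.rarr rarrK = s.rarr rarrK := hs _ (List.mem_cons_of_mem _ List.mem_cons_self)
  exact ⟨hS, ⟨hS.one, hS.leaf, by rw [h1, h2]; exact h.queue.tree⟩, by rw [h2]; exact h.key⟩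

theorem Ready.of_frame {s s' : State} {p : Prog} (h : Ready G s) (f : Frame p s s')
    (hp : readyLocs.all (fun l => !p.writes l) = true := by rfl) : Ready G s' :=
  h.congr fun l hl => f l (by simpa using List.all_eq_true.1 hp l hl)

/-- The invariant of the searches in direction `d` from the set `S`: the label `x` of the vertex `v`
belongs to a path from `S`, unless it is nonnegative. -/
def Reached (G : WDigraph n m) (M : ℝ) (d : Bool) (S : Set ℕ) (v : ℕ) (x : ℝ) : Prop :=
  0 ≤ x ∨ ∃ e ∈ S, ∃ y, DirPath G d (endAt G d e) v y ∧ x = (if d then weightOf G e else -M) + y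

/-- A bound for the running time of a search from a sample of size `c`. -/
def searchTime (n m c : ℕ) : ℕ := n * 4 + c * (treeTime n + 22) + dijkstraTime n m + 8

theorem DirPath.nil {d : Bool} {u : ℕ} (hu : u < n) : DirPath G d u u 0 := by
  cases d <;> exact PosPath.nil hu

/-- After seeding, all labels are at most `0`, are justified by `Reached`, and those at the ends of
the sampled edges are at most the intended initial labels. -/
theorem seed_spec {d : Bool} {s : State} {c : ℕ} (hS : Static G s) (hQ : Queue n s)
    (hc : c = regOne ∨ c = regR)
    (hD : ∀ v < n, s.rarr rarrD v = 0) (hK : ∀ v < n, s.rarr rarrK v = 0)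
    (hneg : ∀ e ∈ cells (s.arr arrSample) (s.reg c), IsNeg G e) :
    Tri (seed d c) s (s.reg c * (treeTime n + 19 + 3) + 3) fun s' => Queue n s' ∧
      (∀ v < n, s'.rarr rarrD v ≤ 0) ∧ (∀ v < n, s'.rarr rarrK v = s'.rarr rarrD v) ∧
      (∀ v < n, Reached G (s.rreg rregMax) d {e | e ∈ cells (s.arr arrSample) (s.reg c)} v
        (s'.rarr rarrD v)) ∧
      ∀ e ∈ cells (s.arr arrSample) (s.reg c),
        s'.rarr rarrD (endAt G d e) ≤ if d then weightOf G e else -s.rreg rregMax := by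
  set M := s.rreg rregMax with hM
  set A := s.arr arrSample with hA
  set r := s.reg c with hr
  refine (Tri.forN (fun j s' => Static G s' ∧ Queue n s' ∧ s'.arr arrSample = A ∧
      s'.rreg rregMax = M ∧
      (∀ v < n, s'.rarr rarrD v ≤ 0) ∧ (∀ v < n, s'.rarr rarrK v = s'.rarr rarrD v) ∧
      (∀ v < n, Reached G M d {e | e ∈ cells A r} v (s'.rarr rarrD v)) ∧
      ∀ i < j, s'.rarr rarrD (endAt G d (A i)) ≤ if d then weightOf G (A i) else -M)
    hr.symm (by rcases hc with rfl | rfl <;> decide) (by cases d <;> rfl)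
    (by rcases hc with rfl | rfl <;> cases d <;> rfl) ?_ ?_).mono le_rfl ?_
  · refine ⟨hS.congr (by simp [staticLocs, Same]), ⟨by simp [hQ.one], hQ.leaf, hQ.tree⟩, rfl, rfl,
      fun v hv => (hD v hv).le, fun v hv => (hK v hv).trans (hD v hv).symm,
      fun v hv => .inl (hD v hv).ge, by simp⟩
  · rintro j s hj hi hcr ⟨hS, hQ, hA', hM', hD, hK, hR, hle⟩
    have hjS : A j ∈ cells A r := mem_cells.2 ⟨j, hj, rfl⟩
    have hnegj := hneg _ hjS
    refine (Tri.mono_time ((Tri.block (by simp [Instr.isRand]) (Q := fun s' =>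
      s'.reg regF = A j ∧ s'.reg regV = endAt G d (A j))
      (by simp [Instr.eff, hi, hA', hS.dst])).seq fun s1 ⟨hF1, hV1⟩ f1 =>
      (Tri.instr (Q := fun s' => s'.rreg rregX = if d then weightOf G (A j) else -M)
        (by cases d <;> rfl)
        (by cases d <;> simp [Instr.eff, f1.rreg rregMax, f1.rarr rarrW, hM', hF1, hS.weight])).seq
        fun s2 hX2 f2 => (relax_spec (n := n) (v := endAt G d (A j))
          (x := if d then weightOf G (A j) else -M) ?_ ?_ (endAt_lt d hnegj.1) hX2).mono le_rfl
          fun s3 hs3 f3 => ?_)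
      (B₁ := 5 + (1 + (treeTime n + 11) + 1) + 1) (by omega))
    · refine ⟨?_, ?_, ?_⟩
      · rw [f2.reg regOne (by cases d <;> rfl), f1.reg regOne (by cases d <;> rfl)]
        exact hQ.one
      · rw [f2.arr arrLeaf (by cases d <;> rfl), f1.arr arrLeaf (by cases d <;> rfl)]
        exact hQ.leaf
      · rw [f2.arr arrTree (by cases d <;> rfl), f1.arr arrTree (by cases d <;> rfl),
          f2.rarr rarrK (by cases d <;> rfl), f1.rarr rarrK (by cases d <;> rfl)]
        exact hQ.tree
    · rw [f2.reg regV (by cases d <;> rfl), hV1]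
    · obtain ⟨hQ3, hs3⟩ := hs3
      rw [f2.rarr rarrD (by cases d <;> rfl), f1.rarr rarrD (by cases d <;> rfl),
        f2.rarr rarrK (by cases d <;> rfl), f1.rarr rarrK (by cases d <;> rfl)] at hs3
      have hS3 := ((hS.of_frame f1 (by cases d <;> rfl)).of_frame f2 (by cases d <;> rfl)).of_frame
        f3 (by cases d <;> rfl)
      refine ⟨hS3.congr (by simp [staticLocs, Same]), ⟨by simp [hQ3.one], hQ3.leaf, hQ3.tree⟩,
        ?_, ?_, ?_⟩
      · simp [f3.arr arrSample, f2.arr arrSample (by cases d <;> rfl),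
          f1.arr arrSample (by cases d <;> rfl), hA']
      · simp [f3.rreg rregMax, f2.rreg rregMax (by cases d <;> rfl),
          f1.rreg rregMax (by cases d <;> rfl), hM']
      simp only [State.setReg_rarr]
      have hRj : Reached G M d {e | e ∈ cells A r} (endAt G d (A j))
          (if d then weightOf G (A j) else -M) :=
        .inr ⟨A j, hjS, 0, DirPath.nil (endAt_lt d hnegj.1), by simp⟩
      set x : ℝ := if d then weightOf G (A j) else -M with hx
      set v := endAt G d (A j) with hv
      split_ifs at hs3 with hlt
      · rw [hs3.1, hs3.2]
        have hmono : ∀ u, Function.update (s.rarr rarrD) v x u ≤ s.rarr rarrD u := fun u => by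
          rw [Function.update_apply]
          split_ifs with h
          · rw [h]; exact hlt.le
          · exact le_rfl
        refine ⟨fun u hu => (hmono u).trans (hD u hu), fun u hu => ?_, fun u hu => ?_,
          fun i hi => ?_⟩
        · rw [Function.update_apply, Function.update_apply, hK u hu]
        · rw [Function.update_apply]
          split_ifs with h
          · rw [h]; exact hRj
          · exact hR u hu
        · rcases Nat.lt_succ_iff_lt_or_eq.1 hi with hi | rfl
          · exact (hmono _).trans (hle i hi)
          · exact (Function.update_self (β := fun _ => ℝ) ..).le
      · rw [hs3.1, hs3.2]
        refine ⟨hD, hK, hR, fun i hi => ?_⟩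
        rcases Nat.lt_succ_iff_lt_or_eq.1 hi with hi | rfl
        · exact hle i hi
        · exact not_lt.1 hlt
  · rintro s' ⟨-, hQ, -, -, hD, hK, hR, hle⟩ _
    refine ⟨hQ, hD, hK, hR, fun e he => ?_⟩
    obtain ⟨i, hi, rfl⟩ := mem_cells.1 he
    exact hle i hi

/-- One search decides, for all `f ∈ E⁻` at once, whether `f` is related to the sample. -/
theorem search_spec (hn : 0 < n) (hpos : ∀ e, e ∉ G.Eneg → 0 ≤ G.w e)
    (hun : ∀ e ∈ G.Eneg, ∀ e', G.tail e' = G.tail e → e' = e) {d : Bool} {s : State} {c : ℕ}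
    (hS : Ready G s) (hc : c = regOne ∨ c = regR)
    (hneg : ∀ e ∈ cells (s.arr arrSample) (s.reg c), IsNeg G e) :
    Tri (search d c) s (searchTime n m (s.reg c)) fun s' => Ready G s' ∧
      ∀ f, IsNeg G f → (relVal G d s' f < 0 ↔
        ∃ e ∈ cells (s.arr arrSample) (s.reg c), Rel G d e f) := by
  set M := s.rreg rregMax with hM
  set r := s.reg c with hr
  have hcl : Tri clear s (n * (1 + 3) + 3) fun s' => ∀ v < n, s'.rarr rarrD v = 0 := by
    refine (Tri.forN (fun j s' => s'.rreg rregZero = 0 ∧ ∀ v < j, s'.rarr rarrD v = 0) hS.n_eq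
      (by decide) rfl rfl ⟨hS.rzero, by simp⟩ ?_).mono le_rfl fun s' h _ => h.2
    rintro j s hj hi - ⟨hz, h⟩
    refine Tri.instr rfl ⟨by simpa [Instr.eff] using hz, fun v hv => ?_⟩
    simp only [Instr.eff, State.setReg_rarr, State.setRArr_rarr, if_true, hi,
      Function.update_apply, hz]
    split_ifs with hvj
    · rfl
    · exact h v (by omega)
  refine (hcl.seq (B₂ := r * (treeTime n + 19 + 3) + 3 + dijkstraTime n m + 1)
    fun s1 hD1 f1 => ?_).mono_time
    (by
      rw [searchTime, show treeTime n + 19 + 3 = treeTime n + 22 from rfl]; omega)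
  have hS1 := hS.toStatic.of_frame f1
  have hQ1 : Queue n s1 := ⟨hS1.one, hS1.leaf, by
    rw [f1.arr arrTree, f1.rarr rarrK]; exact hS.queue.tree⟩
  have hr1 : s1.reg c = r := f1.reg c (by rcases hc with rfl | rfl <;> rfl)
  have hA1 : s1.arr arrSample = s.arr arrSample := f1.arr arrSample
  have hM1 : s1.rreg rregMax = M := f1.rreg rregMax
  have hseed := seed_spec (d := d) hS1 hQ1 hc hD1 (by rw [f1.rarr rarrK]; exact hS.key)
    (by rw [hr1, hA1]; exact hneg)
  rw [hr1, hA1, hM1] at hseed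
  set S := cells (s.arr arrSample) r with hSdef
  refine hseed.seq fun s2 ⟨hQ2, hD2, hK2, hR2, hle2⟩ f2 => ?_
  have hS2 : Static G s2 :=
    hS1.of_frame f2 (by rcases hc with rfl | rfl <;> cases d <;> rfl)
  have hM2 : s2.rreg rregMax = M := (f2.rreg rregMax (by cases d <;> rfl)).trans hM1
  refine (dijkstra_spec (R := Reached G M d {e | e ∈ S}) hn (sum_length_adjList_le d n) ?_
    (hS2.hasAdj hpos d) hQ2 hD2 hR2 hK2).mono le_rfl
    fun s3 ⟨hQ3, hK3, hD3, hle3, hR3, hfix⟩ f3 => ?_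
  · rintro u hu e he x (hx | ⟨e', he', y, hy, rfl⟩)
    · refine .inl (add_nonneg hx ?_)
      exact (hS2.hasAdj hpos d).nonneg u hu e he
    · obtain ⟨hem, rfl, hen⟩ := mem_adjList.1 he
      exact .inr ⟨e', he', y + weightOf G e, hy.extend hem hen, by ring⟩
  have hS3 : Static G s3 := hS2.of_frame f3 (by cases d <;> rfl)
  have hM3 : s3.rreg rregMax = M := (f3.rreg rregMax (by cases d <;> rfl)).trans hM2
  refine ⟨⟨hS3, hQ3, hK3⟩, fun f hf => ?_⟩
  have hfix' : ∀ e < m, ¬ IsNeg G e → s3.rarr rarrD (endAt G d e) ≤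
      s3.rarr rarrD (endAt G (!d) e) + weightOf G e := fun e he hne =>
    hfix _ (endAt_lt _ he) e (mem_adjList.2 ⟨he, rfl, hne⟩)
  have hMf := hS3.max_le f hf
  rw [hM3] at hMf
  simp only [relVal, hM3]
  constructor
  · intro h
    -- In direction `false`, the summand `weightOf G f + M` of `relVal` is nonnegative by the
    -- choice of `M`; so a negative value comes from a negative label, and thus from an actual
    -- path.
    have hneg' : s3.rarr rarrD (endAt G (!d) f) < 0 := by
      cases d
      · simp at h ⊢
        linarith
      · simpa using h
    rcases hR3 _ (endAt_lt _ hf.1) with h' | ⟨e, he, y, hy, hxy⟩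
    · exact absurd hneg' (not_lt.2 h')
    · refine ⟨e, he, (rel_iff hun (hneg e he) hf).2 ⟨y, hy, ?_⟩⟩
      cases d
      · simp at h hxy ⊢
        linarith
      · simp at h hxy ⊢
        linarith
  · rintro ⟨e, he, hrel⟩
    obtain ⟨y, hy, hlt⟩ := (rel_iff hun (hneg e he) hf).1 hrel
    have h1 := hy.le_add hfix'
    have h2 := (hle3 _ (endAt_lt d (hneg e he).1)).trans (hle2 e he)
    cases d
    · simp at h1 h2 hlt ⊢
      linarith
    · simp at h1 h2 hlt ⊢
      linarith

end

/-! ### Random samples -/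

section sampling
variable {α : Type*} [Fintype α] {r : ℕ}

/-- Resampling one coordinate preserves the uniform distribution. -/
theorem sum_sum_update (j : Fin r) (f : (Fin r → α) → ℕ) :
    ∑ ω : Fin r → α, ∑ a, f (Function.update ω j a) = Fintype.card α * ∑ ω, f ω := by
  have hinv : Function.Involutive fun x : (Fin r → α) × α =>
      (Function.update x.1 j x.2, x.1 j) := fun x => by simp
  have hsum : ∑ x : (Fin r → α) × α, f (Function.update x.1 j x.2) =
      ∑ x : (Fin r → α) × α, f x.1 := Equiv.sum_comp hinv.toPerm fun x => f x.1
  rw [← Fintype.sum_prod_type' (f := fun ω a => f (Function.update ω j a)), hsum,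
    Fintype.sum_prod_type]
  simp [Finset.mul_sum]

open Classical in
/-- A coordinate of a random sample is uniformly distributed. -/
theorem card_mul_card_filter (i : Fin r) (p : α → Prop) :
    Fintype.card α * (Finset.univ.filter fun ω : Fin r → α => p (ω i)).card =
      Fintype.card α ^ r * (Finset.univ.filter p).card := by
  rw [Finset.card_filter, ← sum_sum_update i]
  simp

open Classical in
/-- For `i ≠ j`, the event that `ω i` satisfies `p` and `ω j` is one of the at most `τ` elements in
relation `q` to it has probability at most `τ / |α|`. -/
theorem card_mul_card_filter_le {i j : Fin r} (hij : i ≠ j) {p : α → Prop} {q : α → α → Prop}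
    {τ : ℕ} (h : ∀ b, p b → (Finset.univ.filter fun a => q a b).card ≤ τ) :
    Fintype.card α * (Finset.univ.filter fun ω : Fin r → α => p (ω i) ∧ q (ω j) (ω i)).card ≤
      Fintype.card α ^ r * τ := by
  rw [Finset.card_filter, ← sum_sum_update j]
  refine (Finset.sum_le_sum (g := fun _ => τ) fun ω _ => ?_).trans (by simp)
  simp only [Function.update_self, Function.update_of_ne hij]
  by_cases hp : p (ω i)
  · simp only [hp, true_and]
    rw [← Finset.card_filter]
    exact h _ hp
  · simp [hp]

open Classical in
/-- The indices of a sample whose elements are not hit by an element of the sample, and that occur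
only once. -/
noncomputable def survivors (hit : α → α → Prop) (ω : Fin r → α) : Finset (Fin r) :=
  Finset.univ.filter fun i => (∀ j, ¬ hit (ω j) (ω i)) ∧ ∀ j, ω j = ω i → j = i

open Classical in
/-- An element that is hit by itself or by at least `τ` elements. -/
def IsBad (hit : α → α → Prop) (τ : ℕ) (b : α) : Prop :=
  hit b b ∨ τ ≤ (Finset.univ.filter fun a => hit a b).card

open Classical in
/-- A lower bound for the expected number of survivors, multiplied by `|α| ^ (r + 1)`: every index
whose element is not bad survives, unless the element is equal to or hit by the element at one of
the other `r - 1` indices. -/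
theorem sum_card_survivors {hit : α → α → Prop} {τ : ℕ} :
    r * (Fintype.card α ^ r * (Finset.univ.filter fun b : α => ¬ IsBad hit τ b).card) ≤
      Fintype.card α * ∑ ω : Fin r → α, (survivors hit ω).card +
        r * ((r - 1) * (Fintype.card α ^ r * τ)) := by
  set good : α → Prop := fun b => ¬ IsBad hit τ b with hgood
  set q : α → α → Prop := fun a b => hit a b ∨ a = b with hq
  -- An element that is not bad is hit by fewer than `τ` elements, and not by itself; counting the
  -- element itself, there are at most `τ` elements `a` with `q a b`.
  have hτ : ∀ b, good b → (Finset.univ.filter fun a => q a b).card ≤ τ := by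
    intro b hb
    simp only [hgood, IsBad, not_or, not_le] at hb
    refine (Finset.card_le_card (t := insert b (Finset.univ.filter fun a => hit a b)) ?_).trans
      ((Finset.card_insert_le _ _).trans hb.2)
    intro a
    simp only [hq, Finset.mem_filter, Finset.mem_univ, true_and, Finset.mem_insert]
    tauto
  -- The union bound for a fixed sample.
  have hpt : ∀ ω : Fin r → α, ∑ i, (if good (ω i) then 1 else 0) ≤ (survivors hit ω).card +
      ∑ i, ∑ j ∈ Finset.univ.erase i, if good (ω i) ∧ q (ω j) (ω i) then 1 else 0 := by
    intro ω
    rw [survivors, Finset.card_filter, ← Finset.sum_add_distrib]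
    refine Finset.sum_le_sum fun i _ => ?_
    by_cases hg : good (ω i)
    swap
    · simp [hg]
    by_cases hs : (∀ j, ¬ hit (ω j) (ω i)) ∧ ∀ j, ω j = ω i → j = i
    · rw [if_pos hg, if_pos hs]
      omega
    · have : ∃ j, j ≠ i ∧ q (ω j) (ω i) := by
        by_contra! hcon
        refine hs ⟨fun j hj => ?_, fun j hj => ?_⟩
        · rcases eq_or_ne j i with rfl | hji
          · exact hg (.inl hj)
          · exact hcon j hji (.inl hj)
        · by_contra hji
          exact hcon j hji (.inr hj)
      obtain ⟨j, hji, hj⟩ := this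
      rw [if_pos hg, if_neg hs, zero_add]
      refine le_trans ?_ (Finset.single_le_sum (f := fun j =>
        if good (ω i) ∧ q (ω j) (ω i) then 1 else 0) (fun _ _ => Nat.zero_le _)
        (Finset.mem_erase.2 ⟨hji, Finset.mem_univ j⟩))
      simp [hg, hj]
  have h1 : Fintype.card α * ∑ ω : Fin r → α, ∑ i, (if good (ω i) then 1 else 0) =
      r * (Fintype.card α ^ r * (Finset.univ.filter good).card) := by
    rw [Finset.sum_comm, Finset.mul_sum]
    rw [Finset.sum_congr rfl fun i _ => (by
      rw [← Finset.card_filter]; convert card_mul_card_filter i good :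
        Fintype.card α * ∑ ω : Fin r → α, (if good (ω i) then 1 else 0) =
          Fintype.card α ^ r * (Finset.univ.filter good).card)]
    simp
  have h2 : Fintype.card α * ∑ ω : Fin r → α, ∑ i, ∑ j ∈ Finset.univ.erase i,
      (if good (ω i) ∧ q (ω j) (ω i) then 1 else 0) ≤
      r * ((r - 1) * (Fintype.card α ^ r * τ)) := by
    rw [Finset.sum_comm, Finset.mul_sum]
    refine (Finset.sum_le_card_nsmul _ _ ((r - 1) * (Fintype.card α ^ r * τ))
      fun i _ => ?_).trans (by simp)
    rw [Finset.sum_comm, Finset.mul_sum]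
    refine (Finset.sum_le_card_nsmul _ _ (Fintype.card α ^ r * τ) fun j hj => ?_).trans
      (by simp)
    rw [← Finset.card_filter]
    refine (le_of_eq ?_).trans (card_mul_card_filter_le (p := good) (q := q)
      (Finset.mem_erase.1 hj).1.symm fun b hb => ?_)
    · congr!
    · convert hτ b hb
  rw [← h1]
  refine (Nat.mul_le_mul_left _ (Finset.sum_le_sum fun ω _ => hpt ω)).trans ?_
  rw [Finset.sum_add_distrib, mul_add]
  exact Nat.add_le_add_left h2 _

open Classical in
/-- With probability at least `1 / 8`, the first element of a random sample is bad or at least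
`1 / 8` of the sample survives: if half of the elements are bad, then the first alternative has
probability at least `1 / 2`; otherwise a quarter of the sample survives in expectation. -/
theorem card_pow_le_card_filter (hit : α → α → Prop) {τ : ℕ} (hr : 0 < r)
    (hτ : 4 * ((r - 1) * τ) ≤ Fintype.card α) :
    Fintype.card α ^ r ≤ 8 * (Finset.univ.filter fun ω : Fin r → α =>
      IsBad hit τ (ω ⟨0, hr⟩) ∨ r ≤ 8 * (survivors hit ω).card).card := by
  set N := Fintype.card α with hN
  rcases Nat.eq_zero_or_pos N with hN0 | hN0
  · simp [hN0, hr.ne']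
  set S := Finset.univ.filter fun ω : Fin r → α =>
      IsBad hit τ (ω ⟨0, hr⟩) ∨ r ≤ 8 * (survivors hit ω).card with hS
  have hsplit := Finset.card_filter_add_card_filter_not (s := Finset.univ) (IsBad hit τ)
  rw [Finset.card_univ, ← hN] at hsplit
  by_cases hbad : N ≤ 2 * (Finset.univ.filter (IsBad hit τ)).card
  · have h1 := card_mul_card_filter (r := r) ⟨0, hr⟩ (IsBad hit τ)
    have h2 : (Finset.univ.filter fun ω : Fin r → α => IsBad hit τ (ω ⟨0, hr⟩)).card ≤ S.card :=
      Finset.card_le_card fun ω hω => by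
        simp only [hS, Finset.mem_filter, Finset.mem_univ, true_and] at hω ⊢
        exact .inl hω
    rw [← hN] at h1
    refine Nat.le_of_mul_le_mul_left ?_ hN0
    calc N * N ^ r = N ^ r * N := mul_comm _ _
      _ ≤ N ^ r * (2 * (Finset.univ.filter (IsBad hit τ)).card) := Nat.mul_le_mul_left _ hbad
      _ = 2 * (N * (Finset.univ.filter fun ω : Fin r → α => IsBad hit τ (ω ⟨0, hr⟩)).card) := by
        rw [h1]; ring
      _ ≤ 2 * (N * S.card) := by gcongr
      _ ≤ N * (8 * S.card) := by nlinarith [Nat.zero_le (N * S.card)]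
  · set g := (Finset.univ.filter fun b : α => ¬ IsBad hit τ b).card with hg
    have hg2 : N ≤ 2 * g := by omega
    have h1 : r * (N ^ r * g) ≤ N * ∑ ω : Fin r → α, (survivors hit ω).card +
        r * ((r - 1) * (N ^ r * τ)) := sum_card_survivors
    set X := ∑ ω : Fin r → α, (survivors hit ω).card with hX
    -- At most `r` survivors for each sample in `S`, and fewer than `r / 8` for each other one.
    have h2 : 8 * X ≤ 8 * (r * S.card) + r * N ^ r := by
      have hle : ∀ ω : Fin r → α, 8 * (survivors hit ω).card ≤
          8 * r * (if IsBad hit τ (ω ⟨0, hr⟩) ∨ r ≤ 8 * (survivors hit ω).card then 1 else 0)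
            + r := by
        intro ω
        have : (survivors hit ω).card ≤ r := by
          simpa using Finset.card_le_univ (survivors hit ω)
        split_ifs with h
        · omega
        · push Not at h
          omega
      rw [hX, Finset.mul_sum]
      refine (Finset.sum_le_sum fun ω _ => hle ω).trans ?_
      rw [Finset.sum_add_distrib, ← Finset.mul_sum, ← Finset.card_filter, ← hS]
      simp [← hN]
      nlinarith
    -- A quarter of the sample survives in expectation.
    have h3 : r * N ^ r * N ≤ 4 * X * N := by
      have ha : r * N ^ r * N ≤ r * N ^ r * (2 * g) := Nat.mul_le_mul_left _ hg2
      have hb : r * N ^ r * (4 * ((r - 1) * τ)) ≤ r * N ^ r * N := Nat.mul_le_mul_left _ hτ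
      nlinarith
    have h4 := Nat.le_of_mul_le_mul_right h3 hN0
    have h5 : r * N ^ r ≤ r * (8 * S.card) := by nlinarith
    exact Nat.le_of_mul_le_mul_left h5 hr

end sampling

/-! ### One stage of the algorithm -/

/-- The array listing the edges from which stage `b` samples. -/
def arrFrom : Bool → ℕ
  | false => arrNegList
  | true => arrMid

/-- The register holding the number of the edges from which stage `b` samples. -/
def regFrom : Bool → ℕ
  | false => regK
  | true => regMid

/-- The array in which stage `b` lists the edges related to its probe. -/
def arrTo : Bool → ℕ
  | false => arrMid
  | true => arrOut

/-- The register holding the number of the edges that stage `b` found related to its probe. -/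
def regTo : Bool → ℕ
  | false => regMid
  | true => regCnt

/-- The register holding the number of related edges with which the probe of stage `b` counts as
successful. -/
def regThr : Bool → ℕ
  | false => regBig
  | true => regSmall

/-- List the edges related to the probe, and note whether the probe is among them. -/
def collect (b : Bool) : Prog :=
  .seq (block [.const (regTo b) 0, .copy regSelf regZero, .load regE arrSample regZero]) <|
  forN regI (regFrom b) <|
    .seq (.instr (.load regF (arrFrom b) regI)) <|
    .seq (evalRel b) <|
    .ite (.rlt rregVal rregZero)
      (.seq (block [.store (arrTo b) (regTo b) regF, .succ (regTo b) (regTo b)])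
        (.ite (.eq regF regE) (.instr (.copy regSelf regOne)) .skip))
      .skip

/-- For every sampled edge, record an index at which it was sampled. -/
def mark : Prog :=
  forN regI regR (block [.load regF arrSample regI, .store arrMark regF regI])

/-- List the sampled edges that are not related to the sample. -/
def collectFree (d : Bool) : Prog :=
  .seq (.instr (.const regCnt 0)) <|
  forN regI regR <|
    .seq (block [.load regF arrSample regI, .load regT arrMark regF]) <|
    .ite (.eq regT regI)
      (.seq (evalRel d) (.ite (.rlt rregVal rregZero) .skip
        (block [.store arrOut regCnt regF, .succ regCnt regCnt])))
      .skip

/-- Find an independent set in the sample of stage `b`. -/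
def thin (b : Bool) : Prog :=
  .seq (search (!b) regR) <| .seq mark <| .seq (collectFree (!b)) <|
  .ite (.lt regCnt regS) .skip (block [.const regKind 2, .const regDone 1])

/-- Stage `b` of the algorithm, after the sample has been drawn.  The first element of the sample
serves as probe. -/
def analyze (b : Bool) : Prog :=
  .seq (search b regOne) <| .seq (collect b) <|
  .ite (.eq regSelf regOne) (block [.const regKind 0, .const regDone 1]) <|
  .ite (.lt (regTo b) (regThr b)) (thin b) (.instr (.const regFlag 1))

section
variable {n m : ℕ} {G : WDigraph n m}

open Classical in
/-- The edges with negative `relVal` are collected in order, so that the resulting list is a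
sublist of the given one. -/
theorem collect_spec {b : Bool} {s : State} (hS : Static G s) :
    Tri (collect b) s (s.reg (regFrom b) * 30 + 11) fun s' =>
      cells (s'.arr (arrTo b)) (s'.reg (regTo b)) =
        (cells (s.arr (arrFrom b)) (s.reg (regFrom b))).filter (fun f => relVal G b s f < 0) ∧
      (s'.reg regSelf = 1 ↔ s.arr arrSample 0 ∈
        (cells (s.arr (arrFrom b)) (s.reg (regFrom b))).filter (fun f => relVal G b s f < 0)) := by
  set A := s.arr (arrFrom b) with hA
  set N := s.reg (regFrom b) with hN
  set v := s.arr arrSample 0 with hv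
  set P : ℕ → Prop := fun f => relVal G b s f < 0 with hP
  have hd : ∀ l : ℕ, (cells A 0).filter (fun f => P f) = [] := fun _ => rfl
  refine ((Tri.block (by cases b <;> simp [Instr.isRand]) (Q := fun s1 => Static G s1 ∧
    s1.arr = s.arr ∧ s1.rarr = s.rarr ∧ s1.rreg = s.rreg ∧ s1.reg (regFrom b) = N ∧
    s1.reg regE = v ∧ s1.reg regSelf = 0 ∧ s1.reg (regTo b) = 0) ?_).seq
    (B₂ := N * (27 + 3) + 3) fun s1 h1 _ => ?_).mono_time (by simp; omega)
  · refine ⟨hS.congr (by cases b <;> simp [staticLocs, Same, Instr.eff, regTo]), ?_⟩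
    cases b <;> simp [Instr.eff, regTo, regFrom, hN, hS.zero, hv]
  obtain ⟨hS1, ha1, hr1, hrr1, hN1, hE1, hs1, hc1⟩ := h1
  refine (Tri.forN (fun j s' => Static G s' ∧ s'.arr (arrFrom b) = A ∧ s'.rreg rregMax =
      s.rreg rregMax ∧ s'.rarr rarrD = s.rarr rarrD ∧ s'.reg regE = v ∧
      cells (s'.arr (arrTo b)) (s'.reg (regTo b)) = (cells A j).filter (fun f => P f) ∧
      (s'.reg regSelf = 1 ↔ v ∈ (cells A j).filter (fun f => P f)))
    hN1 (by cases b <;> decide) (by cases b <;> rfl) (by cases b <;> rfl) ?_ ?_).mono le_rfl ?_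
  · refine ⟨hS1.congr (by simp [staticLocs, Same]), by simp [ha1, hA], by simp [hrr1],
      by simp [hr1], by simp [hE1], ?_, by simp [hs1, hd 0]⟩
    rw [hd 0]
    cases b <;> simp [regTo, cells] <;> exact hc1
  · rintro j s2 hj hi hN2 ⟨hS2, hA2, hM2, hD2, hE2, hl2, hs2⟩
    refine Tri.mono_time ((Tri.instr rfl (Q := fun s' => s' = s2.setReg regF (A j))
      (by simp [Instr.eff, hi, hA2])).seq fun s3 hs3 f3 => ?_) (B₁ := 1 + 24 + 1) (by norm_num)
    have hS3 : Static G s3 := hS2.of_frame f3 (by cases b <;> rfl)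
    have hval : relVal G b s3 (A j) = relVal G b s (A j) := by
      simp [relVal, hs3, hM2, hD2]
    refine Tri.mono_time ((evalRel_spec (d := b) hS3 (f := A j) (by simp [hs3])).seq
      fun s4 hv4 f4 => ?_) (B₁ := 13 + 10 + 1) (by norm_num)
    have hS4 : Static G s4 := hS3.of_frame f4 (by cases b <;> rfl)
    rw [hval] at hv4
    have e1 : s4.arr (arrFrom b) = A := by
      rw [f4.arr _ (by cases b <;> rfl), f3.arr _ (by cases b <;> rfl), hA2]
    have e2 : s4.rreg rregMax = s.rreg rregMax := by
      rw [f4.rreg _ (by cases b <;> rfl), f3.rreg _ (by cases b <;> rfl), hM2]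
    have e3 : s4.rarr rarrD = s.rarr rarrD := by
      rw [f4.rarr _ (by cases b <;> rfl), f3.rarr _ (by cases b <;> rfl), hD2]
    have e4 : s4.reg regE = v := by
      rw [f4.reg _ (by cases b <;> rfl), f3.reg _ (by cases b <;> rfl), hE2]
    have e5 : s4.reg regF = A j := by
      rw [f4.reg _ (by cases b <;> rfl), hs3]; simp
    have e6 : s4.arr (arrTo b) = s2.arr (arrTo b) := by
      rw [f4.arr _ (by cases b <;> rfl), f3.arr _ (by cases b <;> rfl)]
    have e7 : s4.reg (regTo b) = s2.reg (regTo b) := by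
      rw [f4.reg _ (by cases b <;> rfl), f3.reg _ (by cases b <;> rfl)]
    have e8 : s4.reg regSelf = s2.reg regSelf := by
      rw [f4.reg _ (by cases b <;> rfl), f3.reg _ (by cases b <;> rfl)]
    refine Tri.ite (B := 9) (fun hb => ?_) fun hb => Tri.mono_time (Tri.skip ?_) (by norm_num)
    · have hPj : P (A j) := by simpa [Test.Holds, hv4, hS4.rzero] using hb
      have hfl : (cells A (j + 1)).filter (fun f => P f) =
          (cells A j).filter (fun f => P f) ++ [A j] := by
        rw [cells_succ, List.filter_append]; simp [hPj]
      refine Tri.mono_time ((Tri.block (by simp [Instr.isRand]) (Q := fun s5 =>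
        cells (s5.arr (arrTo b)) (s5.reg (regTo b)) = (cells A (j + 1)).filter (fun f => P f))
        ?_).seq fun s5 hl5 f5 => ?_) (B₁ := 5 + 2 + 1) (by norm_num)
      · rw [hfl, ← hl2, ← e6, ← e7, ← cells_update]
        simp [Instr.eff, e5]
      have hS5 : Static G s5 := hS4.of_frame f5 (by cases b <;> rfl)
      have g1 : s5.arr (arrFrom b) = A := (f5.arr _ (by cases b <;> rfl)).trans e1
      have g2 : s5.rreg rregMax = s.rreg rregMax := (f5.rreg _ (by cases b <;> rfl)).trans e2
      have g3 : s5.rarr rarrD = s.rarr rarrD := (f5.rarr _ (by cases b <;> rfl)).trans e3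
      have g4 : s5.reg regE = v := (f5.reg _ (by cases b <;> rfl)).trans e4
      have g5 : s5.reg regF = A j := (f5.reg _ (by cases b <;> rfl)).trans e5
      have g8 : s5.reg regSelf = s2.reg regSelf := (f5.reg _ (by cases b <;> rfl)).trans e8
      refine Tri.ite (fun hb => Tri.instr rfl ?_) fun hb => Tri.skip ?_
      · have hvA : A j = v := by simpa [Test.Holds, g4, g5] using hb
        refine ⟨hS5.congr (by simp [staticLocs, Same, Instr.eff]), by simpa [Instr.eff] using g1,
          by simpa [Instr.eff] using g2, by simpa [Instr.eff] using g3,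
          by simpa [Instr.eff] using g4, ?_, ?_⟩
        · rw [← hl5]
          cases b <;> simp [Instr.eff, regTo]
        · rw [hfl]
          simp [Instr.eff, hS5.one, hvA]
      · have hvA : ¬ A j = v := by simpa [Test.Holds, g4, g5] using hb
        refine ⟨hS5.congr (by simp [staticLocs, Same]), by simpa using g1,
          by simpa using g2, by simpa using g3, by simpa using g4, ?_, ?_⟩
        · rw [← hl5]
          cases b <;> simp [regTo]
        · rw [hfl]
          have hvA' : v ≠ A j := fun h => hvA h.symm
          simp only [State.setReg_reg, List.mem_append, List.mem_singleton, hvA', or_false]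
          simpa [g8] using hs2
    · have hPj : ¬ P (A j) := by simpa [hP, Test.Holds, hv4, hS4.rzero] using hb
      have hfl : (cells A (j + 1)).filter (fun f => P f) = (cells A j).filter (fun f => P f) := by
        rw [cells_succ, List.filter_append]; simp [hPj]
      rw [hfl]
      refine ⟨hS4.congr (by simp [staticLocs, Same]), by simpa using e1,
          by simpa using e2, by simpa using e3, by simpa using e4, ?_, ?_⟩
      · rw [← hl2, ← e6, ← e7]
        cases b <;> simp [regTo]
      · simpa [e8] using hs2
  · rintro s' ⟨-, -, -, -, -, hl, hs⟩ _
    exact ⟨hl, hs⟩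

/-- If `A i` is sampled several times, `arrMark` holds the same index for all of them, and `A`
takes the same value there. The initial contents of `arrMark` play no role. -/
theorem mark_spec (s : State) :
    Tri mark s (s.reg regR * 8 + 3) fun s' => ∀ i < s.reg regR,
      s'.arr arrMark (s.arr arrSample i) < s.reg regR ∧
      s.arr arrSample (s'.arr arrMark (s.arr arrSample i)) = s.arr arrSample i := by
  set A := s.arr arrSample with hA
  refine (Tri.forN (fun j s' => s'.arr arrSample = A ∧ ∀ i < j,
    s'.arr arrMark (A i) < j ∧ A (s'.arr arrMark (A i)) = A i) rfl (by decide) rfl rfl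
    ⟨rfl, by simp⟩ ?_).mono le_rfl fun s' h _ => h.2
  rintro j s hj hi - ⟨hA, h⟩
  refine Tri.block (by simp [Instr.isRand]) ?_
  simp only [List.foldl, Instr.eff, State.setReg_arr, State.setArr_arr, State.setReg_reg, hA, hi,
    if_true]
  refine ⟨by simp, fun i hi => ?_⟩
  simp only [Function.update_apply]
  norm_num
  split_ifs with hij
  · exact ⟨by omega, hij.symm⟩
  · have hlt : i < j := by
      rcases Nat.lt_succ_iff_lt_or_eq.1 hi with h | rfl
      · exact h
      · exact absurd rfl hij
    exact ⟨(h i hlt).1.le, (h i hlt).2⟩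

open Classical in
/-- Only the marked index of each sampled edge is taken into account, so that the resulting list
has no repetitions. -/
theorem collectFree_spec {d : Bool} {s : State} (hS : Static G s) :
    Tri (collectFree d) s (s.reg regR * 31 + 5) fun s' =>
      cells (s'.arr arrOut) (s'.reg regCnt) = ((List.range (s.reg regR)).filter fun i =>
        s.arr arrMark (s.arr arrSample i) = i ∧ ¬ relVal G d s (s.arr arrSample i) < 0).map
          (s.arr arrSample) := by
  set A := s.arr arrSample with hA
  set N := s.reg regR with hN
  set P : ℕ → Prop := fun i => s.arr arrMark (A i) = i ∧ ¬ relVal G d s (A i) < 0 with hP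
  refine ((Tri.instr rfl (Q := fun s1 => s1 = s.setReg regCnt 0) rfl).seq
    (B₂ := N * (28 + 3) + 3) fun s1 h1 _ => ?_).mono_time (by omega)
  refine (Tri.forN (fun j s' => Static G s' ∧ s'.arr arrSample = A ∧
      s'.arr arrMark = s.arr arrMark ∧ s'.rreg rregMax = s.rreg rregMax ∧
      s'.rarr rarrD = s.rarr rarrD ∧
      cells (s'.arr arrOut) (s'.reg regCnt) = ((List.range j).filter (fun i => P i)).map A)
    (by simp [h1, hN]) (by decide) (by cases d <;> rfl) (by cases d <;> rfl) ?_ ?_).mono le_rfl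
    fun s' h _ => h.2.2.2.2.2
  · exact ⟨hS.congr (by simp [staticLocs, Same, h1]), by simp [h1, hA], by simp [h1], by simp [h1],
      by simp [h1], by simp [h1, cells]⟩
  · rintro j s2 hj hi hN2 ⟨hS2, hA2, hK2, hM2, hD2, hl2⟩
    refine Tri.mono_time ((Tri.block (by simp [Instr.isRand]) (Q := fun s' => s' =
      (s2.setReg regF (A j)).setReg regT (s.arr arrMark (A j)))
      (by simp [Instr.eff, hi, hA2, hK2])).seq fun s3 hs3 f3 => ?_) (B₁ := 5 + 22 + 1)
      (by norm_num)
    have hS3 : Static G s3 := hS2.of_frame f3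
    have hlP : P j → ((List.range (j + 1)).filter (fun i => P i)).map A =
        ((List.range j).filter (fun i => P i)).map A ++ [A j] := fun h => by
      rw [List.range_succ, List.filter_append]; simp [h]
    have hlN : ¬ P j → ((List.range (j + 1)).filter (fun i => P i)).map A =
        ((List.range j).filter (fun i => P i)).map A := fun h => by
      rw [List.range_succ, List.filter_append]; simp [h]
    refine Tri.ite (B := 21) (fun hb => ?_) fun hb => Tri.mono_time (Tri.skip ?_) (by norm_num)
    · have hb : s.arr arrMark (A j) = j := by simpa [Test.Holds, hs3, hi] using hb
      have hval : relVal G d s3 (A j) = relVal G d s (A j) := by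
        simp [relVal, hs3, hM2, hD2]
      refine Tri.mono_time ((evalRel_spec (d := d) hS3 (f := A j) (by simp [hs3])).seq
        fun s4 hv4 f4 => ?_) (B₁ := 13 + 6 + 1) (by norm_num)
      have hS4 : Static G s4 := hS3.of_frame f4 (by cases d <;> rfl)
      rw [hval] at hv4
      have e1 : s4.arr arrSample = A := by
        rw [f4.arr _ (by cases d <;> rfl), hs3]; simpa using hA2
      have e2 : s4.arr arrMark = s.arr arrMark := by
        rw [f4.arr _ (by cases d <;> rfl), hs3]; simpa using hK2
      have e3 : s4.rreg rregMax = s.rreg rregMax := by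
        rw [f4.rreg _ (by cases d <;> rfl), hs3]; simpa using hM2
      have e4 : s4.rarr rarrD = s.rarr rarrD := by
        rw [f4.rarr _ (by cases d <;> rfl), hs3]; simpa using hD2
      have e5 : s4.reg regF = A j := by
        rw [f4.reg _ (by cases d <;> rfl), hs3]; simp
      have e6 : s4.arr arrOut = s2.arr arrOut := by
        rw [f4.arr _ (by cases d <;> rfl), hs3]; simp
      have e7 : s4.reg regCnt = s2.reg regCnt := by
        rw [f4.reg _ (by cases d <;> rfl), hs3]; simp
      refine Tri.ite (B := 5) (fun hb' => Tri.mono_time (Tri.skip ?_) (by norm_num)) fun hb' =>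
        Tri.block (by simp [Instr.isRand]) ?_
      · have hPj : ¬ P j := fun h => h.2 (by simpa [Test.Holds, hv4, hS4.rzero] using hb')
        rw [hlN hPj]
        exact ⟨hS4.congr (by simp [staticLocs, Same]), by simpa using e1, by simpa using e2,
          by simpa using e3, by simpa using e4, by simpa [e6, e7] using hl2⟩
      · have hPj : P j := ⟨hb, by simpa [Test.Holds, hv4, hS4.rzero] using hb'⟩
        rw [hlP hPj, ← hl2, ← e6, ← e7, ← cells_update]
        refine ⟨hS4.congr (by simp [staticLocs, Same, Instr.eff]), by simpa [Instr.eff] using e1,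
          by simpa [Instr.eff] using e2, by simpa [Instr.eff] using e3,
          by simpa [Instr.eff] using e4, by simp [Instr.eff, e5]⟩
    · have hPj : ¬ P j := fun h => hb (by simpa [Test.Holds, hs3, hi] using h.1)
      rw [hlN hPj]
      exact ⟨hS3.congr (by simp [staticLocs, Same]), by simpa [hs3] using hA2,
        by simpa [hs3] using hK2, by simpa [hs3] using hM2, by simpa [hs3] using hD2,
        by simpa [hs3] using hl2⟩

end

section
variable {n m : ℕ} {G : WDigraph n m}

/-- The memory holds a list of distinct, pairwise unrelated edges of `E⁻` as result. -/
structure IndepResult (G : WDigraph n m) (s : State) : Prop where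
  nodup : (cells (s.arr arrOut) (s.reg regCnt)).Nodup
  neg : ∀ e ∈ cells (s.arr arrOut) (s.reg regCnt), IsNeg G e
  indep : ∀ e ∈ cells (s.arr arrOut) (s.reg regCnt), ∀ f ∈ cells (s.arr arrOut) (s.reg regCnt),
    ¬ Rel G true e f

open Classical in
/-- The indices below `r` of the sampled edges that are not related to the sample, and that have
been sampled only once. -/
noncomputable def freeIndices (G : WDigraph n m) (d : Bool) (A : ℕ → ℕ) (r : ℕ) : Finset ℕ :=
  (Finset.range r).filter fun i => (∀ j < r, ¬ Rel G d (A i) (A j)) ∧ ∀ j < r, A j = A i → j = i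

/-- A bound for the running time of `thin`. -/
def thinTime (n m r : ℕ) : ℕ := searchTime n m r + r * 40 + 30

/-- The search in direction `!b` removes the sampled edges `e` with `Rel G b e f` for a sampled
`f`. The remaining edges are independent; among them are those with a free index. -/
theorem thin_spec (hn : 0 < n) (hpos : ∀ e, e ∉ G.Eneg → 0 ≤ G.w e)
    (hun : ∀ e ∈ G.Eneg, ∀ e', G.tail e' = G.tail e → e' = e) {b : Bool} {s : State}
    (hS : Ready G s) (hneg : ∀ e ∈ cells (s.arr arrSample) (s.reg regR), IsNeg G e)
    (hdone : s.reg regDone = 0) :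
    Tri (thin b) s (thinTime n m (s.reg regR)) fun s' => Ready G s' ∧
      (s'.reg regDone = 1 ∧ s'.reg regKind = 2 ∧ IndepResult G s' ∧ s.reg regS ≤ s'.reg regCnt ∨
        s'.reg regDone = 0 ∧
          (freeIndices G b (s.arr arrSample) (s.reg regR)).card < s.reg regS) := by
  classical
  set A := s.arr arrSample with hA
  set r := s.reg regR with hr
  refine ((search_spec hn hpos hun (d := !b) (c := regR) hS (.inr rfl) hneg).seq
    (B₂ := (r * 8 + 3) + ((r * 31 + 5) + 6 + 1) + 1) fun s1 ⟨hS1, hv1⟩ f1 => ?_).mono_time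
    (by simp only [thinTime, ← hr]; omega)
  have hr1 : s1.reg regR = r := f1.reg regR (by cases b <;> rfl)
  have hA1 : s1.arr arrSample = A := f1.arr arrSample (by cases b <;> rfl)
  have hmark := mark_spec s1
  rw [hr1, hA1] at hmark
  refine hmark.seq fun s2 hm2 f2 => ?_
  have hS2 : Ready G s2 := hS1.of_frame f2
  have hA2 : s2.arr arrSample = A := (f2.arr arrSample).trans hA1
  have hcol := collectFree_spec (d := !b) hS2.toStatic
  have hval : ∀ f, relVal G (!b) s2 f = relVal G (!b) s1 f := fun f => by
    simp only [relVal, f2.rreg rregMax, f2.rarr rarrD]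
  rw [f2.reg regR, hr1, hA2] at hcol
  simp only [hval] at hcol
  refine hcol.seq (B₂ := 6) fun s3 hl3 f3 => ?_
  have hS3 : Ready G s3 := hS2.of_frame f3 (by cases b <;> rfl)
  have hd3 : s3.reg regDone = 0 := by
    rw [f3.reg regDone (by cases b <;> rfl), f2.reg regDone (by cases b <;> rfl),
      f1.reg regDone (by cases b <;> rfl), hdone]
  have hthr : s3.reg regS = s.reg regS := by
    rw [f3.reg regS (by cases b <;> rfl), f2.reg regS (by cases b <;> rfl),
      f1.reg regS (by cases b <;> rfl)]
  set Q : ℕ → Prop := fun i => s2.arr arrMark (A i) = i ∧ ¬ relVal G (!b) s1 (A i) < 0 with hQ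
  have hQr : ∀ i < r, (relVal G (!b) s1 (A i) < 0 ↔ ∃ j < r, Rel G b (A i) (A j)) := by
    intro i hi
    rw [hv1 _ (hneg _ (mem_cells.2 ⟨i, hi, rfl⟩))]
    constructor
    · rintro ⟨e, he, hrel⟩
      obtain ⟨j, hj, rfl⟩ := mem_cells.1 he
      exact ⟨j, hj, rel_not.1 hrel⟩
    · rintro ⟨j, hj, hrel⟩
      exact ⟨A j, mem_cells.2 ⟨j, hj, rfl⟩, rel_not.2 hrel⟩
  have hlen : s3.reg regCnt = ((Finset.range r).filter Q).card := by
    have := congrArg List.length hl3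
    rw [length_cells, List.length_map] at this
    rw [this]
    rfl
  have hfree : (freeIndices G b A r).card ≤ s3.reg regCnt := by
    rw [hlen]
    refine Finset.card_le_card fun i hi => ?_
    simp only [freeIndices, Finset.mem_filter, Finset.mem_range] at hi ⊢
    refine ⟨hi.1, hi.2.2 _ (hm2 i hi.1).1 (hm2 i hi.1).2, ?_⟩
    rw [hQr i hi.1]
    push Not
    exact hi.2.1
  have hindep : IndepResult G s3 := by
    have hmem : ∀ e ∈ cells (s3.arr arrOut) (s3.reg regCnt), ∃ i < r, Q i ∧ A i = e := by
      rw [hl3]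
      intro e he
      simp only [List.mem_map, List.mem_filter, List.mem_range, decide_eq_true_eq] at he
      obtain ⟨i, ⟨hi, hQi⟩, rfl⟩ := he
      exact ⟨i, hi, hQi, rfl⟩
    have hind : ∀ e ∈ cells (s3.arr arrOut) (s3.reg regCnt),
        ∀ f ∈ cells (s3.arr arrOut) (s3.reg regCnt), ¬ Rel G b e f := by
      intro e he f hf hrel
      obtain ⟨i, hi, hQi, rfl⟩ := hmem e he
      obtain ⟨j, hj, -, rfl⟩ := hmem f hf
      exact hQi.2 ((hQr i hi).2 ⟨j, hj, hrel⟩)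
    refine ⟨?_, fun e he => ?_, fun e he f hf hrel => ?_⟩
    · rw [hl3]
      refine (List.nodup_range.filter _).map_on fun i hi j hj hij => ?_
      simp only [List.mem_filter, decide_eq_true_eq] at hi hj
      rw [← hi.2.1, ← hj.2.1, hij]
    · obtain ⟨i, hi, -, rfl⟩ := hmem e he
      exact hneg _ (mem_cells.2 ⟨i, hi, rfl⟩)
    · cases b
      · exact hind f hf e he (rel_not.1 hrel)
      · exact hind e he f hf hrel
  refine Tri.ite (B := 5) (fun hb => Tri.mono_time (Tri.skip ?_) (by norm_num)) fun hb =>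
    Tri.block (by simp [Instr.isRand]) ?_
  · have hb : s3.reg regCnt < s.reg regS := by simpa [Test.Holds, hthr] using hb
    exact ⟨hS3, .inr ⟨hd3, hfree.trans_lt hb⟩⟩
  · have hb : s.reg regS ≤ s3.reg regCnt := by simpa [Test.Holds, hthr] using hb
    refine ⟨hS3.congr (by simp [readyLocs, staticLocs, Same, Instr.eff]),
      .inl ⟨by simp [Instr.eff], by simp [Instr.eff], ⟨?_, ?_, ?_⟩, by simpa [Instr.eff] using hb⟩⟩
    · simpa [Instr.eff] using hindep.nodup
    · simpa [Instr.eff] using hindep.neg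
    · simpa [Instr.eff] using hindep.indep

/-- A bound for the running time of `analyze`, if there are at most `n` negative edges. -/
def analyzeTime (n m r : ℕ) : ℕ := searchTime n m 1 + n * 30 + thinTime n m r + 20

open Classical in
/-- The possible results of stage `b`: it has found a negative cycle, or an independent set, or
many edges related to its probe; or the sample was unlucky. -/
inductive StageResult (G : WDigraph n m) (b : Bool) (s s' : State) : Prop
  | cycle (hdone : s'.reg regDone = 1) (hflag : s'.reg regFlag = 0)
      (hkind : s'.reg regKind = 0) (h : G.HasNegativeCycle)
  | independent (hdone : s'.reg regDone = 1) (hflag : s'.reg regFlag = 0)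
      (hkind : s'.reg regKind = 2) (h : IndepResult G s') (hs : s.reg regS ≤ s'.reg regCnt)
  | many (hdone : s'.reg regDone = 0) (hflag : s'.reg regFlag = 1)
      (h : cells (s'.arr (arrTo b)) (s'.reg (regTo b)) =
        (cells (s.arr (arrFrom b)) (s.reg (regFrom b))).filter
          fun f => Rel G b (s.arr arrSample 0) f)
      (hs : s.reg (regThr b) ≤ s'.reg (regTo b))
  | unlucky (hdone : s'.reg regDone = 0) (hflag : s'.reg regFlag = 0)
      (hself : ¬ Rel G b (s.arr arrSample 0) (s.arr arrSample 0))
      (hfew : ((cells (s.arr (arrFrom b)) (s.reg (regFrom b))).filter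
          fun f => Rel G b (s.arr arrSample 0) f).length < s.reg (regThr b))
      (hfree : (freeIndices G b (s.arr arrSample) (s.reg regR)).card < s.reg regS)

/-- For a fixed sample, the stage ends with one of the results listed in `StageResult`. -/
theorem analyze_spec (hn : 0 < n) (hpos : ∀ e, e ∉ G.Eneg → 0 ≤ G.w e)
    (hun : ∀ e ∈ G.Eneg, ∀ e', G.tail e' = G.tail e → e' = e) {b : Bool} {s : State}
    (hS : Ready G s) (hr : 0 < s.reg regR)
    (hneg : ∀ e ∈ cells (s.arr (arrFrom b)) (s.reg (regFrom b)), IsNeg G e)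
    (hsample : ∀ j < s.reg regR,
      s.arr arrSample j ∈ cells (s.arr (arrFrom b)) (s.reg (regFrom b)))
    (hdone : s.reg regDone = 0) (hflag : s.reg regFlag = 0) (hle : s.reg (regFrom b) ≤ n) :
    Tri (analyze b) s (analyzeTime n m (s.reg regR)) fun s' => Ready G s' ∧
      StageResult G b s s' := by
  classical
  set U := cells (s.arr (arrFrom b)) (s.reg (regFrom b)) with hU
  set A := s.arr arrSample with hA
  set N := s.reg (regFrom b) with hN
  have hA0 : IsNeg G (A 0) := hneg _ (hsample 0 hr)
  have hcells1 : cells A (s.reg regOne) = [A 0] := by simp [hS.one, cells]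
  have hsearch := search_spec hn hpos hun (d := b) (c := regOne) hS (.inl rfl)
    (by rw [hcells1]; simpa using hA0)
  rw [hcells1, hS.one] at hsearch
  refine (hsearch.seq (B₂ := (N * 30 + 11) + (thinTime n m (s.reg regR) + 4 + 2) + 1)
    fun s1 ⟨hS1, hv1⟩ f1 => ?_).mono_time (by simp only [analyzeTime]; omega)
  have hcol := collect_spec (b := b) hS1.toStatic
  rw [f1.arr (arrFrom b) (by cases b <;> rfl), f1.reg (regFrom b) (by cases b <;> rfl),
    f1.arr arrSample (by cases b <;> rfl)] at hcol
  rw [← hU, ← hN, ← hA] at hcol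
  have hfil : U.filter (fun f => relVal G b s1 f < 0) = U.filter (fun f => Rel G b (A 0) f) := by
    refine List.filter_congr fun f hf => ?_
    simp [hv1 f (hneg f hf)]
  rw [hfil] at hcol
  refine hcol.seq fun s2 ⟨hl2, hs2⟩ f2 => ?_
  have hS2 : Ready G s2 := hS1.of_frame f2 (by cases b <;> rfl)
  have hd2 : s2.reg regDone = 0 := by
    rw [f2.reg regDone (by cases b <;> rfl), f1.reg regDone (by cases b <;> rfl), hdone]
  have hf2 : s2.reg regFlag = 0 := by
    rw [f2.reg regFlag (by cases b <;> rfl), f1.reg regFlag (by cases b <;> rfl), hflag]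
  have hr2 : s2.reg regR = s.reg regR := by
    rw [f2.reg regR (by cases b <;> rfl), f1.reg regR (by cases b <;> rfl)]
  have ht2 : s2.reg (regThr b) = s.reg (regThr b) := by
    rw [f2.reg (regThr b) (by cases b <;> rfl), f1.reg (regThr b) (by cases b <;> rfl)]
  have hS2' : s2.reg regS = s.reg regS := by
    rw [f2.reg regS (by cases b <;> rfl), f1.reg regS (by cases b <;> rfl)]
  have hA2 : s2.arr arrSample = A := by
    rw [f2.arr arrSample (by cases b <;> rfl), f1.arr arrSample (by cases b <;> rfl)]
  have hself : s2.reg regSelf = 1 ↔ Rel G b (A 0) (A 0) := by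
    rw [hs2]
    simp [hsample 0 hr]
  refine Tri.ite (fun hb => ?_) fun hb => ?_
  · have hb : s2.reg regSelf = 1 := by simpa [Test.Holds, hS2.one] using hb
    refine Tri.mono_time (Tri.block (by simp [Instr.isRand]) ⟨hS2.congr
      (by simp [readyLocs, staticLocs, Same, Instr.eff]), .cycle (by simp [Instr.eff])
      (by simpa [Instr.eff] using hf2) (by simp [Instr.eff])
      (hasNegativeCycle_of_rel (hself.1 hb))⟩) (by simp)
  · have hb : ¬ s2.reg regSelf = 1 := by simpa [Test.Holds, hS2.one] using hb
    refine Tri.mono_time (Tri.ite (B := thinTime n m (s.reg regR)) (fun hb' => ?_) fun hb' =>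
      (Tri.instr rfl ?_).mono_time (by simp only [thinTime]; omega)) (by omega)
    · have hb' : s2.reg (regTo b) < s.reg (regThr b) := by simpa [Test.Holds, ht2] using hb'
      have hthin := thin_spec (b := b) hn hpos hun hS2 (fun e he => by
        rw [hr2, hA2] at he
        obtain ⟨i, hi, rfl⟩ := mem_cells.1 he
        exact hneg _ (hsample i hi)) hd2
      rw [hr2, hA2, hS2'] at hthin
      refine hthin.mono le_rfl fun s3 ⟨hS3, h3⟩ f3 => ⟨hS3, ?_⟩
      have hf3 : s3.reg regFlag = 0 := by rw [f3.reg regFlag (by cases b <;> rfl), hf2]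
      rcases h3 with ⟨h1, h2, h3, h4⟩ | ⟨h1, h2⟩
      · exact .independent h1 hf3 h2 h3 h4
      · refine .unlucky h1 hf3 (fun h => hb (hself.2 h)) ?_ h2
        · rw [← hU, ← hA, ← hl2, length_cells]
          exact hb'
    · have hb' : s.reg (regThr b) ≤ s2.reg (regTo b) := by simpa [Test.Holds, ht2] using hb'
      refine ⟨hS2.congr (by simp [readyLocs, staticLocs, Same, Instr.eff]), .many ?_ ?_ ?_ ?_⟩
      · simpa [Instr.eff] using hd2
      · simp [Instr.eff]
      · rw [← hU, ← hA, ← hl2]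
        cases b <;> simp [Instr.eff, regTo]
      · cases b <;> simpa [Instr.eff, regTo] using hb'

end

/-! ### Programs that draw random numbers -/

/-- Within `B` steps, the program `p` started in `s` ends in one of the memories `σ ω`, where `ω` is
uniformly distributed in `Ω`. -/
structure Spread (p : Prog) (s : State) (B : ℕ) {Ω : Type} [Fintype Ω] (σ : Ω → State) : Prop where
  prob : ∀ K u, ∑ ω, haltProb (K, σ ω) u ≤ Fintype.card Ω * haltProb (p :: K, s) (u + B)
  sound : ∀ K d t, MayHalt (p :: K, s) d t → ∃ ω, ∃ t' ≤ t, MayHalt (K, σ ω) d t'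

namespace Spread
variable {p q : Prog} {s : State} {B B' : ℕ} {Ω Ω' : Type} [Fintype Ω] [Fintype Ω']

theorem of_bigStep {t : ℕ} {s' : State} (h : BigStep p s t s') (ht : t ≤ B) :
    Spread p s B fun _ : Unit => s' where
  prob K u := by
    simpa [← h.haltProb_eq K u] using haltProb_mono (p :: K, s) (Nat.add_le_add_left ht u)
  sound K d t h' := ⟨(), h.mayHalt h'⟩

theorem mono {σ : Ω → State} (h : Spread p s B σ) (hB : B ≤ B') : Spread p s B' σ where
  prob K u := (h.prob K u).trans (mul_le_mul_of_nonneg_left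
    (haltProb_mono _ (Nat.add_le_add_left hB u)) (Nat.cast_nonneg _))
  sound := h.sound

theorem reindex {σ : Ω → State} (h : Spread p s B σ) (e : Ω' ≃ Ω) :
    Spread p s B fun ω => σ (e ω) where
  prob K u := by
    rw [Equiv.sum_comp e fun ω => haltProb (K, σ ω) u, Fintype.card_congr e]
    exact h.prob K u
  sound K d t h' := by
    obtain ⟨ω, h⟩ := h.sound K d t h'
    exact ⟨e.symm ω, by simpa using h⟩

theorem rand (x : ℕ) {y N : ℕ} (hN : s.reg y + 1 = N) :
    Spread (.instr (.rand x y)) s 1 fun v : Fin N => s.setReg x v where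
  prob K u := by
    subst hN
    rw [haltProb_rand, Fintype.card_fin, mul_div_cancel₀]
    exact Nat.cast_ne_zero.2 (Nat.succ_ne_zero _)
  sound K d t h := by
    subst hN
    exact mayHalt_rand h

/-- A step that replaces the program `p` by `q`, followed by `q'`. -/
theorem of_step₂ {q' : Prog} (hstep : ∀ K, step (p :: K, s) = PMF.pure (q :: q' :: K, s))
    {σ : Ω → State} {σ' : Ω → Ω' → State} (h : Spread q s B σ)
    (h' : ∀ ω, Spread q' (σ ω) B' (σ' ω)) :
    Spread p s (B + B' + 1) fun x : Ω × Ω' => σ' x.1 x.2 where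
  prob K u := by
    have h1 : haltProb (p :: K, s) (u + (B + B' + 1)) =
        haltProb (q :: q' :: K, s) (u + B' + B) := by
      rw [haltProb, show u + (B + B' + 1) = u + B' + B + 1 by omega, run_of_step (hstep K),
        haltProb]
    rw [h1, Fintype.sum_prod_type, Fintype.card_prod, Nat.cast_mul]
    calc ∑ ω, ∑ ω', haltProb (K, σ' ω ω') u
        ≤ ∑ ω, Fintype.card Ω' * haltProb (q' :: K, σ ω) (u + B') :=
          Finset.sum_le_sum fun ω _ => (h' ω).prob K u
      _ = Fintype.card Ω' * ∑ ω, haltProb (q' :: K, σ ω) (u + B') := by rw [Finset.mul_sum]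
      _ ≤ Fintype.card Ω' * (Fintype.card Ω * haltProb (q :: q' :: K, s) (u + B' + B)) :=
          mul_le_mul_of_nonneg_left (h.prob _ _) (Nat.cast_nonneg _)
      _ = _ := by ring
  sound K d t hd := by
    cases t with
    | zero =>
      have h1 := hd.1
      simp only [run, PMF.mem_support_pure_iff] at h1
      have := hd.2
      simp [h1, Halted] at this
    | succ t =>
      have hd' : MayHalt (q :: q' :: K, s) d t := ⟨run_of_step (hstep K) t ▸ hd.1, hd.2⟩
      obtain ⟨ω, t', ht', hω⟩ := h.sound _ _ _ hd'
      obtain ⟨ω', t'', ht'', hω'⟩ := (h' ω).sound _ _ _ hω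
      exact ⟨(ω, ω'), t'', by omega, hω'⟩

theorem seq {σ : Ω → State} {σ' : Ω → Ω' → State} (h : Spread p s B σ)
    (h' : ∀ ω, Spread q (σ ω) B' (σ' ω)) :
    Spread (.seq p q) s (B + B' + 1) fun x : Ω × Ω' => σ' x.1 x.2 :=
  of_step₂ (fun K => by simp [step]) h h'

theorem while_true {b : Test} {σ : Ω → State} {σ' : Ω → Ω' → State} (hb : b.Holds s)
    (h : Spread p s B σ) (h' : ∀ ω, Spread (.while b p) (σ ω) B' (σ' ω)) :
    Spread (.while b p) s (B + B' + 1) fun x : Ω × Ω' => σ' x.1 x.2 :=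
  of_step₂ (fun K => by simp [step, hb]) h h'

theorem seq_tri {σ : Ω → State} {Q : Ω → State → Prop} (h : Spread p s B σ)
    (h' : ∀ ω, Tri q (σ ω) B' (Q ω)) :
    ∃ σ' : Ω → State, (∀ ω, Q ω (σ' ω) ∧ Frame q (σ ω) (σ' ω)) ∧
      Spread (.seq p q) s (B + B' + 1) σ' := by
  choose t σ' hbs ht hQ using h'
  refine ⟨σ', fun ω => ⟨hQ ω, (hbs ω).frame⟩, ?_⟩
  exact (h.seq fun ω => of_bigStep (hbs ω) (ht ω)).reindex (Equiv.prodPUnit Ω).symm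

end Spread

/-- The program `p` started in `s` ends within `B` steps in a memory satisfying `Q`, and with
probability at least `ρ` in one satisfying `S`.  The first field expresses this by means of the
halting probabilities of arbitrary continuations. -/
structure PTri (p : Prog) (s : State) (B : ℕ) (ρ : ℝ) (Q S : State → Prop) : Prop where
  prob : ∀ K u c₀ c₁, c₀ ≤ c₁ → (∀ s', Q s' → c₀ ≤ haltProb (K, s') u) →
    (∀ s', Q s' → S s' → c₁ ≤ haltProb (K, s') u) →
    c₀ + ρ * (c₁ - c₀) ≤ haltProb (p :: K, s) (u + B)
  sound : ∀ K d t, MayHalt (p :: K, s) d t → ∃ s', Q s' ∧ ∃ t' ≤ t, MayHalt (K, s') d t'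

namespace PTri
variable {p q : Prog} {s : State} {B B₁ B₂ : ℕ} {ρ ρ₁ ρ₂ : ℝ} {Q Q₁ S S₁ : State → Prop}

theorem mono (h : PTri p s B₁ ρ₁ Q₁ S₁) (hB : B₁ ≤ B) (hρ : ρ ≤ ρ₁)
    (hQ : ∀ s', Q₁ s' → Q s') (hS : ∀ s', Q₁ s' → S₁ s' → S s') : PTri p s B ρ Q S where
  prob K u c₀ c₁ hc h₀ h₁ := by
    refine le_trans ?_ ((h.prob K u c₀ c₁ hc (fun s' hs' => h₀ s' (hQ s' hs'))
      fun s' hs' hs => h₁ s' (hQ s' hs') (hS s' hs' hs)).trans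
        (haltProb_mono _ (Nat.add_le_add_left hB u)))
    nlinarith
  sound K d t hd := by
    obtain ⟨s', hs', h⟩ := h.sound K d t hd
    exact ⟨s', hQ s' hs', h⟩

theorem of_tri {P : Prop} [Decidable P] (h : Tri p s B fun s' => Q s' ∧ (P → S s')) :
    PTri p s B (if P then 1 else 0) Q S := by
  obtain ⟨t, s', hbs, ht, hQ, hS⟩ := h
  refine ⟨fun K u c₀ c₁ hc h₀ h₁ => ?_, fun K d t' hd => ⟨s', hQ, hbs.mayHalt hd⟩⟩
  refine le_trans ?_ (haltProb_mono _ (Nat.add_le_add_left ht u))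
  rw [hbs.haltProb_eq]
  split_ifs with hP
  · simpa using h₁ s' hQ (hS hP)
  · simpa using h₀ s' hQ

theorem of_step {s : State} (hstep : ∀ K, step (p :: K, s) = PMF.pure (q :: K, s))
    (h : PTri q s B ρ Q S) : PTri p s (B + 1) ρ Q S where
  prob K u c₀ c₁ hc h₀ h₁ := by
    rw [haltProb, ← add_assoc, run_of_step (hstep K)]
    exact h.prob K u c₀ c₁ hc h₀ h₁
  sound K d t hd := by
    cases t with
    | zero =>
      have h1 := hd.1
      simp only [run, PMF.mem_support_pure_iff] at h1
      have := hd.2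
      simp [h1, Halted] at this
    | succ t =>
      obtain ⟨s', hs', t', ht', h'⟩ := h.sound K d t ⟨run_of_step (hstep K) t ▸ hd.1, hd.2⟩
      exact ⟨s', hs', t', by omega, h'⟩

theorem ite {b : Test} (h₁ : b.Holds s → PTri p s B ρ Q S) (h₂ : ¬ b.Holds s → PTri q s B ρ Q S) :
    PTri (.ite b p q) s (B + 1) ρ Q S := by
  by_cases hb : b.Holds s
  · exact (h₁ hb).of_step fun K => by simp [step, hb]
  · exact (h₂ hb).of_step fun K => by simp [step, hb]

theorem mayHalt_seq {K : List Prog} {d : Config} {t : ℕ} (hd : MayHalt (.seq p q :: K, s) d t) :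
    ∃ t' ≤ t, MayHalt (p :: q :: K, s) d t' := by
  cases t with
  | zero =>
    have h1 := hd.1
    simp only [run, PMF.mem_support_pure_iff] at h1
    have := hd.2
    simp [h1, Halted] at this
  | succ t =>
    exact ⟨t, by omega,
      run_of_step (c := (.seq p q :: K, s)) (c' := (p :: q :: K, s)) (by simp [step]) t ▸ hd.1,
      hd.2⟩

theorem haltProb_seq (K : List Prog) (u : ℕ) :
    haltProb (.seq p q :: K, s) (u + 1) = haltProb (p :: q :: K, s) u := by
  rw [haltProb, run_of_step (c' := (p :: q :: K, s)) (by simp [step]), haltProb]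

/-- The second program is certain to be successful in proportion `ρ₂` only after success of the
first one. -/
theorem seq (h₁ : PTri p s B₁ ρ₁ Q₁ S₁) (hρ₂ : 0 ≤ ρ₂)
    (h₂ : ∀ s', Q₁ s' → PTri q s' B₂ 0 Q S) (h₃ : ∀ s', Q₁ s' → S₁ s' → PTri q s' B₂ ρ₂ Q S) :
    PTri (.seq p q) s (B₁ + B₂ + 1) (ρ₁ * ρ₂) Q S where
  prob K u c₀ c₁ hc h₀ h₁' := by
    rw [show u + (B₁ + B₂ + 1) = u + B₂ + B₁ + 1 by omega, haltProb_seq]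
    have := h₁.prob (q :: K) (u + B₂) c₀ (c₀ + ρ₂ * (c₁ - c₀))
      (by nlinarith) (fun s' hs' => by simpa using (h₂ s' hs').prob K u c₀ c₁ hc h₀ h₁')
      (fun s' hs' hs => (h₃ s' hs' hs).prob K u c₀ c₁ hc h₀ h₁')
    linarith
  sound K d t hd := by
    obtain ⟨t', ht', h'⟩ := mayHalt_seq hd
    obtain ⟨s', hs', t'', ht'', h''⟩ := h₁.sound _ _ _ h'
    obtain ⟨s'', hs'', t3, ht3, h3⟩ := (h₂ s' hs').sound _ _ _ h''
    exact ⟨s'', hs'', t3, by omega, h3⟩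

theorem tri_seq (h₁ : Tri p s B₁ Q₁)
    (h₂ : ∀ s', Q₁ s' → Frame p s s' → PTri q s' B₂ ρ Q S) :
    PTri (.seq p q) s (B₁ + B₂ + 1) ρ Q S := by
  obtain ⟨t, s', hbs, ht, hQ⟩ := h₁
  refine ⟨fun K u c₀ c₁ hc h₀ h₁ => ?_, fun K d t' hd => ?_⟩
  · refine ((h₂ s' hQ hbs.frame).prob K u c₀ c₁ hc h₀ h₁).trans ?_
    rw [← hbs.haltProb_eq, ← haltProb_seq]
    exact haltProb_mono _ (by omega)
  · obtain ⟨t1, ht1, h1⟩ := mayHalt_seq hd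
    obtain ⟨t2, ht2, h2⟩ := hbs.mayHalt h1
    obtain ⟨s'', hs'', t3, ht3, h3⟩ := (h₂ s' hQ hbs.frame).sound _ _ _ h2
    exact ⟨s'', hs'', t3, by omega, h3⟩

theorem seq_tri (h₁ : PTri p s B₁ ρ Q₁ S₁)
    (h₂ : ∀ s', Q₁ s' → Tri q s' B₂ fun s'' => Q s'' ∧ (S₁ s' → S s'')) :
    PTri (.seq p q) s (B₁ + B₂ + 1) ρ Q S := by
  classical
  have := h₁.seq (q := q) (B₂ := B₂) (Q := Q) (S := S) (ρ₂ := 1) zero_le_one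
    (fun s' hs' => by
      simpa using of_tri (P := False) ((h₂ s' hs').mono le_rfl fun s'' h _ => ⟨h.1, False.elim⟩))
    (fun s' hs' hs => by
      simpa using of_tri (P := True) ((h₂ s' hs').mono le_rfl fun s'' h _ =>
        ⟨h.1, fun _ => h.2 hs⟩))
  simpa using this

open Classical in
/-- A random choice of `ω` that is followed by a deterministic program, which is successful for the
values `ω` satisfying `P`. -/
theorem of_spread {Ω : Type} [Fintype Ω] {σ : Ω → State} (h : Spread p s B₁ σ) (P : Ω → Prop)
    (hP : ρ * Fintype.card Ω ≤ (Finset.univ.filter P).card) (hΩ : 0 < Fintype.card Ω)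
    (h' : ∀ ω, Tri q (σ ω) B₂ fun s' => Q s' ∧ (P ω → S s')) :
    PTri (.seq p q) s (B₁ + B₂ + 1) ρ Q S where
  prob K u c₀ c₁ hc h₀ h₁ := by
    rw [show u + (B₁ + B₂ + 1) = u + B₂ + B₁ + 1 by omega, haltProb_seq]
    have h1 := h.prob (q :: K) (u + B₂)
    have h2 : ∑ ω, (c₀ + (if P ω then 1 else 0) * (c₁ - c₀)) ≤
        ∑ ω, haltProb (q :: K, σ ω) (u + B₂) :=
      Finset.sum_le_sum fun ω _ => (of_tri (h' ω)).prob K u c₀ c₁ hc h₀ h₁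
    rw [Finset.sum_add_distrib, ← Finset.sum_mul, Finset.sum_boole] at h2
    simp only [Finset.sum_const, Finset.card_univ, nsmul_eq_mul] at h2
    have hpos : (0 : ℝ) < Fintype.card Ω := by exact_mod_cast hΩ
    have h3 := mul_le_mul_of_nonneg_right hP (sub_nonneg.2 hc)
    refine le_of_mul_le_mul_left ?_ hpos
    linarith
  sound K d t hd := by
    obtain ⟨t', ht', h1⟩ := mayHalt_seq hd
    obtain ⟨ω, t'', ht'', h2⟩ := h.sound _ _ _ h1
    obtain ⟨s'', hs'', t3, ht3, h3⟩ := (of_tri (h' ω)).sound _ _ _ h2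
    exact ⟨s'', hs'', t3, by omega, h3⟩

end PTri

/-- Repeated trials, each of which is successful with probability at least `ρ`. -/
theorem haltProb_while_ge {b : Test} {p : Prog} {K : List Prog} {B U : ℕ} {ρ : ℝ}
    (hρ₁ : ρ ≤ 1) {Inv : State → Prop}
    (hp : ∀ s, Inv s → b.Holds s → PTri p s B ρ Inv fun s' => ¬ b.Holds s')
    (hK : ∀ s, Inv s → ¬ b.Holds s → haltProb (K, s) U = 1) (i : ℕ) :
    ∀ s, Inv s → 1 - (1 - ρ) ^ i ≤ haltProb (.while b p :: K, s) (U + 1 + i * (B + 1)) := by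
  have hout : ∀ s, Inv s → ¬ b.Holds s → ∀ u, U + 1 ≤ u →
      haltProb (.while b p :: K, s) u = 1 := by
    intro s hs hb u hu
    refine le_antisymm (haltProb_le_one _ _) ?_
    refine le_trans ?_ (haltProb_mono _ hu)
    rw [(BigStep.while_false (p := p) hb).haltProb_eq, hK s hs hb]
  induction i with
  | zero =>
    intro s _
    simpa using haltProb_nonneg _ _
  | succ i ih =>
    intro s hs
    by_cases hb : b.Holds s
    · have h1 : haltProb (.while b p :: K, s) (U + 1 + (i + 1) * (B + 1)) =
          haltProb (p :: .while b p :: K, s) (U + 1 + i * (B + 1) + B) := by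
        rw [haltProb, show U + 1 + (i + 1) * (B + 1) = U + 1 + i * (B + 1) + B + 1 by ring,
          run_of_step (c' := (p :: .while b p :: K, s)) (by simp [step, hb]), haltProb]
      rw [h1]
      refine le_trans (le_of_eq ?_) ((hp s hs hb).prob _ _ (1 - (1 - ρ) ^ i) 1 ?_ ih
        fun s' hs' hb' => (hout s' hs' hb' _ (by omega)).ge)
      · ring
      · have : 0 ≤ (1 - ρ) ^ i := pow_nonneg (by linarith) i
        linarith
    · rw [hout s hs hb _ (by omega)]
      have : 0 ≤ (1 - ρ) ^ (i + 1) := pow_nonneg (by linarith) _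
      linarith

theorem mayHalt_while {b : Test} {p : Prog} {K : List Prog} {B : ℕ} {ρ : ℝ}
    {Inv S : State → Prop} (hp : ∀ s, Inv s → b.Holds s → PTri p s B ρ Inv S) {d : Config}
    {t : ℕ} : ∀ {s}, Inv s → MayHalt (.while b p :: K, s) d t →
      ∃ s', Inv s' ∧ ¬ b.Holds s' ∧ ∃ t' ≤ t, MayHalt (K, s') d t' := by
  induction t using Nat.strong_induction_on with
  | _ t ih =>
    intro s hs hd
    cases t with
    | zero =>
      have h1 := hd.1
      simp only [run, PMF.mem_support_pure_iff] at h1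
      have := hd.2
      simp [h1, Halted] at this
    | succ t =>
      by_cases hb : b.Holds s
      · have hd' : MayHalt (p :: .while b p :: K, s) d t :=
          ⟨run_of_step (c := (.while b p :: K, s)) (c' := (p :: .while b p :: K, s))
            (by simp [step, hb]) t ▸ hd.1, hd.2⟩
        obtain ⟨s', hs', t', ht', h'⟩ := (hp s hs hb).sound _ _ _ hd'
        obtain ⟨s'', hs'', hb'', t'', ht'', h''⟩ := ih t' (by omega) hs' h'
        exact ⟨s'', hs'', hb'', t'', by omega, h''⟩
      · exact ⟨s, hs, hb, (BigStep.while_false (p := p) hb).mayHalt hd⟩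

/-! ### Drawing a sample -/

/-- Draw one element of the sample. -/
def drawOne (b : Bool) : Prog :=
  .seq (.instr (.rand regV regT))
    (block [.load regF (arrFrom b) regV, .store arrSample regI regF, .succ regI regI])

/-- Draw the sample of stage `b`, with replacement. -/
def draw (b : Bool) : Prog :=
  .seq (block [.sub regT (regFrom b) regOne, .const regI 0]) (.while (.lt regI regR) (drawOne b))

theorem drawOne_spec {b : Bool} {s : State} {N : ℕ} (hN : s.reg regT + 1 = N) :
    ∃ σ : Fin N → State, (∀ v, Frame (drawOne b) s (σ v) ∧ (σ v).reg regI = s.reg regI + 1 ∧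
      (σ v).arr arrSample =
        Function.update (s.arr arrSample) (s.reg regI) (s.arr (arrFrom b) v)) ∧
      Spread (drawOne b) s 9 σ := by
  have hrand : Spread (.instr (.rand regV regT)) s 1 fun v : Fin N => s.setReg regV v :=
    Spread.rand regV hN
  obtain ⟨σ, hσ, hsp⟩ := hrand.seq_tri (q := block [.load regF (arrFrom b) regV,
    .store arrSample regI regF, .succ regI regI]) (B' := 7) (Q := fun (v : Fin N) s' =>
    s'.reg regI = s.reg regI + 1 ∧ s'.arr arrSample =
      Function.update (s.arr arrSample) (s.reg regI) (s.arr (arrFrom b) v))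
    fun v => Tri.block (by simp [Instr.isRand]) (by simp [Instr.eff])
  refine ⟨σ, fun v => ⟨fun l hl => ?_, (hσ v).1⟩, hsp⟩
  simp only [drawOne, Prog.writes, Bool.or_eq_false_iff] at hl
  refine Same.trans ?_ ((hσ v).2 l (by simpa [Prog.writes] using hl.2))
  cases l <;> simp_all [Same, Instr.target]
  exact fun h => absurd h.symm hl.1

/-- The samples still to be drawn form a uniformly random function on `Fin i`. -/
theorem while_draw_spec (b : Bool) {N : ℕ} (i : ℕ) : ∀ {s : State},
    s.reg regT + 1 = N → s.reg regR = s.reg regI + i →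
    ∃ σ : (Fin i → Fin N) → State, (∀ ω, Frame (drawOne b) s (σ ω) ∧
      (∀ j < s.reg regI, (σ ω).arr arrSample j = s.arr arrSample j) ∧
      ∀ j : Fin i, (σ ω).arr arrSample (s.reg regI + j) = s.arr (arrFrom b) (ω j)) ∧
      Spread (.while (.lt regI regR) (drawOne b)) s (i * 10 + 1) σ := by
  induction i with
  | zero =>
    intro s hN hr
    refine ⟨fun _ => s, fun ω => ⟨fun l _ => Same.refl s l, fun _ _ => rfl, fun j => j.elim0⟩, ?_⟩
    have hb : ¬ (Test.lt regI regR).Holds s := by simp [Test.Holds, hr]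
    exact (Spread.of_bigStep (.while_false (p := drawOne b) hb) (by omega)).reindex
      (Equiv.ofUnique _ _)
  | succ i ih =>
    intro s hN hr
    obtain ⟨σ, hσ, hsp⟩ := drawOne_spec (b := b) hN
    have hw : ∀ v, ∃ σ' : (Fin i → Fin N) → State, (∀ ω, Frame (drawOne b) (σ v) (σ' ω) ∧
        (∀ j < (σ v).reg regI, (σ' ω).arr arrSample j = (σ v).arr arrSample j) ∧
        ∀ j : Fin i, (σ' ω).arr arrSample ((σ v).reg regI + j) = (σ v).arr (arrFrom b) (ω j)) ∧
        Spread (.while (.lt regI regR) (drawOne b)) (σ v) (i * 10 + 1) σ' := fun v => by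
      refine ih ?_ ?_
      · rw [(hσ v).1.reg regT (by cases b <;> rfl), hN]
      · rw [(hσ v).1.reg regR (by cases b <;> rfl), (hσ v).2.1, hr]
        omega
    choose σ' hσ' hsp' using hw
    have hb : (Test.lt regI regR).Holds s := by simp [Test.Holds, hr]
    refine ⟨fun ω => σ' (ω 0) (Fin.tail ω), fun ω => ⟨fun l hl => ((hσ _).1 l hl).trans
      ((hσ' _ _).1 l hl), fun j hj => ?_, fun j => ?_⟩, ?_⟩
    · rw [(hσ' _ _).2.1 j (by rw [(hσ _).2.1]; omega), (hσ _).2.2, Function.update_of_ne hj.ne]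
    · refine Fin.cases ?_ (fun j => ?_) j
      · rw [Fin.val_zero, add_zero, (hσ' _ _).2.1 _ (by rw [(hσ _).2.1]; omega), (hσ _).2.2,
          Function.update_self]
      · have := (hσ' (ω 0) (Fin.tail ω)).2.2 j
        rw [(hσ _).2.1, (hσ _).1.arr (arrFrom b) (by cases b <;> rfl)] at this
        rw [Fin.val_succ, show s.reg regI + (j + 1) = s.reg regI + 1 + j by omega, this, Fin.tail]
    · exact ((Spread.while_true hb hsp hsp').mono (by omega)).reindex
        (Fin.consEquiv fun _ : Fin (i + 1) => Fin N).symm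

theorem draw_spec {b : Bool} {s : State} {N r : ℕ} (hr : s.reg regR = r)
    (hN : s.reg (regFrom b) = N) (hN0 : 0 < N)
    (h1 : s.reg regOne = 1) :
    ∃ σ : (Fin r → Fin N) → State, (∀ ω, Frame (draw b) s (σ ω) ∧
      ∀ j : Fin r, (σ ω).arr arrSample j = s.arr (arrFrom b) (ω j)) ∧
      Spread (draw b) s (r * 10 + 7) σ := by
  obtain ⟨t, s', hbs, ht, hs'⟩ : Tri (block [.sub regT (regFrom b) regOne, .const regI 0]) s 5
      fun s' => s' = (s.setReg regT (N - 1)).setReg regI 0 :=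
    Tri.block (by simp [Instr.isRand]) (by simp [Instr.eff, hN, h1])
  obtain ⟨σ, hσ, hsp⟩ := while_draw_spec b (N := N) r (s := s')
    (by simp [hs']; omega) (by simp [hs', hr])
  refine ⟨σ, fun ω => ⟨fun l hl => ?_, fun j => ?_⟩, ?_⟩
  · simp only [draw, Prog.writes, Bool.or_eq_false_iff] at hl
    exact (hbs.frame l hl.1).trans ((hσ ω).1 l hl.2)
  · have := (hσ ω).2.2 j
    simpa [hs'] using this
  · exact (((Spread.of_bigStep hbs ht).seq fun _ => hsp).mono (by omega)).reindex
      (Equiv.punitProd _).symm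

/-! ### The success probability of one trial -/

/-- One stage of the algorithm.  Stage `false` starts from all negative vertices, and stage `true`
from those that stage `false` found related to its probe. -/
def stage (b : Bool) : Prog := .seq (draw b) (analyze b)

section
variable {n m : ℕ} {G : WDigraph n m}

theorem cells_nodup_iff {f : ℕ → ℕ} {c : ℕ} :
    (cells f c).Nodup ↔ ∀ i < c, ∀ j < c, f i = f j → i = j := by
  rw [cells, List.nodup_map_iff_inj_on List.nodup_range]
  simp

open Classical in
theorem length_filter_cells (f : ℕ → ℕ) (N : ℕ) (P : ℕ → Prop) :
    ((cells f N).filter fun x => P x).length =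
      (Finset.univ.filter fun a : Fin N => P (f a)).card := by
  have h1 : ((cells f N).filter fun x => P x).length =
      ((Finset.range N).filter fun i => P (f i)).card := by
    rw [cells, List.filter_map, List.length_map]
    rfl
  rw [h1, ← Finset.card_map Fin.valEmbedding]
  congr 1
  ext i
  simp only [Finset.mem_filter, Finset.mem_range, Finset.mem_map, Finset.mem_univ, true_and,
    Fin.valEmbedding_apply]
  exact ⟨fun ⟨h, hp⟩ => ⟨⟨i, h⟩, hp, rfl⟩, fun ⟨a, ha, hai⟩ => hai ▸ ⟨a.2, ha⟩⟩

/-- Indices that survive in the sense of `survivors` are free; here `a` hits `c` if `c` is related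
to `a` in direction `b`. -/
theorem card_survivors_le {b : Bool} {r N : ℕ} {U A : ℕ → ℕ} {ω : Fin r → Fin N}
    (hU : (cells U N).Nodup) (hA : ∀ j : Fin r, A j = U (ω j)) :
    (survivors (fun a c : Fin N => Rel G b (U c) (U a)) ω).card ≤ (freeIndices G b A r).card := by
  classical
  rw [← Finset.card_map Fin.valEmbedding]
  refine Finset.card_le_card fun i hi => ?_
  simp only [survivors, Finset.mem_map, Finset.mem_filter, Finset.mem_univ, true_and,
    Fin.valEmbedding_apply] at hi
  obtain ⟨i, ⟨h1, h2⟩, rfl⟩ := hi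
  simp only [freeIndices, Finset.mem_filter, Finset.mem_range]
  refine ⟨i.2, fun j hj => ?_, fun j hj hji => ?_⟩
  · rw [hA i, hA ⟨j, hj⟩]
    exact h1 ⟨j, hj⟩
  · rw [hA i, hA ⟨j, hj⟩] at hji
    have := cells_nodup_iff.1 hU _ (ω ⟨j, hj⟩).2 _ (ω i).2 hji
    exact congrArg Fin.val (h2 ⟨j, hj⟩ (Fin.ext this))

/-- A bound for the running time of a stage. -/
def stageTime (n m r : ℕ) : ℕ := r * 10 + 7 + analyzeTime n m r + 1

open Classical in
/-- The possible results of stage `b`; compared with `StageResult`, the sample is not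
mentioned. -/
inductive StageOutcome (G : WDigraph n m) (b : Bool) (s s' : State) : Prop
  | cycle (hdone : s'.reg regDone = 1) (hflag : s'.reg regFlag = 0)
      (hkind : s'.reg regKind = 0) (h : G.HasNegativeCycle)
  | independent (hdone : s'.reg regDone = 1) (hflag : s'.reg regFlag = 0)
      (hkind : s'.reg regKind = 2) (h : IndepResult G s') (hs : s.reg regS ≤ s'.reg regCnt)
  | many (hdone : s'.reg regDone = 0) (hflag : s'.reg regFlag = 1)
      (hprobe : s'.arr arrSample 0 ∈ cells (s.arr (arrFrom b)) (s.reg (regFrom b)))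
      (h : cells (s'.arr (arrTo b)) (s'.reg (regTo b)) =
        (cells (s.arr (arrFrom b)) (s.reg (regFrom b))).filter
          fun f => Rel G b (s'.arr arrSample 0) f)
      (hs : s.reg (regThr b) ≤ s'.reg (regTo b))
  | unlucky (hdone : s'.reg regDone = 0) (hflag : s'.reg regFlag = 0)

/-- A stage succeeds with probability at least `1 / 8`: if the probe is bad, then it is related to
itself or to many elements; and if `r / 8` of the sample survives, then there is a large
independent set, unless the probe has led to another result. -/
theorem stage_spec (hn : 0 < n) (hpos : ∀ e, e ∉ G.Eneg → 0 ≤ G.w e)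
    (hun : ∀ e ∈ G.Eneg, ∀ e', G.tail e' = G.tail e → e' = e) {b : Bool} {s : State} {N : ℕ}
    (hS : Ready G s) (hr : 0 < s.reg regR) (hN : s.reg (regFrom b) = N) (hN0 : 0 < N)
    (hle : N ≤ n) (hnd : (cells (s.arr (arrFrom b)) N).Nodup)
    (hneg : ∀ e ∈ cells (s.arr (arrFrom b)) N, IsNeg G e)
    (hdone : s.reg regDone = 0) (hflag : s.reg regFlag = 0)
    (hthr : 4 * ((s.reg regR - 1) * s.reg (regThr b)) ≤ N)
    (hs : s.reg regS ≤ (s.reg regR + 7) / 8) :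
    PTri (stage b) s (stageTime n m (s.reg regR)) (1 / 8)
      (fun s' => Ready G s' ∧ Frame (stage b) s s' ∧ StageOutcome G b s s')
      fun s' => s'.reg regDone = 1 ∨ s'.reg regFlag = 1 := by
  classical
  set r := s.reg regR with hrdef
  set U := s.arr (arrFrom b) with hU
  obtain ⟨σ, hσ, hsp⟩ := draw_spec hrdef.symm hN hN0 hS.one
  rw [← hU] at hσ
  set hit : Fin N → Fin N → Prop := fun a c => Rel G b (U c) (U a) with hhit
  set P : (Fin r → Fin N) → Prop := fun ω => IsBad hit (s.reg (regThr b)) (ω ⟨0, hr⟩) ∨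
    r ≤ 8 * (survivors hit ω).card with hP
  refine PTri.of_spread hsp P ?_ ?_ fun ω => ?_
  · have h1 := card_pow_le_card_filter hit hr (τ := s.reg (regThr b)) (by simpa using hthr)
    have h2 : ((Fintype.card (Fin N) ^ r : ℕ) : ℝ) ≤ (8 * (Finset.univ.filter P).card : ℕ) :=
      Nat.cast_le.2 (h1.trans (Nat.mul_le_mul_left 8 (Finset.card_le_card fun ω hω => by
        simpa [hP] using hω)))
    rw [Fintype.card_fun, Fintype.card_fin r]
    have h3 : (1 / 8 : ℝ) * (Fintype.card (Fin N) ^ r : ℕ) ≤ (Finset.univ.filter P).card := by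
      rw [Nat.cast_mul] at h2
      push_cast at h2 ⊢
      linarith
    convert h3
  · rw [Fintype.card_fun]
    exact pow_pos (by simpa using hN0) _
  obtain ⟨f1, hA⟩ := hσ ω
  set A := (σ ω).arr arrSample with hAdef
  have hS1 : Ready G (σ ω) := hS.of_frame f1 (by cases b <;> rfl)
  have hr1 : (σ ω).reg regR = r := f1.reg regR (by cases b <;> rfl)
  have hU1 : (σ ω).arr (arrFrom b) = U := f1.arr _ (by cases b <;> rfl)
  have hN1 : (σ ω).reg (regFrom b) = N := (f1.reg _ (by cases b <;> rfl)).trans hN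
  have hmem : ∀ j < r, A j ∈ cells U N := fun j hj => by
    rw [hA ⟨j, hj⟩]
    exact mem_cells.2 ⟨_, (ω _).2, rfl⟩
  have han := analyze_spec hn hpos hun (b := b) hS1 (by rw [hr1]; exact hr)
    (by rw [hU1, hN1]; exact hneg) (by rw [hr1, hU1, hN1]; exact hmem)
    ((f1.reg regDone (by cases b <;> rfl)).trans hdone)
    ((f1.reg regFlag (by cases b <;> rfl)).trans hflag) (by rw [hN1]; exact hle)
  rw [hr1] at han
  refine han.mono le_rfl fun s' ⟨hS', h'⟩ f2 => ⟨⟨hS', fun l hl => ?_, ?_⟩, ?_⟩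
  · simp only [stage, Prog.writes, Bool.or_eq_false_iff] at hl
    exact (f1 l hl.1).trans (f2 l hl.2)
  · have hA' : s'.arr arrSample = A := f2.arr _ (by cases b <;> rfl)
    cases h' with
    | cycle h1 h2 h3 h4 => exact .cycle h1 h2 h3 h4
    | independent h1 h2 h3 h4 h5 =>
      exact .independent h1 h2 h3 h4 (by rwa [← f1.reg regS (by cases b <;> rfl)])
    | many h1 h2 h3 h4 =>
      refine .many h1 h2 ?_ ?_ (by rwa [← f1.reg (regThr b) (by cases b <;> rfl)])
      · rw [hA', hN]
        exact hmem 0 hr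
      · rw [h3, hA', hU1, hN1, hN]
    | unlucky h1 h2 h3 h4 h5 => exact .unlucky h1 h2
  · intro hgood
    cases h' with
    | cycle h1 h2 h3 h4 => exact .inl h1
    | independent h1 h2 h3 h4 h5 => exact .inl h1
    | many h1 h2 h3 h4 => exact .inr h2
    | unlucky h1 h2 h3 h4 h5 =>
      exfalso
      rw [← hAdef, hU1, hN1, f1.reg (regThr b) (by cases b <;> rfl)] at h4
      rw [← hAdef, hr1, f1.reg regS (by cases b <;> rfl)] at h5
      rw [← hAdef] at h3
      have hA0 : A 0 = U (ω ⟨0, hr⟩) := hA ⟨0, hr⟩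
      rcases hgood with (hbad | hbad) | hsurv
      · rw [hA0] at h3
        exact h3 hbad
      · rw [length_filter_cells, hA0] at h4
        exact absurd h4 (not_lt.2 (le_trans hbad (le_of_eq (by congr))))
      · have : (survivors hit ω).card ≤ (freeIndices G b A r).card := card_survivors_le hnd hA
        omega

/-- The numerical parameters fit the number `k` of edges of `E⁻`. -/
structure Params (k : ℕ) (s : State) : Prop where
  r_pos : 0 < s.reg regR
  r_le : s.reg regR ≤ k
  s_le : s.reg regS ≤ (s.reg regR + 7) / 8
  big_pos : 0 < s.reg regBig
  big_le : 4 * ((s.reg regR - 1) * s.reg regBig) ≤ k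
  small_le : 4 * ((s.reg regR - 1) * s.reg regSmall) ≤ s.reg regBig
  le_s : k ≤ (512 * s.reg regS) ^ 3
  le_small : k ≤ (512 * s.reg regSmall) ^ 3

/-- The locations that `Params` speaks about. -/
def paramLocs : List Loc := [.reg regR, .reg regS, .reg regBig, .reg regSmall]

theorem Params.congr {k : ℕ} {s s' : State} (h : Params k s)
    (hs : ∀ l ∈ paramLocs, Same s s' l) : Params k s' := by
  simp only [paramLocs, List.forall_mem_cons, Same] at hs
  obtain ⟨h1, h2, h3, h4, -⟩ := hs
  constructor <;> simp only [h1, h2, h3, h4]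
  exacts [h.r_pos, h.r_le, h.s_le, h.big_pos, h.big_le, h.small_le, h.le_s, h.le_small]

theorem Params.of_frame {k : ℕ} {s s' : State} {p : Prog} (h : Params k s) (f : Frame p s s')
    (hp : paramLocs.all (fun l => !p.writes l) = true := by rfl) : Params k s' :=
  h.congr fun l hl => f l (by simpa using List.all_eq_true.1 hp l hl)

/-- The memory holds a list of distinct edges of `E⁻`, the tails of which form a sandwich. -/
structure SandwichResult (G : WDigraph n m) (s : State) : Prop where
  nodup : (cells (s.arr arrOut) (s.reg regCnt)).Nodup
  neg : ∀ e ∈ cells (s.arr arrOut) (s.reg regCnt), IsNeg G e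
  left : IsNeg G (s.reg regX)
  right : IsNeg G (s.reg regY)
  rel_left : ∀ e ∈ cells (s.arr arrOut) (s.reg regCnt), Rel G true (s.reg regX) e
  rel_right : ∀ e ∈ cells (s.arr arrOut) (s.reg regCnt), Rel G true e (s.reg regY)

/-- The memory holds a result. -/
inductive HasResult (G : WDigraph n m) (s : State) : Prop
  | cycle (hkind : s.reg regKind = 0) (h : G.HasNegativeCycle)
  | sandwich (hkind : s.reg regKind = 1) (h : SandwichResult G s)
      (hs : s.reg regSmall ≤ s.reg regCnt)
  | independent (hkind : s.reg regKind = 2) (h : IndepResult G s)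
      (hs : s.reg regS ≤ s.reg regCnt)

/-- The invariant of the repeated trials. -/
structure TrialInv (G : WDigraph n m) (s : State) : Prop where
  ready : Ready G s
  params : Params G.Eneg.card s
  flag : s.reg regFlag = 0
  result : s.reg regDone = 0 ∨ s.reg regDone = 1 ∧ HasResult G s

/-- The continuation of a trial after stage `false` has found many vertices related to its
probe. -/
def secondStage : Prog :=
  .seq (block [.load regY arrSample regZero, .copy regFlag regZero]) <|
  .seq (stage true) <|
  .ite (.eq regFlag regOne)
    (block [.load regX arrSample regZero, .const regKind 1, .const regDone 1, .const regFlag 0])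
    .skip

/-- One trial. -/
def trial : Prog := .seq (stage false) (.ite (.eq regFlag regOne) secondStage .skip)

theorem card_neg_le (hun : ∀ e ∈ G.Eneg, ∀ e', G.tail e' = G.tail e → e' = e) :
    G.Eneg.card ≤ n := by
  have : Set.InjOn G.tail G.Eneg := fun e _ e' he' h => hun e' he' e h
  simpa using Finset.card_le_card_of_injOn G.tail (t := Finset.univ) (by simp) this

theorem Static.regK_eq {s : State} (hS : Static G s) : s.reg regK = G.Eneg.card := by
  rw [← length_negEdges, ← hS.neg, length_cells]

/-- A bound for the running time of a trial. -/
def trialTime (n m : ℕ) : ℕ := 2 * stageTime n m n + 30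

theorem stageTime_mono {r : ℕ} (h : r ≤ n) : stageTime n m r ≤ stageTime n m n := by
  simp only [stageTime, analyzeTime, thinTime, searchTime]
  have := Nat.mul_le_mul_right (treeTime n + 22) h
  omega

/-- The second stage samples from edges related to `y`. If it finds many of them related to its
probe `x`, then these form a sandwich with ends `x` and `y`. -/
theorem secondStage_spec (hn : 0 < n) (hpos : ∀ e, e ∉ G.Eneg → 0 ≤ G.w e)
    (hun : ∀ e ∈ G.Eneg, ∀ e', G.tail e' = G.tail e → e' = e) {s : State}
    (hS : Ready G s) (hP : Params G.Eneg.card s) (hdone : s.reg regDone = 0)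
    (hy : IsNeg G (s.arr arrSample 0)) (hle : s.reg regMid ≤ n)
    (hbig : s.reg regBig ≤ s.reg regMid)
    (hnd : (cells (s.arr arrMid) (s.reg regMid)).Nodup)
    (hneg : ∀ e ∈ cells (s.arr arrMid) (s.reg regMid), IsNeg G e)
    (hrel : ∀ e ∈ cells (s.arr arrMid) (s.reg regMid), Rel G true e (s.arr arrSample 0)) :
    PTri secondStage s (stageTime n m (s.reg regR) + 18) (1 / 8) (TrialInv G)
      fun s' => s'.reg regDone = 1 := by
  classical
  set y := s.arr arrSample 0 with hydef
  have h1 : Tri (block [.load regY arrSample regZero, .copy regFlag regZero]) s 5 fun s' =>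
      s'.reg regFlag = 0 ∧ s'.reg regY = y :=
    Tri.block (by simp [Instr.isRand]) (by simp [Instr.eff, hS.zero, hydef])
  refine (PTri.tri_seq h1 (B₂ := stageTime n m (s.reg regR) + 12) fun s1 ⟨hf1, hy1⟩ f1 => ?_).mono
    (by omega) le_rfl (fun _ h => h) fun _ _ h => h
  have hS1 : Ready G s1 := hS.of_frame f1
  have hP1 : Params G.Eneg.card s1 := hP.of_frame f1
  have hA1 : s1.arr (arrFrom true) = s.arr arrMid := f1.arr _
  have hN1 : s1.reg (regFrom true) = s.reg regMid := f1.reg _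
  have hr1 : s1.reg regR = s.reg regR := f1.reg _
  have hbp := hP.big_pos
  have hst := stage_spec hn hpos hun (b := true) hS1 hP1.r_pos hN1 (by omega) hle
    (by rw [hA1]; exact hnd) (by rw [hA1]; exact hneg)
    ((f1.reg _).trans hdone) hf1
    (hP1.small_le.trans (by rw [f1.reg regBig]; exact hbig)) hP1.s_le
  rw [hr1] at hst
  refine (hst.seq_tri (B₂ := 10) ?_).mono (by omega) le_rfl (fun _ h => h) fun _ _ h => h
  rintro s2 ⟨hS2, f2, h2⟩
  have hP2 : Params G.Eneg.card s2 := hP1.of_frame f2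
  have hy2 : s2.reg regY = y := (f2.reg _).trans hy1
  refine Tri.ite (B := 9) (fun hb => ?_) fun hb => ?_
  · have hb : s2.reg regFlag = 1 := by simpa [Test.Holds, hS2.one] using hb
    refine Tri.block (by simp [Instr.isRand]) ⟨⟨hS2.congr
      (by simp [readyLocs, staticLocs, Same, Instr.eff]), hP2.congr (by
        simp [paramLocs, Same, Instr.eff]), by simp [Instr.eff], .inr ⟨by simp [Instr.eff], ?_⟩⟩,
        by simp [Instr.eff]⟩
    cases h2 with
    | cycle h1 h2 h3 h4 => omega
    | independent h1 h2 h3 h4 h5 => omega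
    | unlucky h1 h2 => omega
    | many h1 h2 h3 h4 h5 =>
      have hx : IsNeg G (s2.arr arrSample 0) := by
        rw [hA1, hN1] at h3
        exact hneg _ h3
      rw [hA1, hN1] at h4
      have hmem : ∀ e ∈ cells (s2.arr arrOut) (s2.reg regCnt),
          e ∈ cells (s.arr arrMid) (s.reg regMid) ∧ Rel G true (s2.arr arrSample 0) e := by
        intro e he
        rw [show cells (s2.arr arrOut) (s2.reg regCnt) = _ from h4] at he
        simpa using he
      refine .sandwich (by simp [Instr.eff]) ⟨?_, ?_, ?_, ?_, ?_, ?_⟩ ?_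
      · simp only [List.foldl, Instr.eff, State.setReg_arr, State.setReg_reg]
        norm_num
        rw [show cells (s2.arr arrOut) (s2.reg regCnt) = _ from h4]
        exact hnd.filter _
      · simpa [Instr.eff] using fun e he => hneg e (hmem e he).1
      · simpa [Instr.eff, hS2.zero] using hx
      · simpa [Instr.eff, hy2] using hy
      · simpa [Instr.eff, hS2.zero] using fun e he => (hmem e he).2
      · simpa [Instr.eff, hy2] using fun e he => hrel e (hmem e he).1
      · have h5 : s1.reg regSmall ≤ s2.reg regCnt := h5
        rw [← f2.reg regSmall] at h5
        simpa [Instr.eff] using h5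
  · have hb : ¬ s2.reg regFlag = 1 := by simpa [Test.Holds, hS2.one] using hb
    refine (Tri.skip ⟨⟨hS2, hP2, ?_, ?_⟩, fun h => h.resolve_right hb⟩).mono_time (by norm_num)
    · cases h2 <;> omega
    · cases h2 with
      | cycle h1 h2 h3 h4 => exact .inr ⟨h1, .cycle h3 h4⟩
      | independent h1 h2 h3 h4 h5 =>
        exact .inr ⟨h1, .independent h3 h4 (by rwa [← f2.reg regS] at h5)⟩
      | unlucky h1 h2 => exact .inl h1
      | many h1 h2 h3 h4 h5 => omega

/-- Each of the two stages succeeds with probability at least `1 / 8`, given the result of the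
previous one. A trial always preserves the invariant, so that a failed one can be repeated. -/
theorem trial_spec (hn : 0 < n) (hpos : ∀ e, e ∉ G.Eneg → 0 ≤ G.w e)
    (hun : ∀ e ∈ G.Eneg, ∀ e', G.tail e' = G.tail e → e' = e) {s : State}
    (hI : TrialInv G s) (hdone : s.reg regDone = 0) :
    PTri trial s (trialTime n m) (1 / 64) (TrialInv G) fun s' => s'.reg regDone = 1 := by
  classical
  obtain ⟨hS, hP, hflag, -⟩ := hI
  have hk : s.reg regK = G.Eneg.card := Static.regK_eq hS.toStatic
  have hkn := card_neg_le hun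
  have hneg : cells (s.arr (arrFrom false)) G.Eneg.card = negEdges G := by
    rw [← hk]; exact hS.neg
  have hst := stage_spec hn hpos hun (b := false) hS hP.r_pos hk
    (hP.r_pos.trans_le hP.r_le) hkn (by rw [hneg]; exact nodup_negEdges)
    (by rw [hneg]; exact fun e he => mem_negEdges.1 he) hdone hflag hP.big_le hP.s_le
  -- If the first stage has ended with a final result, the remainder of the trial does nothing and
  -- is successful with certainty.
  have hsecond : ∀ s1, Ready G s1 ∧ Frame (stage false) s s1 ∧ StageOutcome G false s s1 →
      PTri (.ite (.eq regFlag regOne) secondStage .skip) s1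
        (stageTime n m (s.reg regR) + 18 + 1)
        (if s1.reg regDone = 1 ∨ s1.reg regFlag = 1 then 1 / 8 else 0)
        (TrialInv G) fun s' => s'.reg regDone = 1 := by
    rintro s1 ⟨hS1, f1, h1⟩
    have hP1 : Params G.Eneg.card s1 := hP.of_frame f1
    have hr1 : s1.reg regR = s.reg regR := f1.reg _
    refine PTri.ite (fun hb => ?_) fun hb => ?_
    · have hb : s1.reg regFlag = 1 := by simpa [Test.Holds, hS1.one] using hb
      cases h1 with
      | cycle h1 h2 h3 h4 => omega
      | independent h1 h2 h3 h4 h5 => omega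
      | unlucky h1 h2 => omega
      | many h1 h2 h3 h4 h5 =>
        rw [show regFrom false = regK from rfl, hk, hneg] at h3 h4
        have h4 : cells (s1.arr arrMid) (s1.reg regMid) = _ := h4
        have h5 : s.reg regBig ≤ s1.reg regMid := h5
        have hle : s1.reg regMid ≤ n := by
          have := congrArg List.length h4
          rw [length_cells] at this
          rw [this]
          refine (List.length_filter_le _ _).trans ?_
          rw [length_negEdges]
          exact hkn
        have := secondStage_spec hn hpos hun hS1 hP1 h1 (mem_negEdges.1 h3) hle
          (by rw [f1.reg regBig]; exact h5) (by rw [h4]; exact nodup_negEdges.filter _)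
          (fun e he => by
            rw [h4] at he
            exact mem_negEdges.1 (List.mem_of_mem_filter he))
          (fun e he => by
            rw [h4] at he
            simp only [List.mem_filter, decide_eq_true_eq] at he
            exact rel_not.1 he.2)
        rw [hr1] at this
        refine this.mono le_rfl ?_ (fun _ h => h) fun _ _ h => h
        split_ifs <;> norm_num
    · have hb : ¬ s1.reg regFlag = 1 := by simpa [Test.Holds, hS1.one] using hb
      have hinv : TrialInv G s1 := by
        refine ⟨hS1, hP1, ?_, ?_⟩
        · cases h1 <;> omega
        · cases h1 with
          | cycle h1 h2 h3 h4 => exact .inr ⟨h1, .cycle h3 h4⟩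
          | independent h1 h2 h3 h4 h5 =>
            exact .inr ⟨h1, .independent h3 h4 (by rwa [← f1.reg regS] at h5)⟩
          | unlucky h1 h2 => exact .inl h1
          | many h1 h2 h3 h4 h5 => omega
      refine (PTri.of_tri (P := s1.reg regDone = 1 ∨ s1.reg regFlag = 1) (Tri.skip (s := s1)
        ⟨hinv, fun h => h.resolve_right hb⟩)).mono (by omega) ?_ (fun _ h => h) fun _ _ h => h
      split_ifs <;> norm_num
  refine (hst.seq (q := .ite (.eq regFlag regOne) secondStage .skip)
    (ρ₂ := 1 / 8) (by norm_num) (fun s1 h => (hsecond s1 h).mono le_rfl ?_ (fun _ h => h)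
      fun _ _ h => h) fun s1 h h' => by simpa [h'] using hsecond s1 h).mono ?_ (by norm_num)
      (fun _ h => h) fun _ _ h => h
  · split_ifs <;> norm_num
  · have := stageTime_mono (n := n) (m := m) (hP.r_le.trans hkn)
    simp only [trialTime]
    omega

end

/-! ### Preparing the memory -/

/-- Number the leaves of the tournament tree. -/
def initLeaves : Prog :=
  .seq (block [.const regOne 1, .copy regT regN]) <|
  forN regI regN (block [.store arrLeaf regI regT, .store arrTree regT regI, .succ regT regT])

/-- Fill the inner nodes of the tournament tree; register `regT` holds the number of nodes
plus one. -/
def initTree : Prog :=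
  .seq (.instr (.sub regP regT regOne)) <|
  .while (.lt regOne regP) (.seq combine (.instr (.sub regP regP regOne)))

/-- Insert the edge `regI` of `E⁺` into the adjacency lists of both directions; its ends are in
registers `regA` and `regB`, and its successor in `regT`. -/
def insertPos : Prog :=
  block [.load regE 4 regA, .store 5 regI regE, .store 4 regA regT,
    .load regE 6 regB, .store 7 regI regE, .store 6 regB regT]

/-- Insert the edge `regI` of `E⁻` into the list of these edges. -/
def insertNeg : Prog :=
  .seq (block [.store arrNegList regK regI, .succ regK regK, .rload rregA rarrW regI,
    .rneg rregA rregA])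
  (.ite (.rlt rregMax rregA) (.instr (.rcopy rregMax rregA)) .skip)

/-- Set up the lists of edges. -/
def initEdges : Prog :=
  forN regI regM <|
  .seq (block [.load regA arrTail regI, .load regB arrHead regI, .load regF arrNeg regI,
    .store arrTail' regI regA, .succ regT regI])
  (.ite (.eq regF regZero) insertPos insertNeg)

/-- Set up the memory. -/
def setup : Prog := .seq initLeaves (.seq initTree initEdges)

section
variable {n m : ℕ} {G : WDigraph n m}

theorem initLeaves_spec {s : State} (hn : s.reg regN = n) :
    Tri initLeaves s (n * 10 + 9) fun s' => s'.reg regOne = 1 ∧ s'.reg regT = 2 * n ∧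
      ∀ v < n, s'.arr arrLeaf v = n + v ∧ s'.arr arrTree (n + v) = v := by
  refine ((Tri.block (by simp [Instr.isRand]) (Q := fun s' => s'.reg regOne = 1 ∧
    s'.reg regT = n ∧ s'.reg regN = n) (by simp [Instr.eff, hn])).seq
    (B₂ := n * (7 + 3) + 3) fun s1 ⟨h1, h2, h3⟩ _ => (Tri.forN (fun j s' => s'.reg regOne = 1 ∧
    s'.reg regT = n + j ∧ ∀ v < j, s'.arr arrLeaf v = n + v ∧ s'.arr arrTree (n + v) = v) h3
    (by decide) rfl rfl ?_ ?_).mono le_rfl fun s' h _ =>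
    ⟨h.1, by rw [h.2.1]; omega, h.2.2⟩).mono_time
    (by simp; omega)
  · simp [h1, h2]
  · rintro j s hj hi - ⟨h1, h2, h3⟩
    refine Tri.block (by simp [Instr.isRand]) ⟨by simp [Instr.eff, h1],
      by simp [Instr.eff, h2, add_assoc], fun v hv => ?_⟩
    rcases Nat.lt_succ_iff_lt_or_eq.1 hv with hv | rfl
    · have h4 : v ≠ j := hv.ne
      simpa [Instr.eff, hi, h2, h4] using h3 v hv
    · simp [Instr.eff, hi, h2]

/-- All keys are `0` when the tree is set up, so it suffices that every node holds an element of
one of the leaves below it. The nodes `p` with `2 * p ≥ i` have got their elements when node `i` is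
to be processed; each inner node is computed twice, once from each child. -/
theorem initTree_spec {s : State} (hn : 0 < n) (h1 : s.reg regOne = 1)
    (hT : s.reg regT = 2 * n) (hleaf : ∀ v < n, s.arr arrTree (n + v) = v) :
    Tri initTree s (n * 66 + 3) fun s' => TreeShape n (s'.arr arrTree) := by
  refine ((Tri.instr rfl (Q := fun s' => s'.reg regP = 2 * n - 1)
    (by simp [Instr.eff, h1, hT])).seq (B₂ := (2 * n - 1) * 33 + 1) fun s1 hP1 f1 =>
    (Tri.while_inv (g := 2 * n - 1) (fun i s' => s'.reg regOne = 1 ∧ s'.reg regP = i ∧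
    1 ≤ i ∧ i < 2 * n ∧ (∀ v < n, s'.arr arrTree (n + v) = v) ∧
    ∀ p, 1 ≤ p → p < 2 * n → i ≤ 2 * p →
      s'.arr arrTree p < n ∧ ∃ t, (n + s'.arr arrTree p) / 2 ^ t = p) (fun i => i * 33)
    ?_ ?_).mono le_rfl ?_).mono_time (by omega)
  · rintro i s ⟨h1, hP, hi1, hin, hleaf, hgood⟩ hb
    replace hb : 2 ≤ i := Nat.succ_le_of_lt (by simpa [Test.Holds, hP, h1] using hb)
    refine ⟨30 + 1 + 1, (combine_spec h1 hP hb).seq fun s' ⟨hP', hH', j, z, hji, hj, hT', hz, _, _⟩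
      f => Tri.instr rfl ⟨i - 1, ⟨?_, ?_, by omega, by omega, fun v hv => ?_,
        fun p hp hpn hip => ?_⟩,
        by omega⟩⟩
    · simp [Instr.eff, f.reg regOne, h1]
    · simp [Instr.eff, hP', f.reg regOne, h1]
    · simp only [Instr.eff, State.setReg_arr, hT', Function.update_apply]
      rw [if_neg (by omega), hleaf v hv]
    · simp only [Instr.eff, State.setReg_arr, hT', Function.update_apply]
      split_ifs with hpi
      · subst hpi
        have key : ∀ c, c / 2 = i / 2 → z = s.arr arrTree c →
            z < n ∧ ∃ t, (n + z) / 2 ^ t = i / 2 := by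
          rintro c hc rfl
          obtain ⟨h1, t, ht⟩ := hgood c (by omega) (by omega) (by omega)
          exact ⟨h1, t + 1, by rw [pow_succ, ← Nat.div_div_eq_div_mul, ht, hc]⟩
        rcases hz with hz | hz
        · exact key i rfl hz
        · exact key j hji hz
      · exact hgood p hp hpn (by omega)
  · refine ⟨(f1.reg _).trans h1, hP1, by omega, by omega, by rw [f1.arr arrTree]; exact hleaf,
      fun p hp hpn hip => ?_⟩
    obtain ⟨v, rfl⟩ := Nat.exists_eq_add_of_le (show n ≤ p by omega)
    rw [f1.arr arrTree, hleaf v (by omega)]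
    exact ⟨by omega, 0, by simp⟩
  · rintro s' ⟨⟨i, h1, hP, hi1, hin, hleaf, hgood⟩, hb⟩ _
    replace hb : i = 1 := by
      simp [Test.Holds, hP, h1] at hb
      omega
    exact ⟨fun p hp hpn => (hgood p hp hpn (by omega)).1,
      fun p hp hpn => (hgood p hp hpn (by omega)).2, hleaf⟩

theorem IsChain.congr {nxt nxt' : ℕ → ℕ} {l : List ℕ} {x : ℕ} (h : IsChain nxt x l)
    (hn : ∀ e ∈ l, nxt' e = nxt e) : IsChain nxt' x l := by
  induction l generalizing x with
  | nil => exact h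
  | cons e l ih =>
    refine ⟨h.1, ?_⟩
    rw [hn e (by simp)]
    exact ih h.2 fun e' he' => hn e' (by simp [he'])

/-- Adding the element `j` in front of the list with number `a`. -/
theorem IsChain.push {nxt fst : ℕ → ℕ} {l : ℕ → List ℕ} {a j : ℕ}
    (h : ∀ u < n, IsChain nxt (fst u) (l u)) (hl : ∀ u, ∀ e ∈ l u, e < j) {u : ℕ} (hu : u < n) :
    IsChain (Function.update nxt j (fst a)) (Function.update fst a (j + 1) u)
      (if a = u then j :: l u else l u) := by
  have hc : ∀ u < n, IsChain (Function.update nxt j (fst a)) (fst u) (l u) := fun u hu =>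
    (h u hu).congr fun e he => Function.update_of_ne (hl u e he).ne _ _
  split_ifs with hau
  · subst hau
    exact ⟨by simp, by simpa using hc a hu⟩
  · rw [Function.update_of_ne (Ne.symm hau)]
    exact hc u hu

open Classical in
/-- The list of the edges of `E⁺` with numbers below `j` that leave `u` in direction `d`. -/
noncomputable def adjPart (G : WDigraph n m) (d : Bool) (j u : ℕ) : List ℕ :=
  ((List.range j).filter fun e => endAt G (!d) e = u ∧ ¬ IsNeg G e).reverse

theorem adjPart_succ_of_neg {d : Bool} {j u : ℕ} (h : IsNeg G j) :
    adjPart G d (j + 1) u = adjPart G d j u := by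
  simp [adjPart, List.range_succ, List.filter_append, h]

theorem adjPart_succ_of_not {d : Bool} {j u : ℕ} (h : ¬ IsNeg G j) :
    adjPart G d (j + 1) u =
      if endAt G (!d) j = u then j :: adjPart G d j u else adjPart G d j u := by
  split_ifs with hu <;> simp [adjPart, List.range_succ, List.filter_append, h, hu]

theorem lt_of_mem_adjPart {d : Bool} {j u e : ℕ} (h : e ∈ adjPart G d j u) : e < j := by
  simp only [adjPart, List.mem_reverse, List.mem_filter, List.mem_range] at h
  exact h.1

/-- What `initEdges` has set up after it has processed the edges with numbers below `j`. -/
structure EdgeInv (G : WDigraph n m) (j : ℕ) (s : State) : Prop where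
  zero : s.reg regZero = 0
  dst : ∀ d, s.arr (arrDst d) = endAt G d
  bit : s.arr arrNeg = (inputState G).arr arrNeg
  weight : s.rarr rarrW = weightOf G
  tail' : ∀ e < j, s.arr arrTail' e = endAt G false e
  chain : ∀ d, ∀ u < n, IsChain (s.arr (arrNxt d)) (s.arr (arrFst d) u) (adjPart G d j u)
  neg : ∃ _hd : DecidablePred (IsNeg G), cells (s.arr arrNegList) (s.reg regK) =
    (List.range j).filter fun e => IsNeg G e
  max_nonneg : 0 ≤ s.rreg rregMax
  max_le : ∀ e < j, IsNeg G e → -weightOf G e ≤ s.rreg rregMax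

theorem inputState_bit {e : ℕ} (he : e < m) :
    (inputState G).arr arrNeg e = 0 ↔ ¬ IsNeg G e := by
  have h : IsNeg G e ↔ (⟨e, he⟩ : Fin m) ∈ G.Eneg := ⟨fun ⟨_, h⟩ => h, fun h => ⟨he, h⟩⟩
  rw [h]
  simp [inputState, he]

/-- One pass over the edges builds all lists and the maximum `rregMax`. -/
theorem initEdges_spec {s : State} (h0 : EdgeInv G 0 s) (hm : s.reg regM = m) :
    Tri initEdges s (m * 40 + 3) (EdgeInv G m) := by
  refine (Tri.forN (B := 29) (EdgeInv G) hm (by decide) rfl rfl ?_ ?_).mono_time (by omega)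
  · obtain ⟨h1, h2, h3, h4, h5, h6, h7, h8, h9⟩ := h0
    exact ⟨by simpa using h1, h2, h3, h4, h5, h6, by simpa using h7, h8, h9⟩
  rintro j s hj hi - ⟨hz, hdst, hbit, hw, htail, hchain, hneg, hmax0, hmax⟩
  have h0 := hdst false
  have h1 := hdst true
  simp only [arrDst] at h0 h1
  refine ((Tri.block (by simp [Instr.isRand]) (Q := fun s' => s'.reg regA = endAt G false j ∧
    s'.reg regB = endAt G true j ∧ s'.reg regF = (inputState G).arr arrNeg j ∧
    s'.reg regT = j + 1 ∧ s'.arr arrTail' = Function.update (s.arr arrTail') j (endAt G false j))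
    (by simp [Instr.eff, hi, h0, h1, hbit])).seq (B₂ := 16) fun s1 ⟨hA1, hB1, hF1, hT1, ht1⟩ f1 =>
    ?_).mono_time (by simp)
  have hi1 : s1.reg regI = j := (f1.reg _).trans hi
  have ht1' : ∀ e < j + 1, s1.arr arrTail' e = endAt G false e := fun e he => by
    rw [ht1, Function.update_apply]
    split_ifs with h
    · rw [h]
    · exact htail e (by omega)
  have hz1 : s1.reg regZero = 0 := (f1.reg _).trans hz
  have hd1 : ∀ d, s1.arr (arrDst d) = endAt G d := fun d =>
    (f1.arr _ (by cases d <;> rfl)).trans (hdst d)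
  have hb1 : s1.arr arrNeg = (inputState G).arr arrNeg := (f1.arr _).trans hbit
  have hw1 : s1.rarr rarrW = weightOf G := (f1.rarr _).trans hw
  have hx1 : s1.rreg rregMax = s.rreg rregMax := f1.rreg _
  have hn1 : s1.arr arrNegList = s.arr arrNegList := f1.arr _
  have hk1 : s1.reg regK = s.reg regK := f1.reg _
  have hc1 : ∀ d, ∀ u < n, IsChain (s1.arr (arrNxt d)) (s1.arr (arrFst d) u) (adjPart G d j u) :=
    fun d => by
      rw [f1.arr _ (by cases d <;> rfl), f1.arr _ (by cases d <;> rfl)]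
      exact hchain d
  obtain ⟨hdec, hneg⟩ := hneg
  refine Tri.ite (B := 15) (fun hb => ?_) fun hb => ?_
  · have hnot : ¬ IsNeg G j := by
      rw [← inputState_bit hj]
      simpa [Test.Holds, hF1, hz1] using hb
    refine (Tri.block (by simp [Instr.isRand]) (Q := fun s' => (∀ d, s'.arr (arrNxt d) =
      Function.update (s1.arr (arrNxt d)) j (s1.arr (arrFst d) (endAt G (!d) j)) ∧
      s'.arr (arrFst d) = Function.update (s1.arr (arrFst d)) (endAt G (!d) j) (j + 1))) ?_).mono
      (by simp) fun s2 h2 f2 => ?_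
    · rintro (_ | _) <;> simp [Instr.eff, hA1, hB1, hT1, hi1, arrNxt, arrFst]
    · refine ⟨?_, fun d => ?_, ?_, ?_, ?_, fun d u hu => ?_, ⟨hdec, ?_⟩, ?_, ?_⟩
      · simpa [f2.reg regZero] using hz1
      · exact (f2.arr _ (by cases d <;> rfl)).trans (hd1 d)
      · exact (f2.arr arrNeg).trans hb1
      · exact (f2.rarr rarrW).trans hw1
      · simpa [f2.arr arrTail'] using ht1'
      · rw [adjPart_succ_of_not hnot]
        simp only [State.setReg_arr, (h2 d).1, (h2 d).2]
        exact IsChain.push (hc1 d) (fun u e => lt_of_mem_adjPart) hu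
      · simp only [State.setReg_arr, State.setReg_reg]
        norm_num
        rw [f2.arr arrNegList, f2.reg regK, hn1, hk1, hneg, List.range_succ, List.filter_append]
        simp [hnot]
      · simpa [f2.rreg rregMax, hx1] using hmax0
      · intro e he hne
        simp only [State.setReg_rreg, f2.rreg rregMax, hx1]
        rcases Nat.lt_succ_iff_lt_or_eq.1 he with he | rfl
        · exact hmax e he hne
        · exact absurd hne hnot
  · have hne : IsNeg G j := by
      by_contra h
      rw [← inputState_bit hj] at h
      exact hb (by simpa [Test.Holds, hF1, hz1] using h)
    refine ((Tri.block (by simp [Instr.isRand]) (Q := fun s' => s'.rreg rregA = -weightOf G j ∧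
      cells (s'.arr arrNegList) (s'.reg regK) = (List.range (j + 1)).filter fun e => IsNeg G e)
      ?_).seq (B₂ := 2) (Q := fun s' => EdgeInv G (j + 1) (s'.setReg regI (j + 1)))
      fun s2 ⟨hA2, hl2⟩ f2 => ?_).mono_time (by simp)
    · refine ⟨by simp [Instr.eff, hi1, hw1], ?_⟩
      rw [List.range_succ, List.filter_append, ← hneg, ← hn1, ← hk1]
      simp only [List.filter_cons, hne, decide_true, if_true, List.filter_nil]
      rw [← cells_update]
      simp [Instr.eff, hi1]
    have hz2 : s2.reg regZero = 0 := (f2.reg _).trans hz1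
    have key : ∀ s3 : State, s3.reg = s2.reg → s3.arr = s2.arr → s3.rarr = s2.rarr →
        s3.rreg rregMax = max (s.rreg rregMax) (-weightOf G j) →
        EdgeInv G (j + 1) (s3.setReg regI (j + 1)) := by
      intro s3 e1 e2 e3 e4
      refine ⟨by simp [e1, hz2], fun d => ?_, ?_, ?_, ?_, fun d u hu => ?_, ⟨hdec, ?_⟩, ?_, ?_⟩
      · simp only [State.setReg_arr, e2]
        exact (f2.arr _ (by cases d <;> rfl)).trans (hd1 d)
      · simp only [State.setReg_arr, e2]
        exact (f2.arr _).trans hb1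
      · simp only [State.setReg_rarr, e3]
        exact (f2.rarr _).trans hw1
      · simp only [State.setReg_arr, e2, f2.arr arrTail']
        exact ht1'
      · rw [adjPart_succ_of_neg hne]
        simp only [State.setReg_arr, e2]
        rw [f2.arr _ (by cases d <;> rfl), f2.arr _ (by cases d <;> rfl)]
        exact hc1 d u hu
      · simpa [e1, e2] using hl2
      · simp only [State.setReg_rreg, e4]
        exact hmax0.trans (le_max_left _ _)
      · intro e he hne
        simp only [State.setReg_rreg, e4]
        rcases Nat.lt_succ_iff_lt_or_eq.1 he with he | rfl
        · exact (hmax e he hne).trans (le_max_left _ _)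
        · exact le_max_right _ _
    have hx2 : s2.rreg rregMax = s.rreg rregMax := (f2.rreg _).trans hx1
    refine Tri.ite (B := 1) (fun hb => Tri.instr rfl (key _ rfl rfl rfl ?_)) fun hb =>
      Tri.skip (key _ rfl rfl rfl ?_)
    · have hb : s.rreg rregMax < -weightOf G j := by simpa [Test.Holds, hx2, hA2] using hb
      simp [Instr.eff, hA2, max_eq_right hb.le]
    · have hb : -weightOf G j ≤ s.rreg rregMax := by simpa [Test.Holds, hx2, hA2] using hb
      rw [hx2, max_eq_left hb]

theorem setup_spec (hn : 0 < n) :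
    Tri setup (inputState G) (n * 76 + m * 40 + 20) fun s' => Ready G s' ∧
      s'.reg regDone = 0 ∧ s'.reg regFlag = 0 := by
  refine ((initLeaves_spec (n := n) (by simp [inputState])).seq
    (B₂ := (n * 66 + 3) + (m * 40 + 3) + 1) fun s1 ⟨hO1, hT1, hl1⟩ f1 => ?_).mono_time (by omega)
  refine (initTree_spec hn hO1 hT1 fun v hv => (hl1 v hv).2).seq fun s2 hT2 f2 => ?_
  have hedge : EdgeInv G 0 s2 := by
    classical
    refine ⟨?_, fun d => ?_, ?_, ?_, by simp, fun d u hu => ?_, ⟨inferInstance, ?_⟩, ?_, by simp⟩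
    · rw [f2.reg _, f1.reg _]; simp [inputState]
    · rw [f2.arr _ (by cases d <;> rfl), f1.arr _ (by cases d <;> rfl)]; rfl
    · rw [f2.arr _, f1.arr _]
    · rw [f2.rarr _, f1.rarr _]; rfl
    · rw [f2.arr (arrFst d) (by cases d <;> rfl), f1.arr (arrFst d) (by cases d <;> rfl)]
      cases d <;> simp [adjPart, IsChain, inputState, arrFst]
    · rw [f2.reg regK, f1.reg regK]
      simp [inputState, cells]
    · rw [f2.rreg _, f1.rreg _]; simp [inputState]
  refine (initEdges_spec hedge ?_).mono le_rfl fun s3 h3 f3 => ?_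
  · rw [f2.reg _, f1.reg _]; simp [inputState]
  obtain ⟨hz, hdst, -, hw, htail, hchain, ⟨hdec, hneg⟩, hmax0, hmax⟩ := h3
  have hleaf : ∀ v < n, s3.arr arrLeaf v = n + v := fun v hv => by
    rw [f3.arr _, f2.arr _, (hl1 v hv).1]
  have hK : s3.rarr rarrK = fun _ => 0 := by
    rw [f3.rarr _, f2.rarr _, f1.rarr _]
    funext i
    simp [inputState]
  have hO3 : s3.reg regOne = 1 := by rw [f3.reg _, f2.reg _, hO1]
  refine ⟨⟨⟨?_, ?_, hO3, hz, ?_, hdst, htail, hw, ?_, hleaf, ?_, hmax0,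
    fun e he => hmax e he.1 he⟩, ⟨hO3, hleaf, ?_, ?_⟩, ?_⟩, ?_, ?_⟩
  · rw [f3.reg _, f2.reg _, f1.reg _]; simp [inputState]
  · rw [f3.reg _, f2.reg _, f1.reg _]; simp [inputState]
  · rw [f3.rreg _, f2.rreg _, f1.rreg _]; simp [inputState]
  · exact hchain
  · rw [hneg, negEdges]
    congr!
  · rw [f3.arr arrTree]; exact hT2
  · simp [hK]
  · simp [hK]
  · rw [f3.reg _, f2.reg _, f1.reg _]; simp [inputState]
  · rw [f3.reg _, f2.reg _, f1.reg _]; simp [inputState]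

/-- Compute the numerical parameters from the number `k` of edges of `E⁻`: the loop finds the `j`
with `8 ^ j ≤ k < 8 ^ (j + 1)`, and `k / 4 ^ j` and `k / 2 ^ j`, which are of the orders of
`k ^ (1/3)` and `k ^ (2/3)`. -/
def setParams : Prog :=
  .seq (block [.copy regT regK, .copy regSmall regK, .copy regBig regK, .const regA 7]) <|
  .seq (.while (.lt regA regT) (block [.half regT regT, .half regT regT, .half regT regT,
    .half regSmall regSmall, .half regSmall regSmall, .half regBig regBig])) <|
  block [.half regR regSmall, .half regR regR, .half regR regR, .half regR regR, .half regR regR,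
    .half regS regR, .half regS regS, .half regS regS, .succ regS regS, .succ regR regR]

/-- With `q = 2 ^ j` one has `q ^ 3 ≤ k < 8 * q ^ 3`, so that `a = k / 4 ^ j` satisfies `q ≤ a < 8
* q`, and `b = k / 2 ^ j` satisfies `a * q ≤ b` and `b * q ≤ k`. Then `r = a / 32 + 1` is small
enough for the requirements `4 * (r - 1) * b ≤ k` and `4 * (r - 1) * a ≤ b`. -/
theorem setParams_spec {s : State} {k : ℕ} (hk : s.reg regK = k) (hk0 : 0 < k) :
    Tri setParams s (k * 14 + 40) (Params k) := by
  refine ((Tri.block (by simp [Instr.isRand]) (Q := fun s' => s'.reg regT = k ∧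
    s'.reg regSmall = k ∧ s'.reg regBig = k ∧ s'.reg regA = 7) (by simp [Instr.eff, hk])).seq
    (B₂ := (k * 14 + 1) + 21 + 1) fun s1 ⟨h1, h2, h3, h4⟩ _ => ?_).mono_time (by simp; omega)
  have hw := Tri.while_inv (b := .lt regA regT) (p := block [.half regT regT,
    .half regT regT, .half regT regT, .half regSmall regSmall, .half regSmall regSmall,
    .half regBig regBig]) (s := s1) (g := k) (fun t s' => s'.reg regT = t ∧ s'.reg regA = 7 ∧
    ∃ j, t = k / 8 ^ j ∧ s'.reg regSmall = k / 4 ^ j ∧ s'.reg regBig = k / 2 ^ j ∧ 8 ^ j ≤ k)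
    (fun t => t * 14) ?_ ?_
  rotate_left
  · rintro t s ⟨hT, hA, j, ht, hs, hb, hj⟩ hlt
    replace hlt : 7 < t := by simpa [Test.Holds, hT, hA] using hlt
    refine ⟨13, Tri.block (by simp [Instr.isRand]) ⟨t / 8, ⟨?_, ?_, j + 1, ?_, ?_, ?_, ?_⟩,
      by omega⟩⟩
    · simp [Instr.eff, hT]; omega
    · simp [Instr.eff, hA]
    · rw [ht, Nat.div_div_eq_div_mul, pow_succ]
    · simp [Instr.eff, hs, Nat.div_div_eq_div_mul, pow_succ, mul_assoc]
    · simp [Instr.eff, hb, Nat.div_div_eq_div_mul, pow_succ]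
    · rw [ht, Nat.lt_div_iff_mul_lt (by positivity)] at hlt
      rw [pow_succ]
      omega
  · exact ⟨h1, h4, 0, by simp, by simpa using h2, by simpa using h3,
      by simpa using Nat.succ_le_of_lt hk0⟩
  · refine hw.seq (B₂ := 21) fun s2 ⟨⟨t, hT, hA, j, ht, hs, hb, hj⟩, hnb⟩ _ => ?_
    replace hnb : k / 8 ^ j < 8 := by
      simp [Test.Holds, hT, hA] at hnb
      omega
    set q := 2 ^ j with hq
    set a := k / 4 ^ j with ha
    set b := k / 2 ^ j with hbdef
    have h4q : 4 ^ j = q * q := by rw [hq, ← mul_pow]; norm_num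
    have h8q : 8 ^ j = q * q * q := by rw [hq, ← mul_pow, ← mul_pow]; norm_num
    have hq0 : 0 < q := by positivity
    have hk8 : k < 8 * (q * q * q) := by
      rw [← h8q, mul_comm]
      rwa [Nat.div_lt_iff_lt_mul (by positivity), mul_comm] at hnb
    rw [h8q] at hj
    have hab : a = b / q := by rw [ha, hbdef, Nat.div_div_eq_div_mul, h4q]
    have hqa : q ≤ a := by
      rw [ha, h4q, Nat.le_div_iff_mul_le (by positivity)]
      linarith
    have haq : a < 8 * q := by
      rw [ha, h4q, Nat.div_lt_iff_lt_mul (by positivity)]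
      linarith
    have hbk : b * q ≤ k := Nat.div_mul_le_self _ _
    have hab' : a * q ≤ b := by rw [hab]; exact Nat.div_mul_le_self _ _
    have hb0 : 0 < b := lt_of_lt_of_le (Nat.mul_pos (hq0.trans_le hqa) hq0) hab'
    have hak : a ≤ k := Nat.div_le_self _ _
    have hcube : k ≤ (2 * a) ^ 3 := by
      have : (2 * q) ^ 3 ≤ (2 * a) ^ 3 := Nat.pow_le_pow_left (by omega) 3
      refine le_trans hk8.le (le_trans (le_of_eq ?_) this)
      ring
    have hr4 : 4 * (a / 32) ≤ q := by omega
    refine (Tri.block (by simp [Instr.isRand]) (Q := fun s' => s'.reg regR = a / 32 + 1 ∧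
      s'.reg regS = a / 256 + 1 ∧ s'.reg regBig = b ∧ s'.reg regSmall = a) ?_).mono (by simp)
      fun s3 ⟨e1, e2, e3, e4⟩ _ => ?_
    · simp [Instr.eff, hs, hb, Nat.div_div_eq_div_mul]
    · constructor <;> simp only [e1, e2, e3, e4, Nat.add_sub_cancel]
      · omega
      · omega
      · omega
      · exact hb0
      · calc 4 * (a / 32 * b) = 4 * (a / 32) * b := by ring
          _ ≤ q * b := Nat.mul_le_mul_right _ hr4
          _ ≤ k := by rwa [mul_comm]
      · calc 4 * (a / 32 * a) = 4 * (a / 32) * a := by ring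
          _ ≤ q * a := Nat.mul_le_mul_right _ hr4
          _ ≤ b := by rwa [mul_comm]
      · exact hcube.trans (Nat.pow_le_pow_left (by omega) 3)
      · exact hcube.trans (Nat.pow_le_pow_left (by omega) 3)

end

/-! ### Presenting the answer -/

/-- Copy the tails of the selected edges to the place where the answer is expected. -/
def outputSet : Prog :=
  .seq (forN regI regCnt (block [.load regF arrOut regI, .load regV arrTail' regF,
    .store arrTail regI regV])) <|
  block [.load regA arrTail' regX, .load regB arrTail' regY, .copy 1 regCnt, .copy 2 regA,
    .copy 3 regB, .copy 0 regKind]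

/-- Present the answer. -/
def output : Prog := .ite (.eq regKind regZero) (.instr (.const 0 0)) outputSet

section
variable {n m : ℕ} {G : WDigraph n m}

/-- The memory holds a result that is large in comparison with the number of edges of `E⁻`. -/
inductive Outcome (G : WDigraph n m) (s : State) : Prop
  | cycle (hkind : s.reg regKind = 0) (h : G.HasNegativeCycle)
  | sandwich (hkind : s.reg regKind = 1) (h : SandwichResult G s)
      (hs : G.Eneg.card ≤ (512 * s.reg regCnt) ^ 3)
  | independent (hkind : s.reg regKind = 2) (h : IndepResult G s)
      (hs : G.Eneg.card ≤ (512 * s.reg regCnt) ^ 3)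

theorem HasResult.outcome {s : State} (h : HasResult G s) (hP : Params G.Eneg.card s) :
    Outcome G s := by
  cases h with
  | cycle hkind h => exact .cycle hkind h
  | sandwich hkind h hs => exact .sandwich hkind h (hP.le_small.trans (by gcongr))
  | independent hkind h hs => exact .independent hkind h (hP.le_s.trans (by gcongr))

/-- The set of the tails of the edges with the numbers `f 0, …, f (c - 1)`. -/
noncomputable def tails (G : WDigraph n m) (f : ℕ → ℕ) (c : ℕ) : Finset (Fin n) := by
  classical
  exact Finset.univ.filter fun v => ∃ i < c, endAt G false (f i) = v

theorem mem_tails {f : ℕ → ℕ} {c : ℕ} {v : Fin n} :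
    v ∈ tails G f c ↔ ∃ i < c, endAt G false (f i) = v := by
  simp [tails]

/-- Different edges of `E⁻` have different tails. -/
theorem card_tails (hun : ∀ e ∈ G.Eneg, ∀ e', G.tail e' = G.tail e → e' = e) {f : ℕ → ℕ} {c : ℕ}
    (hnd : (cells f c).Nodup) (hneg : ∀ e ∈ cells f c, IsNeg G e) : (tails G f c).card = c := by
  have hneg' : ∀ i < c, IsNeg G (f i) := fun i hi => hneg _ (mem_cells.2 ⟨i, hi, rfl⟩)
  rw [cells_nodup_iff] at hnd
  refine Eq.trans (Finset.card_bij (s := Finset.range c) (fun i hi => ⟨endAt G false (f i),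
    endAt_lt false (hneg' i (Finset.mem_range.1 hi)).1⟩) (fun i hi => ?_) (fun i hi j hj h => ?_)
    fun v hv => ?_).symm (Finset.card_range c)
  · exact mem_tails.2 ⟨i, Finset.mem_range.1 hi, rfl⟩
  · rw [Finset.mem_range] at hi hj
    obtain ⟨h1, h1'⟩ := hneg' i hi
    obtain ⟨h2, h2'⟩ := hneg' j hj
    refine hnd i hi j hj (Fin.mk.inj_iff.1 (hun _ h2' ⟨f i, h1⟩ (Fin.ext ?_)))
    rw [← endAt_false h1, ← endAt_false h2]
    exact Fin.mk.inj_iff.1 h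
  · obtain ⟨i, hi, hv⟩ := mem_tails.1 hv
    exact ⟨i, Finset.mem_range.2 hi, Fin.ext hv⟩

theorem exists_of_mem_tails {f : ℕ → ℕ} {c : ℕ} (hneg : ∀ e ∈ cells f c, IsNeg G e) {v : Fin n}
    (hv : v ∈ tails G f c) :
    ∃ (e : ℕ) (h : e < m), e ∈ cells f c ∧ ⟨e, h⟩ ∈ G.Eneg ∧ G.tail ⟨e, h⟩ = v := by
  obtain ⟨i, hi, hv⟩ := mem_tails.1 hv
  have hc : f i ∈ cells f c := mem_cells.2 ⟨i, hi, rfl⟩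
  obtain ⟨h, hE⟩ := hneg _ hc
  exact ⟨f i, h, hc, hE, Fin.ext (by rw [← endAt_false h, hv])⟩

theorem SandwichResult.isNegativeSandwich {s : State} (h : SandwichResult G s) :
    G.IsNegativeSandwich (G.tail ⟨_, h.left.1⟩) (tails G (s.arr arrOut) (s.reg regCnt))
      (G.tail ⟨_, h.right.1⟩) where
  negative v hv := by
    obtain ⟨e, he, -, hE, htail⟩ := exists_of_mem_tails h.neg hv
    exact ⟨_, hE, htail⟩
  left v hv := by
    obtain ⟨e, he, hc, -, rfl⟩ := exists_of_mem_tails h.neg hv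
    obtain ⟨_, _, hrel⟩ := h.rel_left e hc
    simpa using hrel
  right v hv := by
    obtain ⟨e, he, hc, -, rfl⟩ := exists_of_mem_tails h.neg hv
    obtain ⟨_, _, hrel⟩ := h.rel_right e hc
    simpa using hrel

theorem IndepResult.isOneHopIndependent {s : State} (h : IndepResult G s) :
    G.IsOneHopIndependent (tails G (s.arr arrOut) (s.reg regCnt)) where
  negative v hv := by
    obtain ⟨e, he, -, hE, htail⟩ := exists_of_mem_tails h.neg hv
    exact ⟨_, hE, htail⟩
  independent v hv w hw := by
    obtain ⟨e, he, hce, -, rfl⟩ := exists_of_mem_tails h.neg hv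
    obtain ⟨f, hf, hcf, -, rfl⟩ := exists_of_mem_tails h.neg hw
    rintro (hr | hr)
    · exact h.indep e hce f hcf ⟨he, hf, by simpa using hr⟩
    · exact h.indep f hcf e hce ⟨hf, he, by simpa using hr⟩

theorem rpow_third_le {k c : ℕ} (h : k ≤ (512 * c) ^ 3) :
    1 / 512 * (k : ℝ) ^ ((1 : ℝ) / 3) ≤ c := by
  have h1 : (k : ℝ) ≤ (512 * c : ℝ) ^ 3 := by exact_mod_cast h
  have h2 : (k : ℝ) ^ ((1 : ℝ) / 3) ≤ 512 * c := by
    refine (Real.rpow_le_rpow (by positivity) h1 (by norm_num)).trans (le_of_eq ?_)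
    rw [one_div]
    exact Real.pow_rpow_inv_natCast (n := 3) (by positivity) (by norm_num)
  linarith

theorem outputSet_spec {s : State} (hS : Static G s)
    (hneg : ∀ e ∈ cells (s.arr arrOut) (s.reg regCnt), IsNeg G e) :
    Tri outputSet s (s.reg regCnt * 10 + 17) fun s' => s'.reg 0 = s.reg regKind ∧
      s'.reg 1 = s.reg regCnt ∧ s'.reg 2 = s.arr arrTail' (s.reg regX) ∧
      s'.reg 3 = s.arr arrTail' (s.reg regY) ∧
      ∀ i < s.reg regCnt, s'.arr 0 i = endAt G false (s.arr arrOut i) := by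
  have hloop : Tri (forN regI regCnt (block [.load regF arrOut regI, .load regV arrTail' regF,
      .store arrTail regI regV])) s (s.reg regCnt * (7 + 3) + 3) fun s' => ∀ i < s.reg regCnt,
        s'.arr 0 i = endAt G false (s.arr arrOut i) := by
    refine (Tri.forN (fun j s' => s'.arr arrOut = s.arr arrOut ∧ s'.arr arrTail' = s.arr arrTail' ∧
      ∀ i < j, s'.arr 0 i = endAt G false (s.arr arrOut i)) rfl (by decide) rfl rfl ?_ ?_).mono
      le_rfl fun s' h _ => h.2.2
    · simp
    · rintro j s1 hj hi - ⟨h1, h2, h3⟩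
      have ht : s.arr arrTail' (s.arr arrOut j) = endAt G false (s.arr arrOut j) :=
        hS.tail' _ (hneg _ (mem_cells.2 ⟨j, hj, rfl⟩)).1
      refine Tri.block (by simp [Instr.isRand]) ⟨by simpa [Instr.eff] using h1,
        by simpa [Instr.eff] using h2, fun i hij => ?_⟩
      rcases Nat.lt_succ_iff_lt_or_eq.1 hij with hij | rfl
      · simpa [Instr.eff, hi, hij.ne] using h3 i hij
      · simp [Instr.eff, hi, h1, h2, ht]
  refine (hloop.seq (B₂ := 13) fun s1 h1 f1 => Tri.block (by simp [Instr.isRand])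
    ⟨?_, ?_, ?_, ?_, ?_⟩).mono_time (by omega)
  · simp [Instr.eff, f1.reg regKind]
  · simp [Instr.eff, f1.reg regCnt]
  · simp [Instr.eff, f1.reg regX, f1.arr arrTail']
  · simp [Instr.eff, f1.reg regY, f1.arr arrTail']
  · simpa [Instr.eff] using h1

/-- A bound for the running time of `output`. -/
def outputTime (n : ℕ) : ℕ := n * 10 + 18

theorem output_spec (hun : ∀ e ∈ G.Eneg, ∀ e', G.tail e' = G.tail e → e' = e) {s : State}
    (hS : Static G s) (h : Outcome G s) :
    Tri output s (outputTime n) fun s' =>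
      ∃ A : Answer n, Presents s' A ∧ A.Correct G (1 / 512) := by
  have hcnt : (cells (s.arr arrOut) (s.reg regCnt)).Nodup →
      (∀ e ∈ cells (s.arr arrOut) (s.reg regCnt), IsNeg G e) → s.reg regCnt ≤ n := by
    intro hnd hneg
    rw [← card_tails hun hnd hneg]
    simpa using Finset.card_le_univ (tails G (s.arr arrOut) (s.reg regCnt))
  have htail : ∀ (e : ℕ) (he : e < m), s.arr arrTail' e = G.tail ⟨e, he⟩ := fun e he => by
    rw [hS.tail' e he, endAt_false he]
  have hlist : ∀ s' : State, (cells (s.arr arrOut) (s.reg regCnt)).Nodup →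
      (∀ e ∈ cells (s.arr arrOut) (s.reg regCnt), IsNeg G e) → s'.reg 1 = s.reg regCnt →
      (∀ i < s.reg regCnt, s'.arr 0 i = endAt G false (s.arr arrOut i)) →
      ListsSet s' (tails G (s.arr arrOut) (s.reg regCnt)) := by
    intro s' hnd hneg h1 h2
    refine ⟨by rw [h1, card_tails hun hnd hneg], fun v => ?_⟩
    rw [mem_tails, h1]
    exact exists_congr fun i => and_congr_right fun hi => by rw [h2 i hi]
  rw [outputTime]
  cases h with
  | cycle hkind h =>
    refine (Tri.ite (B := 1) (fun _ => Tri.instr rfl ⟨.cycle, ?_, h⟩) fun hb => ?_).mono_time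
      (by omega)
    · exact absurd (hkind.trans hS.zero.symm) hb
    · simp [Presents, Instr.eff]
  | sandwich hkind h hs =>
    refine Tri.ite (B := n * 10 + 17) (fun hb => ?_) fun _ =>
      (outputSet_spec hS h.neg).mono ?_ fun s' ⟨h0, h1, h2, h3, h4⟩ _ =>
        ⟨.sandwich _ _ _, ⟨h0.trans hkind, hlist s' h.nodup h.neg h1 h4,
          h2.trans (htail _ h.left.1),
          h3.trans (htail _ h.right.1)⟩, h.isNegativeSandwich, ?_⟩
    · have : s.reg regKind = s.reg regZero := hb
      rw [hkind, hS.zero] at this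
      exact absurd this one_ne_zero
    · have := hcnt h.nodup h.neg
      omega
    · rw [card_tails hun h.nodup h.neg]
      exact rpow_third_le hs
  | independent hkind h hs =>
    refine Tri.ite (B := n * 10 + 17) (fun hb => ?_) fun _ =>
      (outputSet_spec hS h.neg).mono ?_ fun s' ⟨h0, h1, h2, h3, h4⟩ _ =>
        ⟨.independent _, ⟨h0.trans hkind, hlist s' h.nodup h.neg h1 h4⟩, h.isOneHopIndependent, ?_⟩
    · have : s.reg regKind = s.reg regZero := hb
      rw [hkind, hS.zero] at this
      exact absurd this two_ne_zero
    · have := hcnt h.nodup h.neg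
      omega
    · rw [card_tails hun h.nodup h.neg]
      exact rpow_third_le hs

/-! ### The algorithm -/

/-- Set up the memory and compute the parameters; if there are no edges of `E⁻`, then the empty set
is the result. -/
def prepare : Prog :=
  .seq setup (.ite (.lt regZero regK) setParams
    (block [.const regKind 2, .const regCnt 0, .const regDone 1]))

/-- Repeat the trial until it is successful. -/
def algorithm : Prog := .seq prepare (.seq (.while (.eq regDone regZero) trial) output)

/-- The invariant of the main loop. -/
inductive LoopInv (G : WDigraph n m) (s : State) : Prop
  | unfinished (hdone : s.reg regDone = 0) (h : TrialInv G s)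
  | finished (hdone : s.reg regDone = 1) (hS : Static G s) (h : Outcome G s)

theorem TrialInv.loopInv {s : State} (h : TrialInv G s) : LoopInv G s := by
  rcases h.result with hd | ⟨hd, hr⟩
  · exact .unfinished hd h
  · exact .finished hd h.ready.toStatic (hr.outcome h.params)

theorem LoopInv.static {s : State} (h : LoopInv G s) : Static G s := by
  cases h with
  | unfinished _ h => exact h.ready.toStatic
  | finished _ hS _ => exact hS

theorem prepare_spec (hn : 0 < n)
    (hun : ∀ e ∈ G.Eneg, ∀ e', G.tail e' = G.tail e → e' = e) :
    Tri prepare (inputState G) (n * 90 + m * 40 + 62) (LoopInv G) := by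
  have hkn := card_neg_le hun
  refine ((setup_spec hn).seq (B₂ := n * 14 + 40 + 1) fun s1 ⟨hR, hdone, hflag⟩ _ =>
    Tri.ite (fun hb => ?_) fun hb => ?_).mono_time (by omega)
  · have hk0 : 0 < G.Eneg.card := by
      rw [← Static.regK_eq hR.toStatic]
      simpa [Test.Holds, hR.zero] using hb
    refine (setParams_spec (Static.regK_eq hR.toStatic) hk0).mono (by omega) fun s2 hP f2 => ?_
    exact TrialInv.loopInv ⟨hR.of_frame f2, hP, (f2.reg regFlag).trans hflag,
      .inl ((f2.reg regDone).trans hdone)⟩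
  · have hk0 : G.Eneg.card = 0 := by
      rw [← Static.regK_eq hR.toStatic]
      simpa [Test.Holds, hR.zero] using hb
    refine (Tri.block (by simp [Instr.isRand]) (Q := fun s' => s'.reg regKind = 2 ∧
      s'.reg regCnt = 0 ∧ s'.reg regDone = 1) (by simp [Instr.eff])).mono (by simp)
      fun s2 ⟨h1, h2, h3⟩ f2 => .finished h3 (hR.toStatic.of_frame f2) (.independent h1 ?_ ?_)
    · constructor <;> simp [h2, cells]
    · simp [hk0]

/-- A trial preserves the invariant of the main loop, and ends the loop with probability at least
`1 / 64`. -/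
theorem trial_loopInv (hn : 0 < n) (hpos : ∀ e, e ∉ G.Eneg → 0 ≤ G.w e)
    (hun : ∀ e ∈ G.Eneg, ∀ e', G.tail e' = G.tail e → e' = e) (s : State) (hI : LoopInv G s)
    (hb : (Test.eq regDone regZero).Holds s) :
    PTri trial s (trialTime n m) (1 / 64) (LoopInv G)
      fun s' => ¬ (Test.eq regDone regZero).Holds s' := by
  replace hb : s.reg regDone = 0 := hb.trans hI.static.zero
  cases hI with
  | unfinished _ h =>
    refine (trial_spec hn hpos hun h hb).mono le_rfl le_rfl (fun s' hs' => hs'.loopInv)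
      fun s' hs' hdone => ?_
    simp [Test.Holds, hdone, hs'.ready.zero]
  | finished hdone => omega

theorem LoopInv.outcome {s : State} (h : LoopInv G s)
    (hb : ¬ (Test.eq regDone regZero).Holds s) : Outcome G s := by
  cases h with
  | unfinished hdone h => exact absurd (hdone.trans h.ready.zero.symm) hb
  | finished _ _ h => exact h

/-- Whenever the algorithm halts, its answer is correct. -/
theorem algorithm_sound (hn : 0 < n) (hpos : ∀ e, e ∉ G.Eneg → 0 ≤ G.w e)
    (hun : ∀ e ∈ G.Eneg, ∀ e', G.tail e' = G.tail e → e' = e) {t : ℕ} {c : Config}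
    (hc : MayHalt ([algorithm], inputState G) c t) :
    ∃ A : Answer n, Presents c.2 A ∧ A.Correct G (1 / 512) := by
  obtain ⟨t1, -, h1⟩ := PTri.mayHalt_seq hc
  obtain ⟨_, s1, hbs1, -, hI1⟩ := prepare_spec hn hun
  obtain ⟨t2, -, h2⟩ := hbs1.mayHalt h1
  obtain ⟨t3, -, h3⟩ := PTri.mayHalt_seq h2
  obtain ⟨s4, hI4, hb4, t4, -, h4⟩ := mayHalt_while (trial_loopInv hn hpos hun) hI1 h3
  obtain ⟨_, s5, hbs5, -, hA⟩ := output_spec hun hI4.static (hI4.outcome hb4)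
  obtain ⟨t5, -, h5⟩ := hbs5.mayHalt h4
  have h6 := h5.1
  rw [run_of_halted (show Halted ([], s5) from rfl), PMF.mem_support_pure_iff] at h6
  rwa [h6]

/-- A bound for the running time of the algorithm with `i` trials. -/
def algorithmTime (n m i : ℕ) : ℕ := n * 100 + m * 40 + 83 + i * (trialTime n m + 1)

/-- The algorithm has halted after `i` trials unless all of them have failed. -/
theorem haltProb_algorithm_ge (hn : 0 < n) (hpos : ∀ e, e ∉ G.Eneg → 0 ≤ G.w e)
    (hun : ∀ e ∈ G.Eneg, ∀ e', G.tail e' = G.tail e → e' = e) (i : ℕ) :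
    1 - (63 / 64 : ℝ) ^ i ≤ haltProb ([algorithm], inputState G) (algorithmTime n m i) := by
  obtain ⟨t1, s1, hbs1, ht1, hI1⟩ := prepare_spec hn hun
  have hK : ∀ s, LoopInv G s → ¬ (Test.eq regDone regZero).Holds s →
      haltProb ([output], s) (outputTime n) = 1 := by
    intro s hs hb
    obtain ⟨t, s', hbs, ht, -⟩ := output_spec hun hs.static (hs.outcome hb)
    rw [← Nat.sub_add_cancel ht, hbs.haltProb_eq, haltProb_of_halted]
  have hwhile := haltProb_while_ge (by norm_num) (trial_loopInv hn hpos hun) hK i s1 hI1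
  rw [show (1 - 1 / 64 : ℝ) = 63 / 64 by norm_num] at hwhile
  refine hwhile.trans ?_
  rw [← PTri.haltProb_seq, ← hbs1.haltProb_eq, ← PTri.haltProb_seq]
  refine haltProb_mono _ ?_
  simp only [algorithmTime, outputTime]
  omega

/-! ### The running time -/

theorem trialTime_le (hn : 0 < n) (hm : 2 * n ≤ m) :
    trialTime n m + 1 ≤ 362 * (m * (Nat.log 2 (2 * n) + 1)) := by
  have hL : 2 ≤ Nat.log 2 (2 * n) + 1 := by
    have : 1 ≤ Nat.log 2 (2 * n) := (Nat.le_log_iff_pow_le (by norm_num) (by omega)).2 (by omega)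
    omega
  simp only [trialTime, stageTime, analyzeTime, thinTime, searchTime, dijkstraTime, treeTime]
  set l := Nat.log 2 (2 * n)
  have h1 : 2 * (n * l) ≤ m * l := by nlinarith
  have h2 : m ≤ m * l := Nat.le_mul_of_pos_right m (by omega)
  have h3 : l ≤ n * l := Nat.le_mul_of_pos_left l hn
  ring_nf
  ring_nf at h1 h2 h3
  omega

theorem log_two_mul_le (hn : 2 ≤ n) :
    ((Nat.log 2 (2 * n) + 1 : ℕ) : ℝ) ≤ 5 * Real.log n := by
  have h2 : (0.6931471803 : ℝ) < Real.log 2 := Real.log_two_gt_d9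
  have hlog : Real.log 2 ≤ Real.log n := Real.log_le_log (by norm_num) (by exact_mod_cast hn)
  have h1 : (Nat.log 2 (2 * n) : ℝ) * Real.log 2 ≤ Real.log 2 + Real.log n := by
    rw [← Real.log_pow, ← Real.log_mul (by norm_num) (by positivity)]
    refine Real.log_le_log (by positivity) ?_
    exact_mod_cast Nat.pow_log_le_self 2 (by omega : 2 * n ≠ 0)
  push_cast
  have h3 : (Nat.log 2 (2 * n) + 1 : ℝ) * Real.log 2 ≤ 5 * Real.log n * Real.log 2 := by
    nlinarith
  exact le_of_mul_le_mul_right h3 (by linarith)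

/-- The algorithm fails to be done after `64 * a * log n` trials with probability at most
`n ^ (-a)`. -/
theorem pow_trials_le (a : ℕ) (hn : 0 < n) :
    (63 / 64 : ℝ) ^ ⌈64 * a * Real.log n⌉₊ ≤ 1 / (n : ℝ) ^ a := by
  have h1 : (63 / 64 : ℝ) ≤ Real.exp (-(1 / 64)) := by
    have := Real.one_sub_le_exp_neg (1 / 64)
    linarith
  calc (63 / 64 : ℝ) ^ ⌈64 * a * Real.log n⌉₊
      ≤ Real.exp (-(1 / 64)) ^ ⌈64 * a * Real.log n⌉₊ := by gcongr
    _ = Real.exp (-(⌈64 * a * Real.log n⌉₊ / 64)) := by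
      rw [← Real.exp_nat_mul]
      ring_nf
    _ ≤ Real.exp (-(a * Real.log n)) := by
      have := Nat.le_ceil (64 * a * Real.log n)
      gcongr
      linarith
    _ = 1 / (n : ℝ) ^ a := by
      rw [Real.exp_neg, ← Real.log_pow, Real.exp_log (by positivity), one_div]

/-- The number of trials is `O(log n)`, and the time for each of them is `O(m log n)`. For `n = 1`
the right-hand side is `0`, so that `2 ≤ n` is needed. -/
theorem algorithmTime_le (a : ℕ) (hn : 2 ≤ n) (hm : 2 * n ≤ m) :
    (algorithmTime n m ⌈64 * a * Real.log n⌉₊ : ℝ) ≤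
      (532 + 1810 * (64 * a + 2)) * m * Real.log n ^ 2 := by
  have hlog : 1 / 2 ≤ Real.log n := by
    have h2 : (0.6931471803 : ℝ) < Real.log 2 := Real.log_two_gt_d9
    have := Real.log_le_log (by norm_num) (show (2 : ℝ) ≤ n by exact_mod_cast hn)
    linarith
  have hi : (⌈64 * a * Real.log n⌉₊ : ℝ) ≤ (64 * a + 2) * Real.log n := by
    have := (Nat.ceil_lt_add_one (show 0 ≤ 64 * a * Real.log n by positivity)).le
    linarith
  have ht : (trialTime n m + 1 : ℝ) ≤ 1810 * m * Real.log n := by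
    have h1 : (trialTime n m + 1 : ℝ) ≤ 362 * (m * (Nat.log 2 (2 * n) + 1 : ℕ)) := by
      exact_mod_cast trialTime_le (by omega) hm
    have h2 := mul_le_mul_of_nonneg_left (log_two_mul_le hn) (Nat.cast_nonneg (α := ℝ) m)
    linarith
  have h0 : (n * 100 + m * 40 + 83 : ℝ) ≤ 532 * m * Real.log n ^ 2 := by
    have h1 : (n * 100 + m * 40 + 83 : ℝ) ≤ 133 * m := by
      exact_mod_cast (by omega : n * 100 + m * 40 + 83 ≤ 133 * m)
    have h2 : 1 / 4 ≤ Real.log n ^ 2 := by nlinarith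
    have h3 := mul_le_mul_of_nonneg_left h2 (Nat.cast_nonneg (α := ℝ) m)
    linarith
  rw [algorithmTime]
  push_cast
  have h1 := mul_le_mul hi ht (by positivity) (by positivity)
  linarith

end
end FindSandwich

open FindSandwich in
theorem mainTheorem7 :
    ∃ (P : Prog) (δ : ℝ), 0 < δ ∧
      -- every halting run ends with a correct answer
      (∀ (n m : ℕ) (G : WDigraph n m), 0 < n → 2 * n ≤ m →
        (∀ e, e ∉ G.Eneg → 0 ≤ G.w e) →
        (∀ e ∈ G.Eneg, ∀ e', G.tail e' = G.tail e → e' = e) →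
        ∀ (t : ℕ) (c : Config), c ∈ (run ([P], inputState G) t).support → Halted c →
          ∃ A : Answer n, Presents c.2 A ∧ A.Correct G δ) ∧
      -- the running time is `O(m log² n)` with high probability
      (∀ a : ℕ, ∃ C : ℝ, ∀ (n m : ℕ) (G : WDigraph n m), 0 < n → 2 * n ≤ m →
        (∀ e, e ∉ G.Eneg → 0 ≤ G.w e) →
        (∀ e ∈ G.Eneg, ∀ e', G.tail e' = G.tail e → e' = e) →
        ENNReal.ofReal (1 - 1 / (n : ℝ) ^ a) ≤
          (run ([P], inputState G) ⌊C * m * Real.log n ^ 2⌋₊).toOuterMeasure {c | Halted c}) := by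
  refine ⟨algorithm, 1 / 512, by norm_num, fun n m G hn _ hpos hun t c hc hh =>
    algorithm_sound hn hpos hun ⟨hc, hh⟩, fun a => ⟨532 + 1810 * (64 * a + 2),
      fun n m G hn hm hpos hun => ?_⟩⟩
  rcases (show n = 1 ∨ 2 ≤ n by omega) with rfl | hn2
  -- For `n = 1` the required probability is `0`.
  · simp
  · rw [ENNReal.ofReal_le_iff_le_toReal
      (ne_top_of_le_ne_top ENNReal.one_ne_top (toOuterMeasure_le_one _ _))]
    calc 1 - 1 / (n : ℝ) ^ a ≤ 1 - (63 / 64 : ℝ) ^ ⌈64 * a * Real.log n⌉₊ := by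
          have := pow_trials_le a hn
          linarith
      _ ≤ _ := haltProb_algorithm_ge hn hpos hun _
      _ ≤ _ := haltProb_mono _ (Nat.le_floor (algorithmTime_le a hn2 hm))
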